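/- Let $0<a<1$. For $n\ge 1$ put $\lambda_n=\tfrac12 a^{1/2^{n+1}}$ and $\sigma_n=\lambda_1\cdots\lambda_n$, $\sigma_0=1$. Start with the closed unit square $[-\tfrac12,\tfrac12]^2\subset\mathbb C$ and, at step $n\ge1$, replace every square of side $\sigma_{n-1}$ by the four closed squares of side $\sigma_n$ inside it, with sides parallel to the axes, each containing one of its vertices. Let $L_n$ be the union of the $4^n$ squares obtained after $n$ steps and let $K_0=\bigcap_n L_n$. Then $K_0$ is a compact subset of the open unit disk $B(0,1)$ of area $a$, and $\int_{K_0}\frac{dA(w)}{|w-z|}<\infty$ for every $z\in\mathbb C$, where $A$ is area measure. Moreover, there are pairwise disjoint open disks $B(z_k,r_k)\subset B(0,1)\setminus K_0$ $(k=1,2,\dots)$ with $r_k>0$ and $\sum_k r_k<\infty$, whose set of accumulation points (the set of limits of subsequences of $(z_k)$) is exactly $K_0$, such that the following holds for the compact set $$K=\overline{B(0,1)}\setminus\bigcup_{k}B(z_k,r_k)$$ and the function $$\phi(z)=\int_{K_0}\frac{dA(w)}{w-z}\qquad(z\in K).$$ Let $C(K)$ carry the supremum norm, let $P(K)$ and $R(K)$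 be the closures in $C(K)$ of the polynomials in $z$ and of the rational functions with poles off $K$, let $A(K)$ be the algebra of those functions in $C(K)$ that are analytic in the interior of $K$, and, for $\phi\in C(K)$, let $HP(\phi,K)$ be the closure of $P(K)\phi+R(K)$ in $C(K)$. Then $\phi\in A(K)$ and $R(K)\ne A(K)$, yet $A(K)=HP(\phi,K)$. -/

import Mathlib

open MeasureTheory Filter Topology Polynomial

noncomputable section

/-! ### The planar Cantor set -/

/-- The proportion factor `λ_n = (1/2) a^{1 / 2^{n+1}}` used at step `n ≥ 1`. -/
def cantorRatio (a : ℝ) (n : ℕ) : ℝ :=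
  (1 / 2) * a ^ ((1 : ℝ) / 2 ^ (n + 1))

/-- The side length `σ_n = λ_1 λ_2 ⋯ λ_n` of the squares of the `n`-th generation. -/
def cantorSide (a : ℝ) (n : ℕ) : ℝ :=
  ∏ k ∈ Finset.Icc 1 n, cantorRatio a k

/-- The closed square with lower left corner `c`, side length `s`, and sides parallel to the
coordinate axes. -/
def closedSquare (c : ℂ) (s : ℝ) : Set ℂ :=
  {z | z.re ∈ Set.Icc c.re (c.re + s) ∧ z.im ∈ Set.Icc c.im (c.im + s)}

/-- The lower left corners of the `4 ^ n` squares of the `n`-th generation.  Generation `0` is the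
closed unit square centred at `0`; every square of side `σ_n` is replaced by the four
squares of side `σ_{n+1}` inside it that contain one of its vertices. -/
def cantorCorners (a : ℝ) : ℕ → Set ℂ
  | 0 => {⟨-(1 / 2), -(1 / 2)⟩}
  | n + 1 => {w | ∃ c ∈ cantorCorners a n, ∃ s ∈ ({0, cantorSide a n - cantorSide a (n + 1)} : Set ℝ),
      ∃ t ∈ ({0, cantorSide a n - cantorSide a (n + 1)} : Set ℝ), w = c + ⟨s, t⟩}

/-- `L_n`, the union of the squares of the `n`-th generation. -/
def cantorLevel (a : ℝ) (n : ℕ) : Set ℂ :=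
  ⋃ c ∈ cantorCorners a n, closedSquare c (cantorSide a n)

/-- The planar Cantor set `K₀ = ⋂ L_n`. -/
def planarCantor (a : ℝ) : Set ℂ := ⋂ n, cantorLevel a n

/-! ### The disks that are removed -/

/-- The disks `B(c k, r k)` are pairwise disjoint, lie in the open unit disk minus `K₀`, have
summable radii, and the points at which they accumulate are exactly the points of `K₀`
(as the radii tend to `0`, the disks accumulate where their centres do). -/
structure IsDiskSequence (K₀ : Set ℂ) (c : ℕ → ℂ) (r : ℕ → ℝ) : Prop where
  radius_pos : ∀ k, 0 < r k
  subset : ∀ k, Metric.ball (c k) (r k) ⊆ Metric.ball 0 1 \ K₀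
  disjoint : Pairwise fun j k => Disjoint (Metric.ball (c j) (r j)) (Metric.ball (c k) (r k))
  accumulate : ∀ x, MapClusterPt x atTop c ↔ x ∈ K₀
  summable : Summable r

/-- The closed unit disk minus the open disks `B(c k, r k)`. -/
def diskMinusDisks (c : ℕ → ℂ) (r : ℕ → ℝ) : Set ℂ :=
  Metric.closedBall 0 1 \ ⋃ k, Metric.ball (c k) (r k)

/-! ### Spaces of functions on a compact set `K`

For compact `K` the (compact-open) topology of `C(K, ℂ)` is that of the supremum norm. -/

/-- The restrictions to `K` of the rational functions with poles off `K`. -/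
def ratFunctions (K : Set ℂ) : Subalgebra ℂ C(K, ℂ) where
  carrier := {f | ∃ p q : ℂ[X], (∀ z ∈ K, q.eval z ≠ 0) ∧
    ∀ z : K, f z = p.eval (z : ℂ) / q.eval (z : ℂ)}
  mul_mem' := by
    rintro f g ⟨p, q, hq, hf⟩ ⟨p', q', hq', hg⟩
    refine ⟨p * p', q * q', fun z hz => ?_, fun z => ?_⟩
    · rw [eval_mul]
      exact mul_ne_zero (hq z hz) (hq' z hz)
    · rw [ContinuousMap.mul_apply, hf, hg, eval_mul, eval_mul, div_mul_div_comm]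
  add_mem' := by
    rintro f g ⟨p, q, hq, hf⟩ ⟨p', q', hq', hg⟩
    refine ⟨p * q' + q * p', q * q', fun z hz => ?_, fun z => ?_⟩
    · rw [eval_mul]
      exact mul_ne_zero (hq z hz) (hq' z hz)
    · rw [ContinuousMap.add_apply, hf, hg, eval_mul, eval_add, eval_mul, eval_mul,
        div_add_div _ _ (hq z z.2) (hq' z z.2)]
  algebraMap_mem' := by
    intro s
    refine ⟨C s, 1, fun z _ => by simp, fun z => by simp⟩

/-- `P(K)`: the closure in `C(K)` of the polynomials in `z`. -/
def polyClosure (K : Set ℂ) : Submodule ℂ C(K, ℂ) :=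
  (Subalgebra.toSubmodule (polynomialFunctions K)).topologicalClosure

/-- `R(K)`: the closure in `C(K)` of the rational functions with poles off `K`. -/
def ratClosure (K : Set ℂ) : Submodule ℂ C(K, ℂ) :=
  (Subalgebra.toSubmodule (ratFunctions K)).topologicalClosure

/-- `A(K)`: the continuous functions on `K` that are analytic in the interior of `K`. -/
def analyticAlgebra (K : Set ℂ) : Subalgebra ℂ C(K, ℂ) where
  carrier := {f | ∃ F : ℂ → ℂ, (∀ z : K, F z = f z) ∧ AnalyticOnNhd ℂ F (interior K)}
  mul_mem' := by
    rintro f g ⟨F, hf, hF⟩ ⟨G, hg, hG⟩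
    exact ⟨F * G, fun z => by simp [hf, hg], hF.mul hG⟩
  add_mem' := by
    rintro f g ⟨F, hf, hF⟩ ⟨G, hg, hG⟩
    exact ⟨F + G, fun z => by simp [hf, hg], hF.add hG⟩
  algebraMap_mem' := by
    intro s
    exact ⟨fun _ => s, fun z => by simp, analyticOnNhd_const⟩

/-- `HP(φ, K)`: the closure in `C(K)` of `P(K) φ + R(K)`. -/
def HP {K : Set ℂ} (φ : C(K, ℂ)) : Submodule ℂ C(K, ℂ) :=
  ((polyClosure K).map (LinearMap.mulRight ℂ φ) ⊔ ratClosure K).topologicalClosure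

/-- The Cauchy transform `z ↦ ∫ 1 / (w - z) dν(w)`. -/
def cauchyTransform (ν : Measure ℂ) (z : ℂ) : ℂ := ∫ w, 1 / (w - z) ∂ν

end

/-! Write `T h (z) = ∫_{K₀} h(w) / (w - z) dA(w)`, so that `φ = T 1`. For continuous `h` the kernel
is locally integrable, hence `T h` is continuous on the plane and holomorphic off `K₀`. The removed
disks have centres in every neighbourhood of every point of `K₀`, so the interior of `K` misses `K₀`
and `φ ∈ A(K)`.

`R(K) ≠ A(K)`. The functional `f ↦ ∮_{|z|=1} f - ∑ ∮_{∂B(z_k,r_k)} f` is bounded on `C(K)` because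
`∑ r_k < ∞`, and by residues it kills the rational functions with poles off `K`. At `φ` it equals
`-2πi · a ≠ 0`: Fubini evaluates the outer integral and Cauchy's theorem kills the others
(`cauchyTransform_notMem_ratClosure`).

`A(K) ⊆ HP(φ, K)`. (i) Laurent splitting around each removed disk detaches from `f ∈ A(K)` a
singular part that is a uniform limit of polynomials in `1 / (z - z_k)`. The disks are so small
compared with their mutual distances that these parts have a uniformly convergent sum, which lies in
`R(K)`. What remains is continuous on the plane and holomorphic in the unit disk off `K₀`
(`exists_sub_mem_ratClosure`). One more splitting removes a function of the disk algebra and leaves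
a function holomorphic off `K₀`.

(ii) Such a function is, up to a function holomorphic near the closed disk, a uniform limit of
transforms `T h` with `h` continuous (`exists_cauchy_approx`). This is Vitushkin's scheme. Averaging
over disks of radius `σ` gives the Cauchy transform of a density of size `ω / σ`, with `ω` the
modulus of continuity, supported within `σ` of `K₀` apart from a harmless far part
(`exists_density`). The density is cut along a grid of mesh `σ`, and each piece is replaced by one
carried by `K₀` with the same moments of orders 0 and 1 (`exists_matching_moments`). This is
possible with bounded constants because `K₀` has area at least `a σ²` in each disk of radius `2σ`
about its points, for `σ = σ_n`. Equal moments make each error decay like the inverse cube of the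
distance (`norm_areaCauchy_le_of_moments`), which is summable over a planar grid, so the total error
is `O(ω)`.

(iii) Distinct points of `K₀` are separated by lines that miss `K₀`, so polynomials are dense in
`C(K₀)` (`polynomialFunctions_dense`) and `h` may be taken to be a polynomial `p`. From `w / (w - z)
= 1 + z / (w - z)` follows `T p = p φ + q` with `q` a polynomial (`areaCauchy_polynomial`), an
element of `P(K) φ + R(K)`. The reverse inclusion holds because `A(K)` is a closed algebra
containing `φ` and `R(K)`. -/

noncomputable section

/-! ### The one-dimensional Cantor set -/

/-- Left end points of the intervals of generation `n`. -/
def lineCorners (a : ℝ) : ℕ → Finset ℝ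
  | 0 => {-(1 / 2)}
  | n + 1 => lineCorners a n ∪
      (lineCorners a n).image (fun x => x + (cantorSide a n - cantorSide a (n + 1)))

/-- The union of the intervals of generation `n`. -/
def lineLevel (a : ℝ) (n : ℕ) : Set ℝ :=
  ⋃ x ∈ lineCorners a n, Set.Icc x (x + cantorSide a n)

/-- The linear Cantor set whose square is `planarCantor a`. -/
def lineCantor (a : ℝ) : Set ℝ := ⋂ n, lineLevel a n

lemma mem_lineLevel {a : ℝ} {n : ℕ} {t : ℝ} :
    t ∈ lineLevel a n ↔ ∃ x ∈ lineCorners a n, x ≤ t ∧ t ≤ x + cantorSide a n := by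
  simp only [lineLevel, Set.mem_iUnion, Set.mem_Icc, exists_prop]

lemma mem_lineCorners_succ {a : ℝ} {n : ℕ} {y : ℝ} :
    y ∈ lineCorners a (n + 1) ↔
      ∃ x ∈ lineCorners a n, y = x ∨ y = x + (cantorSide a n - cantorSide a (n + 1)) := by
  simp only [lineCorners, Finset.mem_union, Finset.mem_image]
  constructor
  · rintro (h | ⟨x, hx, rfl⟩)
    · exact ⟨y, h, Or.inl rfl⟩
    · exact ⟨x, hx, Or.inr rfl⟩
  · rintro ⟨x, hx, rfl | rfl⟩
    · exact Or.inl hx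
    · exact Or.inr ⟨x, hx, rfl⟩

lemma cantorSide_zero (a : ℝ) : cantorSide a 0 = 1 := by simp [cantorSide]

lemma cantorSide_succ (a : ℝ) (n : ℕ) :
    cantorSide a (n + 1) = cantorSide a n * cantorRatio a (n + 1) := by
  simp [cantorSide, Finset.prod_Icc_succ_top]

/-- The exponents `1/4, 1/8, …, 1/2^(n+1)` add up to `1/2 - 1/2^(n+1)`. Their limit `1/2` gives the
linear Cantor set length `√a`, hence its square area `a`. -/
lemma cantorSide_eq {a : ℝ} (ha : 0 < a) (n : ℕ) :
    cantorSide a n = (1 / 2) ^ n * a ^ ((1 : ℝ) / 2 - 1 / 2 ^ (n + 1)) := by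
  induction n with
  | zero => simp [cantorSide_zero]
  | succ n ih =>
    rw [cantorSide_succ, ih, cantorRatio, mul_mul_mul_comm, ← pow_succ, ← Real.rpow_add ha]
    congr 2
    rw [pow_succ (2 : ℝ) (n + 1)]
    field_simp
    ring

lemma cantorSide_pos {a : ℝ} (ha : 0 < a) (n : ℕ) : 0 < cantorSide a n := by
  rw [cantorSide_eq ha]; positivity

lemma cantorSide_succ_lt {a : ℝ} (ha0 : 0 < a) (ha1 : a < 1) (n : ℕ) :
    2 * cantorSide a (n + 1) < cantorSide a n := by
  have h := cantorSide_pos ha0 n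
  have : a ^ ((1 : ℝ) / 2 ^ (n + 1 + 1)) < 1 :=
    Real.rpow_lt_one ha0.le ha1 (by positivity)
  rw [cantorSide_succ, cantorRatio]
  nlinarith

lemma cantorSide_le {a : ℝ} (ha0 : 0 < a) (ha1 : a < 1) (n : ℕ) :
    cantorSide a n ≤ (1 / 2) ^ n := by
  rw [cantorSide_eq ha0]
  refine mul_le_of_le_one_right (by positivity) (Real.rpow_le_one ha0.le ha1.le ?_)
  rw [sub_nonneg]
  exact one_div_le_one_div_of_le two_pos (le_self_pow₀ one_le_two (by omega))

lemma tendsto_cantorSide {a : ℝ} (ha0 : 0 < a) (ha1 : a < 1) :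
    Tendsto (cantorSide a) atTop (𝓝 0) :=
  squeeze_zero (fun n => (cantorSide_pos ha0 n).le) (cantorSide_le ha0 ha1)
    (tendsto_pow_atTop_nhds_zero_of_lt_one (by norm_num) (by norm_num))

lemma tendsto_two_pow_mul_cantorSide {a : ℝ} (ha : 0 < a) :
    Tendsto (fun n => 2 ^ n * cantorSide a n) atTop (𝓝 (√a)) := by
  have h1 : ∀ n : ℕ, 2 ^ n * cantorSide a n = a ^ ((1 : ℝ) / 2 - (1 / 2) ^ (n + 1)) := by
    intro n
    rw [cantorSide_eq ha, ← mul_assoc, ← mul_pow, one_div_pow]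
    norm_num
  simp_rw [h1]
  rw [Real.sqrt_eq_rpow]
  have h2 : Tendsto (fun n : ℕ => (1 : ℝ) / 2 - (1 / 2) ^ (n + 1)) atTop (𝓝 (1 / 2 - 0)) :=
    tendsto_const_nhds.sub ((tendsto_add_atTop_iff_nat 1).2
      (tendsto_pow_atTop_nhds_zero_of_lt_one (by norm_num) (by norm_num)))
  rw [sub_zero] at h2
  exact tendsto_const_nhds.rpow h2 (Or.inl ha.ne')

/-- Since `2 σ_{n+1} < σ_n`, the two children of an interval lie inside it with a gap between them,
and children of different parents inherit the gap of their parents. -/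
lemma lineCorners_separated {a : ℝ} (ha0 : 0 < a) (ha1 : a < 1) (n : ℕ) {x y : ℝ}
    (hx : x ∈ lineCorners a n) (hy : y ∈ lineCorners a n) (hxy : x < y) :
    x + cantorSide a n < y := by
  induction n generalizing x y with
  | zero =>
    simp only [lineCorners, Finset.mem_singleton] at hx hy
    exact absurd hxy (by rw [hx, hy]; exact lt_irrefl _)
  | succ n ih =>
    have h1 := cantorSide_succ_lt ha0 ha1 n
    have h2 := cantorSide_pos ha0 (n + 1)
    obtain ⟨x', hx', hx⟩ := mem_lineCorners_succ.1 hx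
    obtain ⟨y', hy', hy⟩ := mem_lineCorners_succ.1 hy
    rcases lt_trichotomy x' y' with h | h | h
    · have := ih hx' hy' h
      rcases hx with rfl | rfl <;> rcases hy with rfl | rfl <;> linarith
    · subst h
      rcases hx with rfl | rfl <;> rcases hy with rfl | rfl <;> linarith
    · have := ih hy' hx' h
      rcases hx with rfl | rfl <;> rcases hy with rfl | rfl <;> linarith

lemma eq_of_mem_Icc_lineCorners {a : ℝ} (ha0 : 0 < a) (ha1 : a < 1) {n : ℕ} {x y t : ℝ}
    (hx : x ∈ lineCorners a n) (hy : y ∈ lineCorners a n)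
    (h1 : x ≤ t ∧ t ≤ x + cantorSide a n) (h2 : y ≤ t ∧ t ≤ y + cantorSide a n) : x = y := by
  rcases lt_trichotomy x y with h | h | h
  · linarith [lineCorners_separated ha0 ha1 n hx hy h, h1.2, h2.1]
  · exact h
  · linarith [lineCorners_separated ha0 ha1 n hy hx h, h2.2, h1.1]

lemma card_lineCorners {a : ℝ} (ha0 : 0 < a) (ha1 : a < 1) (n : ℕ) :
    (lineCorners a n).card = 2 ^ n := by
  induction n with
  | zero => simp [lineCorners]
  | succ n ih =>
    have h1 := cantorSide_succ_lt ha0 ha1 n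
    have h2 := cantorSide_pos ha0 (n + 1)
    rw [lineCorners, Finset.card_union_of_disjoint, Finset.card_image_of_injective, ih]
    · ring
    · exact add_left_injective _
    · rw [Finset.disjoint_left]
      intro y hy hy'
      obtain ⟨x, hx, hxy⟩ := Finset.mem_image.1 hy'
      have := lineCorners_separated ha0 ha1 n hx hy (by linarith)
      linarith

lemma lineLevel_succ_subset {a : ℝ} (ha0 : 0 < a) (ha1 : a < 1) (n : ℕ) :
    lineLevel a (n + 1) ⊆ lineLevel a n := by
  intro t ht
  obtain ⟨y, hy, h1, h2⟩ := mem_lineLevel.1 ht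
  obtain ⟨x, hx, hxy⟩ := mem_lineCorners_succ.1 hy
  have h3 := cantorSide_succ_lt ha0 ha1 n
  have h4 := cantorSide_pos ha0 (n + 1)
  refine mem_lineLevel.2 ⟨x, hx, ?_⟩
  rcases hxy with rfl | rfl <;> constructor <;> linarith

lemma antitone_lineLevel {a : ℝ} (ha0 : 0 < a) (ha1 : a < 1) : Antitone (lineLevel a) :=
  antitone_nat_of_succ_le (lineLevel_succ_subset ha0 ha1)

lemma isClosed_lineLevel (a : ℝ) (n : ℕ) : IsClosed (lineLevel a n) :=
  isClosed_biUnion_finset fun _ _ => isClosed_Icc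

lemma isClosed_lineCantor (a : ℝ) : IsClosed (lineCantor a) :=
  isClosed_iInter (isClosed_lineLevel a)

lemma lineCantor_subset_Icc (a : ℝ) : lineCantor a ⊆ Set.Icc (-(1 / 2)) (1 / 2) := by
  intro t ht
  obtain ⟨x, hx, h1, h2⟩ := mem_lineLevel.1 (Set.mem_iInter.1 ht 0)
  simp only [lineCorners, Finset.mem_singleton] at hx
  subst hx
  rw [cantorSide_zero] at h2
  constructor <;> linarith

lemma volume_lineLevel {a : ℝ} (ha0 : 0 < a) (ha1 : a < 1) (n : ℕ) :
    volume (lineLevel a n) = ENNReal.ofReal (2 ^ n * cantorSide a n) := by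
  rw [lineLevel, measure_biUnion_finset]
  · simp only [Real.volume_Icc, add_sub_cancel_left, Finset.sum_const, card_lineCorners ha0 ha1,
      nsmul_eq_mul]
    rw [ENNReal.ofReal_mul (by positivity), ENNReal.ofReal_pow (by norm_num)]
    simp
  · intro x hx y hy hxy
    rw [Function.onFun, Set.disjoint_left]
    exact fun t h1 h2 => hxy (eq_of_mem_Icc_lineCorners ha0 ha1 hx hy h1 h2)
  · exact fun _ _ => measurableSet_Icc

lemma volume_lineCantor {a : ℝ} (ha0 : 0 < a) (ha1 : a < 1) :
    volume (lineCantor a) = ENNReal.ofReal (√a) := by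
  have h1 : Tendsto (fun n => volume (lineLevel a n)) atTop (𝓝 (volume (lineCantor a))) :=
    tendsto_measure_iInter_atTop
      (fun n => (isClosed_lineLevel a n).measurableSet.nullMeasurableSet)
      (antitone_lineLevel ha0 ha1)
      ⟨0, by rw [volume_lineLevel ha0 ha1]; exact ENNReal.ofReal_ne_top⟩
  refine tendsto_nhds_unique h1 ?_
  simp_rw [volume_lineLevel ha0 ha1]
  exact ENNReal.tendsto_ofReal (tendsto_two_pow_mul_cantorSide ha0)

/-- Self-similarity: the descendants of all intervals of generation `n` are arranged in the same
way. The common point `t` is what certifies that `y` descends from `x`. -/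
lemma lineCorners_translate {a : ℝ} (ha0 : 0 < a) (ha1 : a < 1) {n : ℕ} {x x' : ℝ}
    (hx : x ∈ lineCorners a n) (hx' : x' ∈ lineCorners a n) (k : ℕ) {y t : ℝ}
    (hy : y ∈ lineCorners a (n + k)) (ht : y ≤ t ∧ t ≤ y + cantorSide a (n + k))
    (hxt : x ≤ t ∧ t ≤ x + cantorSide a n) :
    y - x + x' ∈ lineCorners a (n + k) := by
  induction k generalizing y t with
  | zero =>
    have := eq_of_mem_Icc_lineCorners ha0 ha1 hx hy hxt ht
    subst this
    simpa using hx'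
  | succ k ih =>
    rw [← add_assoc] at hy ht ⊢
    obtain ⟨z, hz, hzy⟩ := mem_lineCorners_succ.1 hy
    have h3 := cantorSide_succ_lt ha0 ha1 (n + k)
    have h4 := cantorSide_pos ha0 (n + k + 1)
    have hzt : z ≤ t ∧ t ≤ z + cantorSide a (n + k) := by
      rcases hzy with rfl | rfl <;> constructor <;> linarith [ht.1, ht.2]
    refine mem_lineCorners_succ.2 ⟨z - x + x', ih hz hzt hxt, ?_⟩
    rcases hzy with rfl | rfl
    · exact Or.inl rfl
    · right; ring

lemma lineCantor_translate {a : ℝ} (ha0 : 0 < a) (ha1 : a < 1) {n : ℕ} {x x' : ℝ}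
    (hx : x ∈ lineCorners a n) (hx' : x' ∈ lineCorners a n) {t : ℝ} (ht : t ∈ lineCantor a)
    (hxt : x ≤ t ∧ t ≤ x + cantorSide a n) :
    t - x + x' ∈ lineCantor a := by
  have key : ∀ k, t - x + x' ∈ lineLevel a (n + k) := by
    intro k
    obtain ⟨y, hy, hyt⟩ := mem_lineLevel.1 (Set.mem_iInter.1 ht (n + k))
    exact mem_lineLevel.2 ⟨_, lineCorners_translate ha0 ha1 hx hx' k hy hyt hxt,
      by linarith [hyt.1], by linarith [hyt.2]⟩
  exact Set.mem_iInter.2 fun m => antitone_lineLevel ha0 ha1 (Nat.le_add_left m n) (key m)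

lemma volume_lineCantor_inter_le {a : ℝ} (ha0 : 0 < a) (ha1 : a < 1) {n : ℕ} {x x' : ℝ}
    (hx : x ∈ lineCorners a n) (hx' : x' ∈ lineCorners a n) :
    volume (lineCantor a ∩ Set.Icc x (x + cantorSide a n)) ≤
      volume (lineCantor a ∩ Set.Icc x' (x' + cantorSide a n)) := by
  rw [← measure_preimage_add_right volume (x' - x)
    (lineCantor a ∩ Set.Icc x' (x' + cantorSide a n))]
  refine measure_mono fun t ht => ?_
  have h := lineCantor_translate ha0 ha1 hx hx' ht.1 ht.2
  have e : t + (x' - x) = t - x + x' := by ring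
  refine ⟨by simpa only [e] using h, ?_, ?_⟩
  · linarith [ht.2.1]
  · linarith [ht.2.2]

/-- By translation the `2 ^ n` pieces of generation `n` have equal length, and together they cover a
set of length `√a`. -/
lemma volume_lineCantor_inter_ge {a : ℝ} (ha0 : 0 < a) (ha1 : a < 1) {n : ℕ} {x : ℝ}
    (hx : x ∈ lineCorners a n) :
    ENNReal.ofReal (√a / 2 ^ n) ≤ volume (lineCantor a ∩ Set.Icc x (x + cantorSide a n)) := by
  have h1 : lineCantor a ⊆ ⋃ y ∈ lineCorners a n,
      (lineCantor a ∩ Set.Icc y (y + cantorSide a n)) := by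
    intro t ht
    obtain ⟨y, hy, hyt⟩ := mem_lineLevel.1 (Set.mem_iInter.1 ht n)
    exact Set.mem_biUnion hy ⟨ht, hyt⟩
  have h2 : ENNReal.ofReal (√a) ≤
      2 ^ n * volume (lineCantor a ∩ Set.Icc x (x + cantorSide a n)) := by
    rw [← volume_lineCantor ha0 ha1]
    calc volume (lineCantor a) ≤ _ := measure_mono h1
      _ ≤ ∑ y ∈ lineCorners a n, volume (lineCantor a ∩ Set.Icc y (y + cantorSide a n)) :=
        measure_biUnion_finset_le _ _
      _ ≤ ∑ y ∈ lineCorners a n, volume (lineCantor a ∩ Set.Icc x (x + cantorSide a n)) :=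
        Finset.sum_le_sum fun y hy => volume_lineCantor_inter_le ha0 ha1 hy hx
      _ = _ := by
        rw [Finset.sum_const, card_lineCorners ha0 ha1, nsmul_eq_mul]; simp
  rw [ENNReal.ofReal_div_of_pos (by positivity), ENNReal.ofReal_pow (by norm_num)]
  refine ENNReal.div_le_of_le_mul' ?_
  simpa using h2

lemma exists_notMem_lineCantor {a : ℝ} (ha0 : 0 < a) (ha1 : a < 1) {x y : ℝ} (hxy : x < y)
    (hx : x ∈ lineCantor a) (hy : y ∈ lineCantor a) : ∃ t, x < t ∧ t < y ∧ t ∉ lineCantor a := by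
  obtain ⟨n, hn⟩ := ((tendsto_cantorSide ha0 ha1).eventually_lt_const (sub_pos.2 hxy)).exists
  obtain ⟨u, hu, hu1, hu2⟩ := mem_lineLevel.1 (Set.mem_iInter.1 hx n)
  obtain ⟨v, hv, hv1, hv2⟩ := mem_lineLevel.1 (Set.mem_iInter.1 hy n)
  have hs := cantorSide_pos ha0 n
  have huv : u < v := by
    rcases lt_trichotomy u v with h | h | h
    · exact h
    · linarith
    · linarith [lineCorners_separated ha0 ha1 n hv hu h]
  have hne : ((lineCorners a n).filter (u < ·)).Nonempty := ⟨v, by simp [hv, huv]⟩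
  -- At a generation with `σ_n < y - x` the two points lie in different intervals. With `w` the next
  -- corner after `u`, the open gap between the interval of `u` and `w` misses the Cantor set; its
  -- midpoint is the witness.
  set w := ((lineCorners a n).filter (u < ·)).min' hne with hw
  have hwm := Finset.min'_mem _ hne
  rw [← hw, Finset.mem_filter] at hwm
  have hwv : w ≤ v := Finset.min'_le _ _ (by simp [hv, huv])
  have huw := lineCorners_separated ha0 ha1 n hu hwm.1 hwm.2
  refine ⟨(u + cantorSide a n + w) / 2, by linarith, by linarith, fun ht => ?_⟩
  obtain ⟨z, hz, hz1, hz2⟩ := mem_lineLevel.1 (Set.mem_iInter.1 ht n)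
  rcases lt_trichotomy z u with h | h | h
  · linarith [lineCorners_separated ha0 ha1 n hz hu h]
  · subst h; linarith
  · have : w ≤ z := Finset.min'_le _ _ (by simp [hz, h])
    linarith

/-! ### The planar Cantor set as a product -/

lemma mem_cantorCorners {a : ℝ} {n : ℕ} {c : ℂ} :
    c ∈ cantorCorners a n ↔ c.re ∈ lineCorners a n ∧ c.im ∈ lineCorners a n := by
  induction n generalizing c with
  | zero => simp [cantorCorners, lineCorners, Complex.ext_iff]
  | succ n ih =>
    simp only [cantorCorners, Set.mem_ofPred_eq, mem_lineCorners_succ]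
    constructor
    · rintro ⟨c, hc, s, hs, t, ht, rfl⟩
      rw [ih] at hc
      refine ⟨⟨c.re, hc.1, ?_⟩, ⟨c.im, hc.2, ?_⟩⟩
      · rcases hs with rfl | rfl <;> simp
      · rcases ht with rfl | rfl <;> simp
    · rintro ⟨⟨x, hx, hx'⟩, ⟨y, hy, hy'⟩⟩
      refine ⟨⟨x, y⟩, ih.2 ⟨hx, hy⟩, c.re - x, ?_, c.im - y, ?_, ?_⟩
      · rcases hx' with h | h <;> simp [h]
      · rcases hy' with h | h <;> simp [h]
      · apply Complex.ext <;> simp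

lemma mem_cantorLevel {a : ℝ} {n : ℕ} {z : ℂ} :
    z ∈ cantorLevel a n ↔ z.re ∈ lineLevel a n ∧ z.im ∈ lineLevel a n := by
  simp only [cantorLevel, Set.mem_iUnion, mem_lineLevel, exists_prop, closedSquare,
    Set.mem_ofPred_eq, Set.mem_Icc]
  constructor
  · rintro ⟨c, hc, h1, h2⟩
    rw [mem_cantorCorners] at hc
    exact ⟨⟨_, hc.1, h1⟩, ⟨_, hc.2, h2⟩⟩
  · rintro ⟨⟨x, hx, h1⟩, ⟨y, hy, h2⟩⟩
    exact ⟨⟨x, y⟩, mem_cantorCorners.2 ⟨hx, hy⟩, h1, h2⟩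

lemma mem_planarCantor {a : ℝ} {z : ℂ} :
    z ∈ planarCantor a ↔ z.re ∈ lineCantor a ∧ z.im ∈ lineCantor a := by
  simp only [planarCantor, lineCantor, Set.mem_iInter, mem_cantorLevel, forall_and]

lemma planarCantor_eq (a : ℝ) : planarCantor a = lineCantor a ×ℂ lineCantor a := by
  ext z; rw [mem_planarCantor, Complex.mem_reProdIm]

lemma volume_reProdIm (s t : Set ℝ) :
    volume (s ×ℂ t) = volume s * volume t := by
  rw [← Measure.prod_prod, ← Measure.volume_eq_prod,
    ← Complex.volume_preserving_equiv_real_prod.measure_preimage_equiv]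
  congr 1

/-- The value `3/4` is a convenient rational between `√2 / 2` and `1`; it leaves an annulus inside
the unit disk that is free of `K₀`. -/
lemma norm_le_of_mem_planarCantor {a : ℝ} {z : ℂ} (hz : z ∈ planarCantor a) : ‖z‖ ≤ 3 / 4 := by
  rw [mem_planarCantor] at hz
  have h1 := lineCantor_subset_Icc a hz.1
  have h2 := lineCantor_subset_Icc a hz.2
  have h3 : ‖z‖ ^ 2 ≤ (3 / 4) ^ 2 := by
    rw [Complex.sq_norm, Complex.normSq_apply]
    nlinarith [h1.1, h1.2, h2.1, h2.2]
  exact le_of_sq_le_sq h3 (by norm_num)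

lemma isCompact_planarCantor (a : ℝ) : IsCompact (planarCantor a) := by
  refine Metric.isCompact_of_isClosed_isBounded ?_ ?_
  · have : planarCantor a = Complex.re ⁻¹' lineCantor a ∩ Complex.im ⁻¹' lineCantor a := by
      ext z; exact mem_planarCantor
    rw [this]
    exact ((isClosed_lineCantor a).preimage Complex.continuous_re).inter
      ((isClosed_lineCantor a).preimage Complex.continuous_im)
  · exact isBounded_iff_forall_norm_le.2 ⟨_, fun z => norm_le_of_mem_planarCantor⟩

lemma volume_planarCantor {a : ℝ} (ha0 : 0 < a) (ha1 : a < 1) :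
    volume (planarCantor a) = ENNReal.ofReal a := by
  rw [planarCantor_eq, volume_reProdIm, volume_lineCantor ha0 ha1,
    ← ENNReal.ofReal_mul (Real.sqrt_nonneg a), Real.mul_self_sqrt ha0.le]

/-- Every disk of radius `2 σ_n` about a point of `K₀` contains a fixed proportion of `K₀`. -/
lemma le_volume_planarCantor_inter {a : ℝ} (ha0 : 0 < a) (ha1 : a < 1) (n : ℕ) {p : ℂ}
    (hp : p ∈ planarCantor a) :
    ENNReal.ofReal (a * cantorSide a n ^ 2) ≤
      volume (planarCantor a ∩ Metric.closedBall p (2 * cantorSide a n)) := by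
  have hp' := mem_planarCantor.1 hp
  obtain ⟨x, hx, hx1, hx2⟩ := mem_lineLevel.1 (Set.mem_iInter.1 hp'.1 n)
  obtain ⟨y, hy, hy1, hy2⟩ := mem_lineLevel.1 (Set.mem_iInter.1 hp'.2 n)
  have h0 := cantorSide_le ha0 ha1 n
  have hs := cantorSide_pos ha0 n
  calc ENNReal.ofReal (a * cantorSide a n ^ 2)
      ≤ ENNReal.ofReal (√a / 2 ^ n * (√a / 2 ^ n)) := by
        refine ENNReal.ofReal_le_ofReal ?_
        rw [div_mul_div_comm, Real.mul_self_sqrt ha0.le, div_eq_mul_inv]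
        gcongr
        calc cantorSide a n ^ 2 ≤ ((1 / 2) ^ n) ^ 2 := by gcongr
          _ = _ := by rw [← mul_pow, ← inv_pow, ← pow_mul, pow_mul']; norm_num
    _ = ENNReal.ofReal (√a / 2 ^ n) * ENNReal.ofReal (√a / 2 ^ n) :=
        ENNReal.ofReal_mul (by positivity)
    _ ≤ volume (lineCantor a ∩ Set.Icc x (x + cantorSide a n)) *
        volume (lineCantor a ∩ Set.Icc y (y + cantorSide a n)) :=
        mul_le_mul' (volume_lineCantor_inter_ge ha0 ha1 hx) (volume_lineCantor_inter_ge ha0 ha1 hy)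
    _ = _ := (volume_reProdIm _ _).symm
    _ ≤ _ := by
        -- The square of generation `n` that contains `p` has side `σ_n`, so it lies in the disk of
        -- radius `2 σ_n` about `p`.
        refine measure_mono fun z hz => ?_
        obtain ⟨⟨h1, h2⟩, h3, h4⟩ := Complex.mem_reProdIm.1 hz
        refine ⟨mem_planarCantor.2 ⟨h1, h3⟩, ?_⟩
        rw [Metric.mem_closedBall, Complex.dist_eq]
        have e1 : |(z - p).re| ≤ cantorSide a n := by
          rw [Complex.sub_re, abs_le]; constructor <;> linarith [h2.1, h2.2]
        have e2 : |(z - p).im| ≤ cantorSide a n := by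
          rw [Complex.sub_im, abs_le]; constructor <;> linarith [h4.1, h4.2]
        linarith [Complex.norm_le_abs_re_add_abs_im (z - p)]

/-- Distinct points of `K₀` are separated by a line parallel to an axis that misses `K₀`. -/
lemma exists_separating_line {a : ℝ} (ha0 : 0 < a) (ha1 : a < 1) {z w : ℂ}
    (hz : z ∈ planarCantor a) (hw : w ∈ planarCantor a) (hzw : z ≠ w) :
    ∃ t, t ∉ lineCantor a ∧ (z.re < t ∧ t < w.re ∨ w.re < t ∧ t < z.re ∨
      z.im < t ∧ t < w.im ∨ w.im < t ∧ t < z.im) := by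
  rw [mem_planarCantor] at hz hw
  by_cases h : z.re = w.re
  · have h' : z.im ≠ w.im := fun h' => hzw (Complex.ext h h')
    rcases lt_or_gt_of_ne h' with h' | h'
    · obtain ⟨t, h1, h2, h3⟩ := exists_notMem_lineCantor ha0 ha1 h' hz.2 hw.2
      exact ⟨t, h3, by tauto⟩
    · obtain ⟨t, h1, h2, h3⟩ := exists_notMem_lineCantor ha0 ha1 h' hw.2 hz.2
      exact ⟨t, h3, by tauto⟩
  · rcases lt_or_gt_of_ne h with h' | h'
    · obtain ⟨t, h1, h2, h3⟩ := exists_notMem_lineCantor ha0 ha1 h' hz.1 hw.1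
      exact ⟨t, h3, by tauto⟩
    · obtain ⟨t, h1, h2, h3⟩ := exists_notMem_lineCantor ha0 ha1 h' hw.1 hz.1
      exact ⟨t, h3, by tauto⟩

lemma interior_planarCantor {a : ℝ} (ha0 : 0 < a) (ha1 : a < 1) :
    interior (planarCantor a) = ∅ := by
  refine Set.eq_empty_iff_forall_notMem.2 fun z hz => ?_
  obtain ⟨ε, hε, hb⟩ := Metric.isOpen_iff.1 isOpen_interior z hz
  have hb' : ∀ s : ℝ, 0 ≤ s → s < ε → z.re + s ∈ lineCantor a := by
    intro s hs hs'
    have : z + s ∈ planarCantor a := interior_subset (hb (by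
      simpa [Complex.dist_eq, abs_of_nonneg hs] using hs'))
    simpa using (mem_planarCantor.1 this).1
  have h0 := hb' 0 le_rfl hε
  have h1 := hb' (ε / 2) (by positivity) (by linarith)
  obtain ⟨t, h2, h3, h4⟩ := exists_notMem_lineCantor ha0 ha1 (by linarith) h0 h1
  apply h4
  have := hb' (t - z.re) (by linarith) (by linarith)
  simpa using this

/-! ### The Cauchy transform of a bounded density -/

/-- The Cauchy transform of the area measure with density `k`. -/
def areaCauchy (k : ℂ → ℂ) (z : ℂ) : ℂ := ∫ w, k w / (w - z)

/-- In polar coordinates the Jacobian `t` cancels the singularity `1 / t`. -/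
lemma integrableOn_inv_norm_sub (z : ℂ) (R : ℝ) :
    IntegrableOn (fun w : ℂ => ‖w - z‖⁻¹) (Metric.ball z R) := by
  have h : IntegrableOn (fun w : ℂ => ‖w‖⁻¹) (Metric.ball (0 : ℂ) R) := by
    refine (integrableOn_fun_norm_addHaar (μ := (volume : Measure ℂ)) (f := fun t => t⁻¹)).2 ?_
    rw [Complex.finrank_real_complex]
    refine (integrableOn_const (C := (1 : ℝ)) (by simp) (by simp)).congr_fun (fun y hy => ?_)
      measurableSet_Ioo
    simp [hy.1.ne']
  have h2 := (measurePreserving_sub_right volume z).integrableOn_comp_preimage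
    (measurableEmbedding_subRight z) (f := fun w : ℂ => ‖w‖⁻¹) (s := Metric.ball 0 R) |>.2 h
  have e : (fun x : ℂ => x - z) ⁻¹' Metric.ball 0 R = Metric.ball z R := by
    ext x; simp [Complex.dist_eq]
  rwa [e] at h2

lemma setIntegral_inv_norm_sub (z : ℂ) {R : ℝ} (hR : 0 ≤ R) :
    ∫ w in Metric.ball z R, ‖w - z‖⁻¹ = 2 * Real.pi * R := by
  have e : (fun x : ℂ => x - z) ⁻¹' Metric.ball 0 R = Metric.ball z R := by
    ext x; simp [Complex.dist_eq]
  have h2 := (measurePreserving_sub_right volume z).setIntegral_preimage_emb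
    (measurableEmbedding_subRight z) (fun w : ℂ => ‖w‖⁻¹) (Metric.ball 0 R)
  rw [e] at h2
  rw [h2]
  have h3 := integral_fun_norm_addHaar (volume : Measure ℂ) (fun t => (Set.Iio R).indicator (·⁻¹) t)
  rw [Complex.finrank_real_complex] at h3
  have e2 : ∀ w : ℂ, (Metric.ball (0 : ℂ) R).indicator (fun w : ℂ => ‖w‖⁻¹) w =
      (Set.Iio R).indicator (·⁻¹) ‖w‖ := by
    intro w; simp [Set.indicator]
  rw [← integral_indicator measurableSet_ball, integral_congr_ae (ae_of_all _ e2), h3]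
  have e3 : ∫ y in Set.Ioi (0 : ℝ), y ^ (2 - 1) • (Set.Iio R).indicator (·⁻¹) y = R := by
    calc _ = ∫ y in Set.Ioi (0 : ℝ), (Set.Iio R).indicator (fun _ => (1 : ℝ)) y := by
          refine setIntegral_congr_fun measurableSet_Ioi fun y hy => ?_
          have hy : (0 : ℝ) < y := hy
          by_cases h : y < R <;> simp [h, hy.ne']
      _ = R := by
          rw [setIntegral_indicator measurableSet_Iio]
          simp [Set.Ioi_inter_Iio, hR]
  rw [e3]
  simp [Measure.real, Complex.volume_ball]
  ring

lemma integrable_kernel {k : ℂ → ℂ} {B R : ℝ} (hk : AEStronglyMeasurable k volume)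
    (hB : ∀ w, ‖k w‖ ≤ B) (z : ℂ) (hs : ∀ w, k w ≠ 0 → w ∈ Metric.ball z R) :
    Integrable (fun w => k w / (w - z)) := by
  have h1 := ((integrable_indicator_iff measurableSet_ball).2
    (integrableOn_inv_norm_sub z R)).const_mul B
  refine h1.mono' (hk.aemeasurable.div (by fun_prop)).aestronglyMeasurable
    (ae_of_all _ fun w => ?_)
  by_cases h : k w = 0
  · have hB0 : 0 ≤ B := (norm_nonneg _).trans (hB w)
    simp only [h, zero_div, norm_zero]
    exact mul_nonneg hB0 (Set.indicator_nonneg (fun _ _ => by positivity) _)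
  · rw [Set.indicator_of_mem (hs w h), norm_div, div_eq_mul_inv]
    gcongr
    exact hB w

lemma integral_norm_kernel_le {k : ℂ → ℂ} {B R : ℝ} (hR : 0 ≤ R)
    (hB : ∀ w, ‖k w‖ ≤ B) (z : ℂ) (hs : ∀ w, k w ≠ 0 → w ∈ Metric.ball z R) :
    ∫ w, ‖k w / (w - z)‖ ≤ B * (2 * Real.pi * R) := by
  have h1 := ((integrable_indicator_iff measurableSet_ball).2
    (integrableOn_inv_norm_sub z R)).const_mul B
  rw [← setIntegral_inv_norm_sub z hR, ← integral_indicator measurableSet_ball,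
    ← integral_const_mul]
  refine integral_mono_of_nonneg (ae_of_all _ fun _ => norm_nonneg _) h1
    (ae_of_all _ fun w => ?_)
  beta_reduce
  by_cases h : k w = 0
  · have hB0 : 0 ≤ B := (norm_nonneg _).trans (hB w)
    simp only [h, zero_div, norm_zero]
    exact mul_nonneg hB0 (Set.indicator_nonneg (fun _ _ => by positivity) _)
  · rw [Set.indicator_of_mem (hs w h), norm_div, div_eq_mul_inv]
    gcongr
    exact hB w

lemma norm_areaCauchy_le {k : ℂ → ℂ} {B R : ℝ} (hR : 0 ≤ R)
    (hB : ∀ w, ‖k w‖ ≤ B) (z : ℂ) (hs : ∀ w, k w ≠ 0 → w ∈ Metric.ball z R) :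
    ‖areaCauchy k z‖ ≤ B * (2 * Real.pi * R) :=
  (norm_integral_le_integral_norm _).trans (integral_norm_kernel_le hR hB z hs)

lemma exists_mem_ball_of_support {k : ℂ → ℂ} {ρ : ℝ} (hs : ∀ w, k w ≠ 0 → ‖w‖ ≤ ρ) (z : ℂ) :
    ∀ w, k w ≠ 0 → w ∈ Metric.ball z (ρ + ‖z‖ + 1) := by
  intro w hw
  rw [Metric.mem_ball, Complex.dist_eq]
  linarith [hs w hw, norm_sub_le w z]

lemma integrable_kernel' {k : ℂ → ℂ} {B ρ : ℝ} (hk : AEStronglyMeasurable k volume)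
    (hB : ∀ w, ‖k w‖ ≤ B) (hs : ∀ w, k w ≠ 0 → ‖w‖ ≤ ρ) (z : ℂ) :
    Integrable (fun w => k w / (w - z)) :=
  integrable_kernel hk hB z (exists_mem_ball_of_support hs z)

lemma integrable_of_bounded_support {k : ℂ → ℂ} {B ρ : ℝ} (hk : AEStronglyMeasurable k volume)
    (hB : ∀ w, ‖k w‖ ≤ B) (hs : ∀ w, k w ≠ 0 → ‖w‖ ≤ ρ) : Integrable k := by
  have h1 : Integrable ((Metric.closedBall (0 : ℂ) ρ).indicator fun _ => B) :=
    (integrable_indicator_iff Metric.isClosed_closedBall.measurableSet).2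
      (integrableOn_const measure_closedBall_lt_top.ne)
  refine h1.mono' hk (ae_of_all _ fun w => ?_)
  by_cases h : k w = 0
  · have hB0 : 0 ≤ B := (norm_nonneg _).trans (hB w)
    rw [h, norm_zero]
    exact Set.indicator_nonneg (fun _ _ => hB0) _
  · rw [Set.indicator_of_mem (by simpa using hs w h)]
    exact hB w

lemma areaCauchy_add {k l : ℂ → ℂ} {z : ℂ} (hk : Integrable fun w => k w / (w - z))
    (hl : Integrable fun w => l w / (w - z)) :
    areaCauchy (fun w => k w + l w) z = areaCauchy k z + areaCauchy l z := by
  simp only [areaCauchy, add_div]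
  exact integral_add hk hl

lemma areaCauchy_sub {k l : ℂ → ℂ} {z : ℂ} (hk : Integrable fun w => k w / (w - z))
    (hl : Integrable fun w => l w / (w - z)) :
    areaCauchy (fun w => k w - l w) z = areaCauchy k z - areaCauchy l z := by
  simp only [areaCauchy, sub_div]
  exact integral_sub hk hl

/-- The kernel `1 / u` cut off near the origin. -/
def cutKernel (ε : ℝ) (u : ℂ) : ℂ :=
  (starRingEnd ℂ) u / ((max (‖u‖ ^ 2) (ε ^ 2) : ℝ) : ℂ)

lemma continuous_cutKernel {ε : ℝ} (hε : 0 < ε) : Continuous (cutKernel ε) := by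
  unfold cutKernel
  refine Complex.continuous_conj.div (Complex.continuous_ofReal.comp
    ((continuous_norm.pow 2).max continuous_const)) fun u => ?_
  rw [Ne, Complex.ofReal_eq_zero]
  exact (lt_max_of_lt_right (by positivity)).ne'

lemma norm_cutKernel_le {ε : ℝ} (hε : 0 < ε) (u : ℂ) : ‖cutKernel ε u‖ ≤ ε⁻¹ := by
  have h1 : 0 < max (‖u‖ ^ 2) (ε ^ 2) := lt_max_of_lt_right (by positivity)
  rw [cutKernel, norm_div, RCLike.norm_conj, Complex.norm_of_nonneg h1.le, div_le_iff₀ h1,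
    ← div_eq_inv_mul, le_div_iff₀ hε]
  rcases le_total ‖u‖ ε with h | h
  · exact le_max_of_le_right (by nlinarith [norm_nonneg u])
  · exact le_max_of_le_left (by nlinarith [norm_nonneg u])

lemma cutKernel_eq {ε : ℝ} {u : ℂ} (h0 : 0 ≤ ε) (h : ε ≤ ‖u‖) : cutKernel ε u = 1 / u := by
  rcases eq_or_ne u 0 with rfl | hu
  · simp [cutKernel]
  rw [cutKernel, max_eq_left (by gcongr), div_eq_div_iff (by simpa using hu) hu, one_mul,
    mul_comm, Complex.mul_conj, Complex.normSq_eq_norm_sq]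

lemma norm_inv_sub_cutKernel_le {ε : ℝ} (hε : 0 < ε) (u : ℂ) :
    ‖1 / u - cutKernel ε u‖ ≤ (Metric.ball (0 : ℂ) ε).indicator (fun u => 2 * ‖u‖⁻¹) u := by
  rcases le_or_gt ε ‖u‖ with h | h
  · rw [cutKernel_eq hε.le h, sub_self, norm_zero]
    exact Set.indicator_nonneg (fun _ _ => by positivity) _
  · rw [Set.indicator_of_mem (by simpa using h)]
    rcases eq_or_ne u 0 with rfl | hu
    · simp [cutKernel]
    have hu' : 0 < ‖u‖ := norm_pos_iff.2 hu
    have h2 : ‖cutKernel ε u‖ ≤ ‖u‖⁻¹ :=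
      (norm_cutKernel_le hε u).trans (inv_anti₀ hu' h.le)
    calc _ ≤ ‖1 / u‖ + ‖cutKernel ε u‖ := norm_sub_le _ _
      _ ≤ ‖u‖⁻¹ + ‖u‖⁻¹ := by gcongr; simp
      _ = _ := by ring

/-- Cutting the kernel off at distance `ε` gives a continuous function of `z` by dominated
convergence. The error is `O(ε)` uniformly in `z`, so the transform is a uniform limit of continuous
functions. -/
lemma continuous_areaCauchy {k : ℂ → ℂ} {B ρ : ℝ} (hk : AEStronglyMeasurable k volume)
    (hB : ∀ w, ‖k w‖ ≤ B) (hs : ∀ w, k w ≠ 0 → ‖w‖ ≤ ρ) : Continuous (areaCauchy k) := by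
  have hB0 : 0 ≤ B := (norm_nonneg _).trans (hB 0)
  have hki := integrable_of_bounded_support hk hB hs
  refine continuous_of_uniform_approx_of_continuous fun u hu => ?_
  obtain ⟨δ, hδ, hu⟩ := Metric.mem_uniformity_dist.1 hu
  -- The cut-off costs at most `B ∫_{|w-z|<ε} 2 / |w-z| = 4πBε`.
  obtain ⟨ε, hε, hεδ⟩ : ∃ ε > 0, B * (2 * (2 * Real.pi * ε)) < δ := by
    refine ⟨δ / (B * (2 * (2 * Real.pi)) + 1), by positivity, ?_⟩
    have : 0 < B * (2 * (2 * Real.pi)) + 1 := by positivity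
    calc B * (2 * (2 * Real.pi * (δ / (B * (2 * (2 * Real.pi)) + 1))))
        = (B * (2 * (2 * Real.pi))) * δ / (B * (2 * (2 * Real.pi)) + 1) := by ring
      _ < δ := by rw [div_lt_iff₀ this]; linarith
  have hint : ∀ z, Integrable fun w => k w * cutKernel ε (w - z) := fun z =>
    hki.mul_bdd (c := ε⁻¹) ((continuous_cutKernel hε).comp (by fun_prop)).aestronglyMeasurable
      (ae_of_all _ fun w => norm_cutKernel_le hε _)
  refine ⟨fun z => ∫ w, k w * cutKernel ε (w - z), ?_, fun z => hu ?_⟩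
  · refine continuous_of_dominated (bound := fun w => ‖k w‖ * ε⁻¹)
      (fun z => (hint z).aestronglyMeasurable) (fun z => ae_of_all _ fun w => ?_)
      (hki.norm.mul_const _) (ae_of_all _ fun w => ?_)
    · rw [norm_mul]; gcongr; exact norm_cutKernel_le hε _
    · exact continuous_const.mul ((continuous_cutKernel hε).comp (by fun_prop))
  · rw [Complex.dist_eq, areaCauchy, ← integral_sub (integrable_kernel' hk hB hs z) (hint z)]
    have h1 := (((integrable_indicator_iff measurableSet_ball).2
      (integrableOn_inv_norm_sub z ε)).const_mul 2).const_mul B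
    refine lt_of_le_of_lt (norm_integral_le_of_norm_le h1 (ae_of_all _ fun w => ?_)) ?_
    · have := norm_inv_sub_cutKernel_le hε (w - z)
      have e : k w / (w - z) - k w * cutKernel ε (w - z) =
          k w * (1 / (w - z) - cutKernel ε (w - z)) := by ring
      rw [e, norm_mul]
      refine mul_le_mul (hB w) (this.trans (le_of_eq ?_)) (norm_nonneg _) hB0
      by_cases h : w ∈ Metric.ball z ε
      · rw [Set.indicator_of_mem h, Set.indicator_of_mem (by simpa [Complex.dist_eq] using h)]
      · rw [Set.indicator_of_notMem h, Set.indicator_of_notMem (by simpa [Complex.dist_eq] using h),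
          mul_zero]
    · rw [integral_const_mul, integral_const_mul, integral_indicator measurableSet_ball,
        setIntegral_inv_norm_sub z hε.le]
      exact hεδ

/-- For `z` near a point of `U` the density lives at distance at least `δ / 2` from `z`, so
differentiation under the integral is dominated. -/
lemma differentiableOn_areaCauchy {k : ℂ → ℂ} {B ρ : ℝ} (hk : AEStronglyMeasurable k volume)
    (hB : ∀ w, ‖k w‖ ≤ B) (hs : ∀ w, k w ≠ 0 → ‖w‖ ≤ ρ) {U : Set ℂ} (hU : IsOpen U)
    (hkU : ∀ w ∈ U, k w = 0) : DifferentiableOn ℂ (areaCauchy k) U := by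
  intro z₀ hz₀
  obtain ⟨δ, hδ, hb⟩ := Metric.isOpen_iff.1 hU z₀ hz₀
  have hki := integrable_of_bounded_support hk hB hs
  have hfar : ∀ w, k w ≠ 0 → ∀ z ∈ Metric.ball z₀ (δ / 2), δ / 2 ≤ ‖w - z‖ := by
    intro w hw z hz
    have h1 : δ ≤ ‖w - z₀‖ := by
      by_contra! h
      exact hw (hkU w (hb (by rwa [Metric.mem_ball, Complex.dist_eq])))
    rw [Metric.mem_ball, Complex.dist_eq] at hz
    have : ‖w - z₀‖ ≤ ‖w - z‖ + ‖z - z₀‖ := by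
      simpa using norm_add_le (w - z) (z - z₀)
    linarith
  refine (hasDerivAt_integral_of_dominated_loc_of_deriv_le (μ := volume)
    (F := fun z w => k w / (w - z)) (F' := fun z w => k w / (w - z) ^ 2)
    (bound := fun w => ‖k w‖ * ((δ / 2) ^ 2)⁻¹)
    (Metric.ball_mem_nhds z₀ (half_pos hδ))
    (Eventually.of_forall fun z => (integrable_kernel' hk hB hs z).aestronglyMeasurable)
    (integrable_kernel' hk hB hs z₀)
    (hk.aemeasurable.div (by fun_prop)).aestronglyMeasurable
    (ae_of_all _ fun w z hz => ?_) (hki.norm.mul_const _)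
    (ae_of_all _ fun w z hz => ?_)).2.differentiableAt.differentiableWithinAt
  · by_cases h : k w = 0
    · simp [h]
    · have := hfar w h z hz
      rw [norm_div, norm_pow, div_eq_mul_inv]
      gcongr
  · by_cases h : k w = 0
    · simp [h, hasDerivAt_const]
    · have h1 := hfar w h z hz
      have h2 : w - z ≠ 0 := norm_pos_iff.1 (by linarith)
      have h3 : HasDerivAt (fun x => (w - x)⁻¹) (1 / (w - z) ^ 2) z := by
        simpa using ((hasDerivAt_id' z).const_sub w).fun_inv h2
      simpa only [div_eq_mul_inv, one_mul] using h3.const_mul (k w)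

/-! ### Disk averages as Cauchy transforms -/

lemma circleIntegral_inv_sub_of_notMem {c w : ℂ} {R : ℝ} (hR : 0 ≤ R)
    (hw : w ∉ Metric.closedBall c R) : (∮ v in C(c, R), (w - v)⁻¹) = 0 := by
  refine Complex.circleIntegral_eq_zero_of_differentiable_on_off_countable hR
    Set.countable_empty ?_ ?_
  · exact (continuousOn_const.sub continuousOn_id).inv₀ fun v hv h => hw (by
      rwa [show w = v from sub_eq_zero.1 h])
  · rintro v ⟨hv, -⟩
    exact ((differentiableAt_const w).sub differentiableAt_id).inv fun h =>
      hw (by rw [show w = v from sub_eq_zero.1 h]; exact Metric.ball_subset_closedBall hv)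

lemma circleIntegral_inv_sub_of_mem {c w : ℂ} {R : ℝ} (hw : w ∈ Metric.ball c R) :
    (∮ v in C(c, R), (w - v)⁻¹) = -(2 * Real.pi * Complex.I) := by
  rw [← circleIntegral.integral_sub_inv_of_mem_ball hw, ← neg_one_mul,
    ← circleIntegral.integral_const_mul]
  congr 1
  ext v
  rw [neg_one_mul, ← inv_neg, neg_sub]

lemma circleIntegral_eq_integral_restrict (f : ℂ → ℂ) (c : ℂ) (R : ℝ) :
    (∮ v in C(c, R), f v) = ∫ θ in Set.Ioc 0 (2 * Real.pi),
      (circleMap 0 R θ * Complex.I) * f (circleMap c R θ) := by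
  rw [circleIntegral, intervalIntegral.integral_of_le Real.two_pi_pos.le]
  simp only [deriv_circleMap, smul_eq_mul]

/-- The Cauchy transform of `w ↦ ∮ F(w + v) dv` is a disk average of `F`. -/
lemma areaCauchy_circleIntegral {F : ℂ → ℂ} (hF : Continuous F) {ρ : ℝ}
    (hs : ∀ w, F w ≠ 0 → ‖w‖ ≤ ρ) {ε : ℝ} (hε : 0 < ε) (z : ℂ) :
    areaCauchy (fun w => ∮ v in C(0, ε), F (w + v)) z =
      -(2 * Real.pi * Complex.I) * ∫ u in Metric.ball 0 ε, F (u + z) := by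
  set ν := (volume : Measure ℝ).restrict (Set.Ioc 0 (2 * Real.pi)) with hν
  obtain ⟨B, hB⟩ : ∃ B, ∀ w, ‖F w‖ ≤ B := by
    obtain ⟨B, hB⟩ := (isCompact_closedBall (0 : ℂ) ρ).exists_bound_of_continuousOn hF.continuousOn
    refine ⟨max B 0, fun w => ?_⟩
    by_cases h : F w = 0
    · simp [h]
    · exact (hB w (by simpa using hs w h)).trans (le_max_left _ _)
  have hB0 : 0 ≤ B := (norm_nonneg _).trans (hB 0)
  have hcm : Continuous (circleMap 0 ε) := continuous_circleMap 0 ε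
  set Φ : ℝ × ℂ → ℂ := fun p =>
    circleMap 0 ε p.1 * Complex.I * (F (p.2 + circleMap 0 ε p.1) / (p.2 - z)) with hΦ
  have hΦm : Measurable Φ := by
    have h1 : Measurable fun p : ℝ × ℂ => F (p.2 + circleMap 0 ε p.1) :=
      (hF.comp (by fun_prop)).measurable
    have h2 : Measurable fun p : ℝ × ℂ => circleMap 0 ε p.1 * Complex.I :=
      (by fun_prop : Continuous fun p : ℝ × ℂ => circleMap 0 ε p.1 * Complex.I).measurable
    exact h2.mul (h1.div (by fun_prop))
  have hΦi : Integrable Φ (ν.prod volume) := by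
    have h1 := (((integrable_indicator_iff measurableSet_ball).2
      (integrableOn_inv_norm_sub z (ρ + ε + ‖z‖ + 1))).const_mul (ε * B)).comp_snd ν
    refine h1.mono' hΦm.aestronglyMeasurable (ae_of_all _ fun p => ?_)
    by_cases h : F (p.2 + circleMap 0 ε p.1) = 0
    · simp only [hΦ, h, zero_div, mul_zero, norm_zero]
      exact mul_nonneg (by positivity) (Set.indicator_nonneg (fun _ _ => by positivity) _)
    · have h2 : p.2 ∈ Metric.ball z (ρ + ε + ‖z‖ + 1) := by
        have h3 := hs _ h
        have h4 := norm_sub_le (p.2 + circleMap 0 ε p.1) (circleMap 0 ε p.1)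
        rw [add_sub_cancel_right, norm_circleMap_zero, abs_of_pos hε] at h4
        rw [Metric.mem_ball, Complex.dist_eq]
        linarith [norm_sub_le p.2 z]
      rw [Set.indicator_of_mem h2]
      simp only [hΦ, norm_mul, norm_div, norm_circleMap_zero, abs_of_pos hε, Complex.norm_I,
        mul_one]
      rw [mul_assoc, div_eq_mul_inv]
      gcongr
      exact hB _
  -- Translating `w` by `z - v`, for each fixed `v` on the circle, moves the dependence on `v` from
  -- `F` to the kernel, which becomes `1 / (w - v)`. The contour integral of that kernel is `-2πi`
  -- for `w` inside the circle and `0` outside.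
  set T : ℝ × ℂ → ℝ × ℂ := fun p => (p.1, p.2 + (z - circleMap 0 ε p.1)) with hT
  have hTm : MeasurePreserving T (ν.prod volume) (ν.prod volume) := by
    refine (MeasurePreserving.id ν).skew_product (g := fun θ w => w + (z - circleMap 0 ε θ))
      ?_ (ae_of_all _ fun θ => map_add_right_eq_self volume _)
    exact (by fun_prop : Continuous fun p : ℝ × ℂ => p.2 + (z - circleMap 0 ε p.1)).measurable
  have hΨi : Integrable (Φ ∘ T) (ν.prod volume) :=
    hTm.integrable_comp hΦm.aestronglyMeasurable |>.2 hΦi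
  have hΨ : ∀ θ w, (Φ ∘ T) (θ, w) =
      circleMap 0 ε θ * Complex.I * (F (w + z) / (w - circleMap 0 ε θ)) := by
    intro θ w
    simp only [hΦ, hT, Function.comp]
    rw [show w + (z - circleMap 0 ε θ) + circleMap 0 ε θ = w + z by ring,
      show w + (z - circleMap 0 ε θ) - z = w - circleMap 0 ε θ by ring]
  calc areaCauchy (fun w => ∮ v in C(0, ε), F (w + v)) z
      = ∫ w, ∫ θ, Φ (θ, w) ∂ν := by
        refine integral_congr_ae (ae_of_all _ fun w => ?_)
        simp only [circleIntegral_eq_integral_restrict, hΦ, ← mul_div_assoc]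
        rw [integral_div]
    _ = ∫ θ, ∫ w, Φ (θ, w) ∂volume ∂ν := (integral_integral_swap hΦi).symm
    _ = ∫ θ, ∫ w, (Φ ∘ T) (θ, w) ∂volume ∂ν := by
        refine integral_congr_ae (ae_of_all _ fun θ => ?_)
        exact (integral_add_right_eq_self (fun w => Φ (θ, w)) (z - circleMap 0 ε θ)).symm
    _ = ∫ w, ∫ θ, (Φ ∘ T) (θ, w) ∂ν := integral_integral_swap hΨi
    _ = ∫ w, F (w + z) * ∮ v in C(0, ε), (w - v)⁻¹ := by
        refine integral_congr_ae (ae_of_all _ fun w => ?_)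
        simp only [hΨ, circleIntegral_eq_integral_restrict]
        rw [← integral_const_mul]
        refine integral_congr_ae (ae_of_all _ fun θ => ?_)
        simp only [div_eq_mul_inv]
        ring
    _ = ∫ w, (Metric.ball (0 : ℂ) ε).indicator
          (fun w => -(2 * Real.pi * Complex.I) * F (w + z)) w := by
        have h0 : ∀ᵐ w : ℂ, w ∉ Metric.sphere (0 : ℂ) ε :=
          measure_eq_zero_iff_ae_notMem.1 (Measure.addHaar_sphere _ _ _)
        refine integral_congr_ae (h0.mono fun w hw => ?_)
        by_cases h : w ∈ Metric.ball (0 : ℂ) ε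
        · simp only [Set.indicator_of_mem h, circleIntegral_inv_sub_of_mem h]
          ring
        · have h' : w ∉ Metric.closedBall (0 : ℂ) ε := by
            rw [← Metric.ball_union_sphere]
            simp only [Set.mem_union, not_or]
            exact ⟨h, hw⟩
          simp only [Set.indicator_of_notMem h, circleIntegral_inv_sub_of_notMem hε.le h', mul_zero]
    _ = _ := by
        rw [integral_indicator measurableSet_ball, integral_const_mul]

/-- A continuous compactly supported function is close to the Cauchy transform of a density
supported near the set where it is not holomorphic. -/
lemma exists_density {F : ℂ → ℂ} (hF : Continuous F) {ρ : ℝ}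
    (hs : ∀ w, F w ≠ 0 → ‖w‖ ≤ ρ) {ε ω : ℝ} (hε : 0 < ε)
    (hω : ∀ x y, ‖x - y‖ ≤ ε → ‖F x - F y‖ ≤ ω) :
    ∃ g : ℂ → ℂ, Continuous g ∧ (∀ w, ‖g w‖ ≤ ω / (Real.pi * ε)) ∧
      (∀ w, g w ≠ 0 → ‖w‖ ≤ ρ + ε) ∧
      (∀ w, (∀ x ∈ Metric.closedBall w ε, DifferentiableAt ℂ F x) → g w = 0) ∧
      ∀ z, ‖F z - areaCauchy g z‖ ≤ ω := by
  have hpi := Real.pi_pos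
  -- The factor `-2πi` comes from `areaCauchy_circleIntegral`, and `π ε²` turns the integral over
  -- the disk into an average. By Green's formula the density below is, for smooth `F`, the disk
  -- average of `-(1/π) ∂F/∂z̄`.
  set κ : ℂ := -(2 * Real.pi * Complex.I) * (Real.pi * ε ^ 2) with hκ
  have hκ0 : κ ≠ 0 := by
    simp [hκ, Real.pi_ne_zero, hε.ne', Complex.I_ne_zero]
  have hκn : ‖κ‖ = 2 * Real.pi * (Real.pi * ε ^ 2) := by
    simp [hκ, abs_of_pos hpi, abs_of_pos hε]
  have hcc : Continuous fun w => ∮ v in C(0, ε), F (w + v) := by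
    simp only [circleIntegral, deriv_circleMap, smul_eq_mul]
    apply intervalIntegral.continuous_parametric_intervalIntegral_of_continuous'
    have := continuous_circleMap (0 : ℂ) ε
    simp only [Function.uncurry_def]
    fun_prop
  refine ⟨fun w => κ⁻¹ * ∮ v in C(0, ε), F (w + v), continuous_const.mul hcc, fun w => ?_,
    fun w hw => ?_, fun w hw => ?_, fun z => ?_⟩
  -- The contour integral of a constant vanishes, so `F w` may be subtracted and only the
  -- oscillation `ω` enters: `2πεω / (2π · πε²) = ω / (πε)`.
  · have h1 : (∮ v in C(0, ε), F (w + v)) = ∮ v in C(0, ε), (F (w + v) - F w) := by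
      rw [circleIntegral.integral_sub]
      · have : (∮ v in C((0 : ℂ), ε), F w) = 0 :=
          Complex.circleIntegral_eq_zero_of_differentiable_on_off_countable hε.le
            Set.countable_empty continuousOn_const (fun _ _ => differentiableAt_const _)
        rw [this, sub_zero]
      · exact (hF.comp (by fun_prop)).continuousOn.circleIntegrable hε.le
      · exact continuousOn_const.circleIntegrable hε.le
    have h2 : ‖∮ v in C(0, ε), (F (w + v) - F w)‖ ≤ 2 * Real.pi * ε * ω := by
      refine circleIntegral.norm_integral_le_of_norm_le_const hε.le fun v hv => hω _ _ ?_
      rw [add_sub_cancel_left]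
      exact (mem_sphere_zero_iff_norm.1 hv).le
    rw [norm_mul, norm_inv, hκn, h1, inv_mul_le_iff₀ (by positivity)]
    refine h2.trans (le_of_eq ?_)
    field_simp
  · by_contra! h
    refine hw (mul_eq_zero_of_right _ ?_)
    rw [circleIntegral.integral_congr (g := fun _ => 0) hε.le]
    · simp [circleIntegral]
    intro v hv
    by_contra h2
    have h3 := hs _ h2
    have h4 := norm_sub_le (w + v) v
    rw [add_sub_cancel_right, mem_sphere_zero_iff_norm.1 hv] at h4
    linarith
  · refine mul_eq_zero_of_right _ ?_
    refine Complex.circleIntegral_eq_zero_of_differentiable_on_off_countable hε.le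
      Set.countable_empty (hF.comp (by fun_prop)).continuousOn ?_
    rintro v ⟨hv, -⟩
    have h1 := hw (w + v) (by
      rw [Metric.mem_closedBall, Complex.dist_eq, add_sub_cancel_left]
      exact (mem_ball_zero_iff.1 hv).le)
    exact h1.comp v (by fun_prop)
  · have h1 : areaCauchy (fun w => κ⁻¹ * ∮ v in C(0, ε), F (w + v)) z =
        κ⁻¹ * areaCauchy (fun w => ∮ v in C(0, ε), F (w + v)) z := by
      simp only [areaCauchy, mul_div_assoc]
      exact integral_const_mul _ _
    have hvol : volume.real (Metric.ball (0 : ℂ) ε) = Real.pi * ε ^ 2 := by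
      simp [Measure.real, Complex.volume_ball, hε.le]
      ring
    have h2 : ∫ u in Metric.ball (0 : ℂ) ε, F z = (Real.pi * ε ^ 2 : ℝ) * F z := by
      rw [setIntegral_const, hvol, Complex.real_smul]
    have hpe : ((Real.pi * ε ^ 2 : ℝ) : ℂ) ≠ 0 := by
      rw [Ne, Complex.ofReal_eq_zero]; positivity
    have hi1 : IntegrableOn (fun u => F (u + z)) (Metric.ball 0 ε) :=
      ((hF.comp (by fun_prop : Continuous fun u => u + z)).locallyIntegrable.integrableOn_isCompact
        (isCompact_closedBall 0 ε)).mono_set Metric.ball_subset_closedBall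
    have hi0 : IntegrableOn (fun _ => F z) (Metric.ball (0 : ℂ) ε) :=
      integrableOn_const measure_ball_lt_top.ne
    have h3 : F z - areaCauchy (fun w => κ⁻¹ * ∮ v in C(0, ε), F (w + v)) z =
        ((Real.pi * ε ^ 2 : ℝ) : ℂ)⁻¹ * ∫ u in Metric.ball (0 : ℂ) ε, (F z - F (u + z)) := by
      rw [h1, areaCauchy_circleIntegral hF hs hε, integral_sub hi0 hi1, h2, mul_sub, inv_mul_cancel_left₀ hpe, ← mul_assoc]
      congr 2
      rw [hκ]
      have : -(2 * Real.pi * Complex.I) ≠ 0 := by simp [Real.pi_ne_zero, Complex.I_ne_zero]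
      rw [mul_inv, mul_comm _ (-(2 * Real.pi * Complex.I)), mul_inv_cancel_left₀ this]
      push_cast
      rfl
    have h4 : ‖∫ u in Metric.ball (0 : ℂ) ε, (F z - F (u + z))‖ ≤ ω * (Real.pi * ε ^ 2) := by
      rw [← hvol]
      refine norm_setIntegral_le_of_norm_le_const measure_ball_lt_top fun u hu => hω _ _ ?_
      rw [sub_add_cancel_right, norm_neg]
      exact (mem_ball_zero_iff.1 hu).le
    rw [h3, norm_mul, norm_inv, Complex.norm_of_nonneg (by positivity),
      inv_mul_le_iff₀ (by positivity)]
    linarith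

/-! ### Matching moments on a set of positive area -/

/-- The cut-off function equal to `1` for `‖w - p‖ ≤ 2 σ` and to `0` for `‖w - p‖ ≥ 3 σ`. -/
def tent (p : ℂ) (σ : ℝ) (w : ℂ) : ℝ := max 0 (min 1 (3 - ‖w - p‖ / σ))

lemma continuous_tent (p : ℂ) (σ : ℝ) : Continuous (tent p σ) := by
  unfold tent; fun_prop

lemma tent_nonneg (p : ℂ) (σ : ℝ) (w : ℂ) : 0 ≤ tent p σ w := le_max_left _ _

lemma tent_le_one (p : ℂ) (σ : ℝ) (w : ℂ) : tent p σ w ≤ 1 :=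
  max_le zero_le_one (min_le_left _ _)

lemma tent_eq_one {p : ℂ} {σ : ℝ} (hσ : 0 < σ) {w : ℂ} (h : ‖w - p‖ ≤ 2 * σ) :
    tent p σ w = 1 := by
  have : ‖w - p‖ / σ ≤ 2 := (div_le_iff₀ hσ).2 h
  rw [tent, min_eq_left (by linarith), max_eq_right zero_le_one]

lemma norm_sub_le_of_tent_ne_zero {p : ℂ} {σ : ℝ} (hσ : 0 < σ) {w : ℂ} (h : tent p σ w ≠ 0) :
    ‖w - p‖ ≤ 3 * σ := by
  by_contra! h2
  have : 3 < ‖w - p‖ / σ := (lt_div_iff₀ hσ).2 h2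
  exact h (by rw [tent]; exact max_eq_left ((min_le_right _ _).trans (by linarith)))

/-- The second moment of a planar set of area `≥ A` about any point is at least `A² / (4π)`. -/
lemma second_moment_ge {S : Set ℂ} (hS : MeasurableSet S) {A : ℝ} (hA : 0 < A)
    (hvol : ENNReal.ofReal A ≤ volume S) (q : ℂ)
    (hi : IntegrableOn (fun w => ‖w - q‖ ^ 2) S) (hfin : volume S ≠ ⊤) :
    A ^ 2 / (4 * Real.pi) ≤ ∫ w in S, ‖w - q‖ ^ 2 := by
  have hpi := Real.pi_pos
  -- The radius is chosen so that `π ρ² = A / 2`: at least half of the area then lies at distance `≥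
  -- ρ` from `q`, and contributes at least `(A/2) ρ²`.
  set ρ : ℝ := √(A / (2 * Real.pi)) with hρ
  have hρ2 : ρ ^ 2 = A / (2 * Real.pi) := Real.sq_sqrt (by positivity)
  have h1 : A - Real.pi * ρ ^ 2 ≤ volume.real (S \ Metric.ball q ρ) := by
    have h2 : volume.real (Metric.ball q ρ) = Real.pi * ρ ^ 2 := by
      simp [Measure.real, Complex.volume_ball, hρ]
      ring
    have h3 : A ≤ volume.real S := (ENNReal.ofReal_le_iff_le_toReal hfin).1 hvol
    have h4 := le_measureReal_sdiff (μ := volume) (s₁ := S) (s₂ := Metric.ball q ρ)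
      measure_ball_lt_top.ne
    linarith
  have h5 : IntegrableOn (fun _ => ρ ^ 2) (S \ Metric.ball q ρ) :=
    integrableOn_const (ne_top_of_le_ne_top hfin (measure_mono Set.sdiff_subset))
  calc A ^ 2 / (4 * Real.pi) = (A - Real.pi * ρ ^ 2) * ρ ^ 2 := by
        rw [hρ2]; field_simp; ring
    _ ≤ volume.real (S \ Metric.ball q ρ) * ρ ^ 2 := by gcongr
    _ = ∫ w in S \ Metric.ball q ρ, ρ ^ 2 := by rw [setIntegral_const, smul_eq_mul]
    _ ≤ ∫ w in S \ Metric.ball q ρ, ‖w - q‖ ^ 2 := by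
        refine setIntegral_mono_on h5 (hi.mono_set Set.sdiff_subset)
          (hS.diff measurableSet_ball) fun w hw => ?_
        have : ρ ≤ ‖w - q‖ := by
          simpa [Complex.dist_eq] using hw.2
        gcongr
    _ ≤ ∫ w in S, ‖w - q‖ ^ 2 :=
        setIntegral_mono_set hi (ae_of_all _ fun _ => by positivity)
          (LE.le.eventuallyLE Set.sdiff_subset)

/-- The constant of `exists_matching_moments`. -/
def momentConst (a : ℝ) : ℝ := 1 / a + 96 * Real.pi / a ^ 2

/-- With `θ` the tent and `q = p + m` its centroid on `K`, take `h = θ · (s + t · conj (w - q))`.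
Since `∫ θ (w - q) = 0`, the two moment equations decouple: the zeroth moment is `s A` and the first
moment about `q` is `t V`, with `A = ∫ θ` and `V = ∫ θ |w - q|²`. The lower bounds for `A`
(thickness of `K`) and `V` (`second_moment_ge`) keep `s` and `t` under control. A tent in place of a
characteristic function makes `h` continuous. -/
lemma exists_matching_moments {K : Set ℂ} (hK : IsCompact K) {a σ : ℝ} (ha : 0 < a) (hσ : 0 < σ)
    {p : ℂ} (hp : ENNReal.ofReal (a * σ ^ 2) ≤ volume (K ∩ Metric.closedBall p (2 * σ)))
    {α β : ℂ} {G : ℝ} (hα : ‖α‖ ≤ G * σ ^ 2) (hβ : ‖β‖ ≤ G * σ ^ 3) :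
    ∃ h : ℂ → ℂ, Continuous h ∧ (∀ w, h w ≠ 0 → ‖w - p‖ ≤ 3 * σ) ∧
      (∀ w, ‖h w‖ ≤ momentConst a * G) ∧ ∫ w in K, h w = α ∧ ∫ w in K, h w * (w - p) = β := by
  have hpi := Real.pi_pos
  have hG : 0 ≤ G := by
    have := (norm_nonneg α).trans hα
    by_contra! h
    nlinarith [pow_pos hσ 2]
  have hθ := continuous_tent p σ
  have hint : ∀ {f : ℂ → ℂ}, Continuous f → IntegrableOn f K := fun hf =>
    hf.continuousOn.integrableOn_compact hK
  have hintr : ∀ {f : ℂ → ℝ}, Continuous f → IntegrableOn f K := fun hf =>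
    hf.continuousOn.integrableOn_compact hK
  set S := K ∩ Metric.closedBall p (2 * σ) with hS
  have hSm : MeasurableSet S := hK.measurableSet.inter Metric.isClosed_closedBall.measurableSet
  have hSfin : volume S ≠ ⊤ :=
    ne_top_of_le_ne_top hK.measure_lt_top.ne (measure_mono Set.inter_subset_left)
  have hSK : S ≤ᵐ[volume] K := LE.le.eventuallyLE Set.inter_subset_left
  have hθS : ∀ w ∈ S, tent p σ w = 1 := fun w hw => tent_eq_one hσ (by
    simpa [Complex.dist_eq] using hw.2)
  set A : ℝ := ∫ w in K, tent p σ w with hA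
  have hAge : a * σ ^ 2 ≤ A := by
    calc a * σ ^ 2 ≤ volume.real S := (ENNReal.ofReal_le_iff_le_toReal hSfin).1 hp
      _ = ∫ w in S, tent p σ w := by
        rw [setIntegral_congr_fun hSm hθS]; simp
      _ ≤ A := setIntegral_mono_set (hintr hθ) (ae_of_all _ fun w => tent_nonneg p σ w) hSK
  have hApos : 0 < A := lt_of_lt_of_le (by positivity) hAge
  have hAc : ((A : ℝ) : ℂ) ≠ 0 := by exact_mod_cast hApos.ne'
  have hAint : ∫ w in K, (tent p σ w : ℂ) = A := integral_ofReal
  set m : ℂ := (∫ w in K, (tent p σ w : ℂ) * (w - p)) / A with hm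
  have hmn : ‖m‖ ≤ 3 * σ := by
    rw [hm, norm_div, Complex.norm_of_nonneg hApos.le, div_le_iff₀ hApos]
    calc ‖∫ w in K, (tent p σ w : ℂ) * (w - p)‖ ≤ ∫ w in K, 3 * σ * tent p σ w := by
          refine norm_integral_le_of_norm_le (hintr (by fun_prop)) (ae_of_all _ fun w => ?_)
          rw [norm_mul, Complex.norm_of_nonneg (tent_nonneg p σ w), mul_comm]
          by_cases h0 : tent p σ w = 0
          · simp [h0]
          · have := norm_sub_le_of_tent_ne_zero hσ h0
            gcongr
            exact tent_nonneg p σ w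
      _ = 3 * σ * A := integral_const_mul _ _
  set V : ℝ := ∫ w in K, tent p σ w * ‖w - (p + m)‖ ^ 2 with hV
  have hVge : (a * σ ^ 2) ^ 2 / (4 * Real.pi) ≤ V := by
    calc _ ≤ ∫ w in S, ‖w - (p + m)‖ ^ 2 :=
          second_moment_ge hSm (by positivity) hp _
            ((hintr (by fun_prop)).mono_set Set.inter_subset_left) hSfin
      _ = ∫ w in S, tent p σ w * ‖w - (p + m)‖ ^ 2 :=
          setIntegral_congr_fun hSm fun w hw => by simp only [hθS w hw, one_mul]
      _ ≤ V := setIntegral_mono_set (hintr (by fun_prop))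
          (ae_of_all _ fun w => mul_nonneg (tent_nonneg p σ w) (by positivity)) hSK
  have hVpos : 0 < V := lt_of_lt_of_le (by positivity) hVge
  have hVc : ((V : ℝ) : ℂ) ≠ 0 := by exact_mod_cast hVpos.ne'
  have hVint : ∫ w in K, (tent p σ w : ℂ) *
      ((starRingEnd ℂ) (w - (p + m)) * (w - (p + m))) = V := by
    refine Eq.trans ?_ (integral_ofReal (𝕜 := ℂ))
    refine integral_congr_ae (ae_of_all _ fun w => ?_)
    simp only [mul_comm ((starRingEnd ℂ) _), Complex.mul_conj, Complex.normSq_eq_norm_sq]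
    simp
  have hM1 : ∫ w in K, (tent p σ w : ℂ) * (w - (p + m)) = 0 := by
    have e : ∀ w, (tent p σ w : ℂ) * (w - (p + m)) =
        (tent p σ w : ℂ) * (w - p) - (tent p σ w : ℂ) * m := fun w => by ring
    simp only [e]
    rw [integral_sub (hint (by fun_prop)) (hint (by fun_prop)), integral_mul_const, hAint, hm,
      mul_div_cancel₀ _ hAc, sub_self]
  have hM1' : ∫ w in K, (tent p σ w : ℂ) * (starRingEnd ℂ) (w - (p + m)) = 0 := by
    have := congrArg (starRingEnd ℂ) hM1
    rw [← integral_conj, map_zero] at this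
    simpa using this
  set s : ℂ := α / A with hs
  set t : ℂ := (β - m * α) / V with ht
  set h : ℂ → ℂ := fun w => (tent p σ w : ℂ) * (s + t * (starRingEnd ℂ) (w - (p + m))) with hh
  have hconj : Continuous fun w : ℂ => (starRingEnd ℂ) (w - (p + m)) :=
    Complex.continuous_conj.comp (by fun_prop)
  have hhc : Continuous h := by
    rw [hh]; fun_prop
  have hI0 : ∫ w in K, h w = α := by
    have e : ∀ w, h w = s * (tent p σ w : ℂ) +
        t * ((tent p σ w : ℂ) * (starRingEnd ℂ) (w - (p + m))) := fun w => by
      simp only [hh]; ring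
    simp only [e]
    rw [integral_add (hint (by fun_prop)) (hint (by fun_prop)), integral_const_mul,
      integral_const_mul, hAint, hM1', mul_zero, add_zero, hs, div_mul_cancel₀ _ hAc]
  have hI1 : ∫ w in K, h w * (w - (p + m)) = β - m * α := by
    have e : ∀ w, h w * (w - (p + m)) = s * ((tent p σ w : ℂ) * (w - (p + m))) +
        t * ((tent p σ w : ℂ) * ((starRingEnd ℂ) (w - (p + m)) * (w - (p + m)))) := fun w => by
      simp only [hh]; ring
    simp only [e]
    rw [integral_add (hint (by fun_prop)) (hint (by fun_prop)), integral_const_mul,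
      integral_const_mul, hVint, hM1, mul_zero, zero_add, ht, div_mul_cancel₀ _ hVc]
  refine ⟨h, hhc, fun w hw => ?_, fun w => ?_, hI0, ?_⟩
  · refine norm_sub_le_of_tent_ne_zero hσ fun h0 => hw ?_
    simp only [hh, h0, Complex.ofReal_zero, zero_mul]
  · have hsn : ‖s‖ ≤ G / a := by
      rw [hs, norm_div, Complex.norm_of_nonneg hApos.le, div_le_div_iff₀ hApos ha]
      calc ‖α‖ * a ≤ G * σ ^ 2 * a := by gcongr
        _ = G * (a * σ ^ 2) := by ring
        _ ≤ G * A := by gcongr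
    -- On the support of the tent `|w - q| ≤ 3σ + 3σ`. The first moment about `q` is at most `(1 +
    -- 3) G σ³`, and division by `V ≥ a²σ⁴ / (4π)` gives `4 · 6 · 4π = 96π`.
    have htn : ‖t‖ * (6 * σ) ≤ 96 * Real.pi / a ^ 2 * G := by
      have h1 : ‖β - m * α‖ ≤ 4 * G * σ ^ 3 := by
        calc ‖β - m * α‖ ≤ ‖β‖ + ‖m‖ * ‖α‖ := by
              rw [← norm_mul]; exact norm_sub_le _ _
          _ ≤ G * σ ^ 3 + 3 * σ * (G * σ ^ 2) := by gcongr
          _ = _ := by ring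
      rw [ht, norm_div, Complex.norm_of_nonneg hVpos.le, div_mul_eq_mul_div, div_le_iff₀ hVpos]
      calc ‖β - m * α‖ * (6 * σ) ≤ 4 * G * σ ^ 3 * (6 * σ) := by gcongr
        _ = 96 * Real.pi / a ^ 2 * G * ((a * σ ^ 2) ^ 2 / (4 * Real.pi)) := by
          field_simp; ring
        _ ≤ _ := by gcongr
    by_cases h0 : tent p σ w = 0
    · simp only [hh, h0, Complex.ofReal_zero, zero_mul, norm_zero]
      unfold momentConst
      positivity
    · have h1 := norm_sub_le_of_tent_ne_zero hσ h0
      have h2 : ‖w - (p + m)‖ ≤ 6 * σ := by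
        rw [← sub_sub]
        linarith [norm_sub_le (w - p) m]
      calc ‖h w‖ = tent p σ w * ‖s + t * (starRingEnd ℂ) (w - (p + m))‖ := by
            simp only [hh, norm_mul, Complex.norm_of_nonneg (tent_nonneg p σ w)]
        _ ≤ 1 * (‖s‖ + ‖t‖ * ‖w - (p + m)‖) := by
            gcongr
            · exact tent_le_one p σ w
            · refine (norm_add_le _ _).trans (le_of_eq ?_)
              rw [norm_mul, RCLike.norm_conj]
        _ ≤ ‖s‖ + ‖t‖ * (6 * σ) := by rw [one_mul]; gcongr
        _ ≤ G / a + 96 * Real.pi / a ^ 2 * G := by gcongr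
        _ = momentConst a * G := by unfold momentConst; ring
  · have e : ∀ w, h w * (w - p) = h w * (w - (p + m)) + m * h w := fun w => by ring
    simp only [e]
    rw [integral_add (hint (by fun_prop)) (hint (by fun_prop)), hI1, integral_const_mul, hI0]
    ring

/-! ### Decay of Cauchy transforms with vanishing moments -/

/-- The vanishing moments allow the first two terms of the expansion of `1 / (w - z)` about `p` to
be removed. What remains is `(w - p)² / ((z - p)² (w - z))`, of order `σ² / |z - p|³`, integrated
over an area of order `σ²`. Near `p` the trivial bound suffices. -/
lemma norm_areaCauchy_le_of_moments {k : ℂ → ℂ} {B σ : ℝ} {p : ℂ}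
    (hk : AEStronglyMeasurable k volume) (hσ : 0 < σ) (hB : ∀ w, ‖k w‖ ≤ B)
    (hs : ∀ w, k w ≠ 0 → ‖w - p‖ ≤ 4 * σ) (h0 : ∫ w, k w = 0) (h1 : ∫ w, k w * (w - p) = 0)
    (z : ℂ) :
    ‖areaCauchy k z‖ ≤ 20000 * Real.pi * B * σ / (1 + ‖z - p‖ / σ) ^ 3 := by
  have hpi := Real.pi_pos
  have hB0 : 0 ≤ B := (norm_nonneg _).trans (hB 0)
  set x := ‖z - p‖ / σ with hx
  have hx0 : 0 ≤ x := by positivity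
  have hzx : ‖z - p‖ = x * σ := by rw [hx, div_mul_cancel₀ _ hσ.ne']
  -- The support has radius `4σ`, so beyond `8σ` one has `|w - z| ≥ |z - p| / 2`. The near case
  -- produces the constant `26 · 9³ = 18954` and the far case `16 · 32 · 8 = 4096`; both are below
  -- `20000`.
  rcases lt_or_ge x 8 with h | h
  · have h2 : ‖areaCauchy k z‖ ≤ B * (2 * Real.pi * (13 * σ)) := by
      refine norm_areaCauchy_le (by positivity) hB z fun w hw => ?_
      rw [Metric.mem_ball, Complex.dist_eq]
      have h3 := hs w hw
      have h4 : ‖w - z‖ ≤ ‖w - p‖ + ‖z - p‖ := by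
        simpa using norm_sub_le (w - p) (z - p)
      nlinarith
    rw [le_div_iff₀ (by positivity)]
    have h5 : (1 + x) ^ 3 ≤ 729 := by
      calc (1 + x) ^ 3 ≤ (1 + 8) ^ 3 := by gcongr
        _ = 729 := by norm_num
    calc ‖areaCauchy k z‖ * (1 + x) ^ 3 ≤ B * (2 * Real.pi * (13 * σ)) * 729 := by gcongr
      _ = 18954 * (Real.pi * B * σ) := by ring
      _ ≤ 20000 * (Real.pi * B * σ) := by gcongr; norm_num
      _ = _ := by ring
  · have hs' : ∀ w, k w ≠ 0 → ‖w‖ ≤ 4 * σ + ‖p‖ := fun w hw => by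
      have := norm_sub_norm_le w p
      linarith [hs w hw]
    have hki := integrable_of_bounded_support hk hB hs'
    have hk1 : Integrable fun w => k w * (w - p) := by
      refine integrable_of_bounded_support (B := B * (4 * σ)) (ρ := 4 * σ + ‖p‖)
        (hk.mul (by fun_prop : Continuous fun w : ℂ => w - p).aestronglyMeasurable)
        (fun w => ?_) fun w hw => hs' w (left_ne_zero_of_mul hw)
      by_cases h : k w = 0
      · simp only [h, zero_mul, norm_zero]; positivity
      · rw [norm_mul]
        exact mul_le_mul (hB w) (hs w h) (norm_nonneg _) hB0
    have hxpos : 0 < x := by linarith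
    have hζ : z - p ≠ 0 := norm_pos_iff.1 (by rw [hzx]; positivity)
    have e : areaCauchy k z = ∫ w, (k w / (w - z) + (z - p)⁻¹ * k w +
        ((z - p) ^ 2)⁻¹ * (k w * (w - p))) := by
      rw [integral_add _ (hk1.const_mul _), integral_add (integrable_kernel' hk hB hs' z)
        (hki.const_mul _), integral_const_mul, integral_const_mul, h0, h1]
      · simp [areaCauchy]
      · exact (integrable_kernel' hk hB hs' z).add (hki.const_mul _)
    have hb : ∀ w, ‖k w / (w - z) + (z - p)⁻¹ * k w + ((z - p) ^ 2)⁻¹ * (k w * (w - p))‖ ≤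
        (Metric.closedBall p (4 * σ)).indicator (fun _ => B * (32 / (x ^ 3 * σ))) w := by
      intro w
      by_cases hw : k w = 0
      · simp only [hw, zero_div, mul_zero, zero_mul, add_zero, norm_zero]
        exact Set.indicator_nonneg (fun _ _ => by positivity) _
      · have hwp := hs w hw
        rw [Set.indicator_of_mem (by simpa [Complex.dist_eq] using hwp)]
        have h3 : x * σ / 2 ≤ ‖w - z‖ := by
          have h4 : ‖z - p‖ ≤ ‖w - z‖ + ‖w - p‖ := by
            have := norm_sub_le (w - p) (w - z)
            rw [sub_sub_sub_cancel_left] at this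
            linarith
          nlinarith
        have hwz : w - z ≠ 0 := norm_pos_iff.1 (lt_of_lt_of_le (by positivity) h3)
        have e2 : k w / (w - z) + (z - p)⁻¹ * k w + ((z - p) ^ 2)⁻¹ * (k w * (w - p)) =
            k w * ((w - p) ^ 2 / ((z - p) ^ 2 * (w - z))) := by
          field_simp
          ring
        rw [e2, norm_mul]
        refine mul_le_mul (hB w) ?_ (norm_nonneg _) hB0
        rw [norm_div, norm_mul, norm_pow, norm_pow, hzx]
        calc ‖w - p‖ ^ 2 / ((x * σ) ^ 2 * ‖w - z‖)
            ≤ (4 * σ) ^ 2 / ((x * σ) ^ 2 * (x * σ / 2)) := by gcongr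
          _ = 32 / (x ^ 3 * σ) := by field_simp; ring
    have hvol : volume.real (Metric.closedBall p (4 * σ)) = Real.pi * (4 * σ) ^ 2 := by
      simp [Measure.real, Complex.volume_closedBall, hσ.le]
      ring
    rw [e]
    refine (norm_integral_le_of_norm_le ((integrable_indicator_iff
      Metric.isClosed_closedBall.measurableSet).2
      (integrableOn_const measure_closedBall_lt_top.ne)) (ae_of_all _ hb)).trans ?_
    rw [integral_indicator Metric.isClosed_closedBall.measurableSet, setIntegral_const, hvol,
      smul_eq_mul, le_div_iff₀ (by positivity)]
    have h6 : (1 + x) ^ 3 ≤ (2 * x) ^ 3 := by gcongr; linarith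
    calc Real.pi * (4 * σ) ^ 2 * (B * (32 / (x ^ 3 * σ))) * (1 + x) ^ 3
        ≤ Real.pi * (4 * σ) ^ 2 * (B * (32 / (x ^ 3 * σ))) * (2 * x) ^ 3 := by gcongr
      _ = 4096 * (Real.pi * B * σ) := by field_simp; ring
      _ ≤ 20000 * (Real.pi * B * σ) := by gcongr; norm_num
      _ = _ := by ring

/-- A bounded density in a small set can be replaced by one carried by `K`, with an error that
decays like the inverse cube of the distance. -/
lemma exists_transport {K : Set ℂ} (hK : IsCompact K) {a σ : ℝ} (ha : 0 < a) (hσ : 0 < σ)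
    {p : ℂ} (hp : ENNReal.ofReal (a * σ ^ 2) ≤ volume (K ∩ Metric.closedBall p (2 * σ)))
    {l : ℂ → ℂ} {G : ℝ} (hl : AEStronglyMeasurable l volume) (hG : ∀ w, ‖l w‖ ≤ G)
    (hs : ∀ w, l w ≠ 0 → ‖w - p‖ ≤ 4 * σ) :
    ∃ h : ℂ → ℂ, Continuous h ∧ ∀ z, ‖areaCauchy l z - areaCauchy (K.indicator h) z‖ ≤
      20000 * Real.pi * (1 + 64 * Real.pi * momentConst a) * G * σ / (1 + ‖z - p‖ / σ) ^ 3 := by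
  have hpi := Real.pi_pos
  have hG0 : 0 ≤ G := (norm_nonneg _).trans (hG 0)
  have hs' : ∀ w, l w ≠ 0 → ‖w‖ ≤ 4 * σ + ‖p‖ := fun w hw => by
    have := norm_sub_norm_le w p
    linarith [hs w hw]
  have hvol : volume.real (Metric.closedBall p (4 * σ)) = Real.pi * (4 * σ) ^ 2 := by
    simp [Measure.real, Complex.volume_closedBall, hσ.le]
    ring
  have hbound : ∀ (f : ℂ → ℂ) (c : ℝ), 0 ≤ c → (∀ w, l w ≠ 0 → ‖f w‖ ≤ c) →
      ‖∫ w, l w * f w‖ ≤ Real.pi * (4 * σ) ^ 2 * (G * c) := by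
    intro f c hc hf
    rw [← hvol, ← smul_eq_mul (volume.real _), ← setIntegral_const,
      ← integral_indicator Metric.isClosed_closedBall.measurableSet]
    refine norm_integral_le_of_norm_le ((integrable_indicator_iff
      Metric.isClosed_closedBall.measurableSet).2
      (integrableOn_const measure_closedBall_lt_top.ne)) (ae_of_all _ fun w => ?_)
    by_cases h : l w = 0
    · simp only [h, zero_mul, norm_zero]
      exact Set.indicator_nonneg (fun _ _ => by positivity) _
    · rw [Set.indicator_of_mem (by simpa [Complex.dist_eq] using hs w h), norm_mul]
      exact mul_le_mul (hG w) (hf w h) (norm_nonneg _) hG0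
  -- The moments of `l` are at most `16π G σ²` and `64π G σ³`; the single constant `64π G` covers
  -- both.
  obtain ⟨h, hc, hsup, hn, hI0, hI1⟩ := exists_matching_moments hK ha hσ hp
    (α := ∫ w, l w) (β := ∫ w, l w * (w - p)) (G := 64 * Real.pi * G)
    (by
      have := hbound (fun _ => 1) 1 zero_le_one (by simp)
      simp only [mul_one] at this
      refine this.trans ?_
      have : 0 ≤ Real.pi * G * σ ^ 2 := by positivity
      nlinarith)
    (by
      refine (hbound (fun w => w - p) (4 * σ) (by positivity) hs).trans (le_of_eq (by ring)))
  have hKm := hK.measurableSet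
  have hmc : 0 ≤ momentConst a := by unfold momentConst; positivity
  have hhm : AEStronglyMeasurable (K.indicator h) volume :=
    hc.aestronglyMeasurable.indicator hKm
  have hhB : ∀ w, ‖K.indicator h w‖ ≤ momentConst a * (64 * Real.pi * G) := fun w =>
    (norm_indicator_le_norm_self _ _).trans (hn w)
  have hhs : ∀ w, K.indicator h w ≠ 0 → ‖w - p‖ ≤ 4 * σ := fun w hw => by
    have := hsup w (fun h0 => hw (by simp [Set.indicator, h0]))
    linarith
  have hhs' : ∀ w, K.indicator h w ≠ 0 → ‖w‖ ≤ 4 * σ + ‖p‖ := fun w hw => by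
    have := norm_sub_norm_le w p
    linarith [hhs w hw]
  have hli := integrable_of_bounded_support hl hG hs'
  have hhi := integrable_of_bounded_support hhm hhB hhs'
  have hmul : ∀ {k : ℂ → ℂ} {B : ℝ}, AEStronglyMeasurable k volume → (∀ w, ‖k w‖ ≤ B) →
      (∀ w, k w ≠ 0 → ‖w - p‖ ≤ 4 * σ) → Integrable fun w => k w * (w - p) := by
    intro k B hk hB hs
    have hB0 : 0 ≤ B := (norm_nonneg _).trans (hB 0)
    refine integrable_of_bounded_support (B := B * (4 * σ)) (ρ := 4 * σ + ‖p‖)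
      (hk.mul (by fun_prop : Continuous fun w : ℂ => w - p).aestronglyMeasurable)
      (fun w => ?_) fun w hw => ?_
    · by_cases h : k w = 0
      · simp only [h, zero_mul, norm_zero]; positivity
      · rw [norm_mul]
        exact mul_le_mul (hB w) (hs w h) (norm_nonneg _) hB0
    · have := norm_sub_norm_le w p
      linarith [hs w (left_ne_zero_of_mul hw)]
  refine ⟨h, hc, fun z => ?_⟩
  rw [← areaCauchy_sub (integrable_kernel' hl hG hs' z) (integrable_kernel' hhm hhB hhs' z)]
  have := norm_areaCauchy_le_of_moments (k := fun w => l w - K.indicator h w) (p := p)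
    (B := G + momentConst a * (64 * Real.pi * G)) (hl.sub hhm) hσ
    (fun w => (norm_sub_le _ _).trans (add_le_add (hG w) (hhB w)))
    (fun w hw => by
      by_cases h1 : l w = 0
      · exact hhs w fun h2 => hw (by simp only [h1, h2, sub_zero])
      · exact hs w h1)
    (by rw [integral_sub hli hhi, integral_indicator hKm, hI0, sub_self])
    (by
      simp only [sub_mul]
      rw [integral_sub (hmul hl hG hs) (hmul hhm hhB hhs), sub_eq_zero, ← hI1,
        ← integral_indicator hKm]
      refine integral_congr_ae (ae_of_all _ fun w => ?_)
      by_cases hw : w ∈ K <;> simp [hw])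
    z
  refine this.trans (le_of_eq ?_)
  ring

/-! ### Summation over a square grid -/

/-- The index of the square of side `σ` of the standard grid that contains `w`. -/
def gridIndex (σ : ℝ) (w : ℂ) : Fin 2 → ℤ := ![⌊w.re / σ⌋, ⌊w.im / σ⌋]

lemma measurable_gridIndex (σ : ℝ) : Measurable (gridIndex σ) := by
  refine measurable_pi_iff.2 fun i => ?_
  fin_cases i
  · exact Int.measurable_floor.comp (Complex.measurable_re.div_const σ)
  · exact Int.measurable_floor.comp (Complex.measurable_im.div_const σ)

lemma norm_sub_le_of_gridIndex_eq {σ : ℝ} (hσ : 0 < σ) {w w' : ℂ}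
    (h : gridIndex σ w = gridIndex σ w') : ‖w - w'‖ ≤ 2 * σ := by
  have aux : ∀ x y : ℝ, ⌊x / σ⌋ = ⌊y / σ⌋ → |x - y| ≤ σ := by
    intro x y hxy
    have := (Int.abs_sub_lt_one_of_floor_eq_floor hxy).le
    rwa [← sub_div, abs_div, abs_of_pos hσ, div_le_one hσ] at this
  have h0 := aux w.re w'.re (congrFun h 0)
  have h1 := aux w.im w'.im (congrFun h 1)
  have := Complex.norm_le_abs_re_add_abs_im (w - w')
  rw [Complex.sub_re, Complex.sub_im] at this
  linarith

lemma norm_gridIndex_sub_le {σ : ℝ} (hσ : 0 < σ) (w w' : ℂ) :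
    ‖gridIndex σ w - gridIndex σ w'‖ ≤ ‖w - w'‖ / σ + 1 := by
  have aux : ∀ x y : ℝ, |x - y| ≤ ‖w - w'‖ →
      |((⌊x / σ⌋ - ⌊y / σ⌋ : ℤ) : ℝ)| ≤ ‖w - w'‖ / σ + 1 := by
    intro x y hxy
    have h1 : |x / σ - y / σ| ≤ ‖w - w'‖ / σ := by
      rw [← sub_div, abs_div, abs_of_pos hσ]
      gcongr
    have h2 := abs_le.1 h1
    rw [abs_le]
    push_cast
    constructor <;>
    linarith [Int.floor_le (x / σ), Int.lt_floor_add_one (x / σ), Int.floor_le (y / σ),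
      Int.lt_floor_add_one (y / σ)]
  refine (pi_norm_le_iff_of_nonneg (by positivity)).2 fun i => ?_
  rw [Int.norm_eq_abs]
  fin_cases i
  · exact aux _ _ (by simpa using Complex.abs_re_le_norm (w - w'))
  · exact aux _ _ (by simpa using Complex.abs_im_le_norm (w - w'))

/-- The exponent `3` exceeds the dimension `2` of the lattice; this is why two moments are matched,
since matching the zeroth alone would leave inverse-square decay and a logarithmically divergent
sum. -/
lemma summable_inv_one_add_norm_cube :
    Summable fun x : Fin 2 → ℤ => 1 / (1 + ‖x‖) ^ 3 := by
  have h := EisensteinSeries.summable_one_div_norm_rpow (k := 3) (by norm_num)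
  -- The Eisenstein summand takes the value `0` at the origin, whereas the term here is `1`; the
  -- added function supplies it.
  refine (h.add (summable_of_ne_finset_zero (s := {0})
    (f := fun x : Fin 2 → ℤ => if x = 0 then (1 : ℝ) else 0) (by
      intro b hb; simpa using hb))).of_nonneg_of_le (fun x => by positivity) fun x => ?_
  by_cases hx : x = 0
  · subst hx
    simp
  · have hx' : 0 < ‖x‖ := norm_pos_iff.2 hx
    simp only [hx, if_false, add_zero]
    rw [Real.rpow_neg hx'.le, ← one_div]
    norm_cast
    gcongr
    linarith

/-- The value of the lattice sum `∑ 1 / (1 + ‖x‖)³`. -/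
def gridConst : ℝ := ∑' x : Fin 2 → ℤ, 1 / (1 + ‖x‖) ^ 3

lemma gridConst_nonneg : 0 ≤ gridConst := tsum_nonneg fun _ => by positivity

lemma sum_le_gridConst (s : Finset (Fin 2 → ℤ)) (k : Fin 2 → ℤ) :
    ∑ i ∈ s, 1 / (1 + ‖k - i‖) ^ 3 ≤ gridConst := by
  have h : Summable fun i : Fin 2 → ℤ => 1 / (1 + ‖k - i‖) ^ 3 :=
    (Equiv.subLeft k).summable_iff.2 summable_inv_one_add_norm_cube
  refine (h.sum_le_tsum s fun _ _ => by positivity).trans (le_of_eq ?_)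
  exact (Equiv.subLeft k).tsum_eq fun x : Fin 2 → ℤ => 1 / (1 + ‖x‖) ^ 3

lemma areaCauchy_sum {ι : Type*} (s : Finset ι) {k : ι → ℂ → ℂ} {z : ℂ}
    (hk : ∀ i ∈ s, Integrable fun w => k i w / (w - z)) :
    areaCauchy (fun w => ∑ i ∈ s, k i w) z = ∑ i ∈ s, areaCauchy (k i) z := by
  simp only [areaCauchy, Finset.sum_div]
  exact integral_finsetSum s hk

/-! ### Approximation by Cauchy transforms on a thick compact set -/

/-- A bounded density near a thick compact set `K` can be replaced by one carried by `K`. -/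
lemma exists_global_transport {K : Set ℂ} (hK : IsCompact K) {a σ : ℝ} (ha : 0 < a) (hσ : 0 < σ)
    (hp : ∀ p ∈ K, ENNReal.ofReal (a * σ ^ 2) ≤ volume (K ∩ Metric.closedBall p (2 * σ)))
    {g : ℂ → ℂ} {G ρ : ℝ} (hg : AEStronglyMeasurable g volume) (hG : ∀ w, ‖g w‖ ≤ G)
    (hρ : ∀ w, g w ≠ 0 → ‖w‖ ≤ ρ) (hs : ∀ w, g w ≠ 0 → ∃ p ∈ K, ‖w - p‖ ≤ σ) :
    ∃ h : ℂ → ℂ, Continuous h ∧ ∀ z, ‖areaCauchy g z - areaCauchy (K.indicator h) z‖ ≤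
      20000 * Real.pi * (1 + 64 * Real.pi * momentConst a) * G * σ * (27 * gridConst) := by
  classical
  have hpi := Real.pi_pos
  have hG0 : 0 ≤ G := (norm_nonneg _).trans (hG 0)
  have hmc : 0 ≤ momentConst a := by unfold momentConst; positivity
  have hfin : {i | ∃ w, g w ≠ 0 ∧ gridIndex σ w = i}.Finite := by
    refine (isCompact_closedBall (0 : Fin 2 → ℤ) (ρ / σ + 1)).finite_of_discrete.subset ?_
    rintro i ⟨w, hw, rfl⟩
    have h1 := norm_gridIndex_sub_le hσ w 0
    have h2 : gridIndex σ 0 = 0 := by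
      ext i; fin_cases i <;> simp [gridIndex]
    rw [h2, sub_zero, sub_zero] at h1
    rw [mem_closedBall_zero_iff]
    have := hρ w hw
    exact h1.trans (by gcongr)
  set I := hfin.toFinset with hI
  have hIm : ∀ i, i ∈ I ↔ ∃ w, g w ≠ 0 ∧ gridIndex σ w = i := fun i => by simp [hI]
  -- For a square meeting the support of `g`, the point `p` of `K` lies within `σ` of some `w₀` in
  -- the square, so within `3σ ≤ 4σ` of the whole square. Passing from `z - p` to grid indices
  -- changes the scaled distance by at most `2`, and `1 + (x + 2) ≤ 3 (1 + x)` explains the factor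
  -- `27 = 3³`. For the other indices the value of `p` is irrelevant.
  have hp' : ∀ i : Fin 2 → ℤ, ∃ p : ℂ, i ∈ I → p ∈ K ∧
      (∀ w, gridIndex σ w = i → ‖w - p‖ ≤ 4 * σ) ∧
      ∀ z, 1 / (1 + ‖z - p‖ / σ) ^ 3 ≤ 27 * (1 / (1 + ‖gridIndex σ z - i‖) ^ 3) := by
    intro i
    by_cases hi : i ∈ I
    · obtain ⟨w₀, hw₀, rfl⟩ := (hIm i).1 hi
      obtain ⟨p, hpK, hwp⟩ := hs w₀ hw₀
      refine ⟨p, fun _ => ⟨hpK, fun w hw => ?_, fun z => ?_⟩⟩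
      · have h1 := norm_sub_le_of_gridIndex_eq hσ hw
        have h2 := norm_add_le (w - w₀) (w₀ - p)
        rw [sub_add_sub_cancel] at h2
        linarith
      · have h1 := norm_gridIndex_sub_le hσ z w₀
        have h2 : ‖z - w₀‖ / σ ≤ ‖z - p‖ / σ + 1 := by
          rw [div_add_one hσ.ne']
          gcongr
          have := norm_sub_le (z - p) (w₀ - p)
          rw [sub_sub_sub_cancel_right] at this
          linarith
        have h3 : 0 ≤ ‖z - p‖ / σ := by positivity
        rw [mul_one_div, div_le_div_iff₀ (by positivity) (by positivity), one_mul]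
        calc (1 + ‖gridIndex σ z - gridIndex σ w₀‖) ^ 3 ≤ (3 * (1 + ‖z - p‖ / σ)) ^ 3 := by
              gcongr; linarith
          _ = _ := by ring
    · exact ⟨0, fun h => absurd h hi⟩
  choose p hpI using hp'
  set l : (Fin 2 → ℤ) → ℂ → ℂ := fun i => (gridIndex σ ⁻¹' {i}).indicator g with hl
  have hlm : ∀ i, AEStronglyMeasurable (l i) volume := fun i =>
    hg.indicator (measurable_gridIndex σ (measurableSet_singleton i))
  have hlG : ∀ i w, ‖l i w‖ ≤ G := fun i w => (norm_indicator_le_norm_self _ _).trans (hG w)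
  have hls : ∀ i w, l i w ≠ 0 → gridIndex σ w = i ∧ g w ≠ 0 := fun i w hw => by
    by_cases h : gridIndex σ w = i
    · exact ⟨h, fun h0 => hw (by simp [hl, Set.indicator, h0])⟩
    · exact absurd (by simp [hl, h]) hw
  have hlρ : ∀ i w, l i w ≠ 0 → ‖w‖ ≤ ρ := fun i w hw => hρ w (hls i w hw).2
  have hex : ∀ i, ∃ h : ℂ → ℂ, Continuous h ∧ (i ∈ I → ∀ z,
      ‖areaCauchy (l i) z - areaCauchy (K.indicator h) z‖ ≤
      20000 * Real.pi * (1 + 64 * Real.pi * momentConst a) * G * σ /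
        (1 + ‖z - p i‖ / σ) ^ 3) := by
    intro i
    by_cases hi : i ∈ I
    · obtain ⟨hpK, h1, -⟩ := hpI i hi
      obtain ⟨h, hc, hh⟩ := exists_transport hK ha hσ (hp (p i) hpK) (hlm i) (hlG i)
        (fun w hw => h1 w (hls i w hw).1)
      exact ⟨h, hc, fun _ => hh⟩
    · exact ⟨0, continuous_zero, fun h => absurd h hi⟩
  choose h hhc hhI using hex
  have hgsum : g = fun w => ∑ i ∈ I, l i w := by
    ext w
    by_cases hw : g w = 0
    · rw [hw, Finset.sum_eq_zero]
      exact fun i _ => by simp [hl, Set.indicator, hw]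
    · rw [Finset.sum_eq_single_of_mem (gridIndex σ w) ((hIm _).2 ⟨w, hw, rfl⟩)]
      · simp [hl]
      · intro i _ hi
        exact Set.indicator_of_notMem (fun h => hi (by simpa using h.symm)) _
  obtain ⟨R, hR⟩ := hK.isBounded.exists_norm_le
  have hhint : ∀ i z, Integrable fun w => K.indicator (h i) w / (w - z) := by
    intro i z
    obtain ⟨B, hB⟩ := hK.exists_bound_of_continuousOn (hhc i).continuousOn
    refine integrable_kernel' (B := max B 0) (ρ := R)
      ((hhc i).aestronglyMeasurable.indicator hK.measurableSet) (fun w => ?_) (fun w hw => ?_) z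
    · by_cases hw : w ∈ K
      · rw [Set.indicator_of_mem hw]; exact (hB w hw).trans (le_max_left _ _)
      · rw [Set.indicator_of_notMem hw, norm_zero]; exact le_max_right _ _
    · by_contra h2
      exact hw (Set.indicator_of_notMem (fun h3 => h2 (hR w h3)) _)
  refine ⟨fun w => ∑ i ∈ I, h i w, continuous_finsetSum _ fun i _ => hhc i, fun z => ?_⟩
  have e1 : K.indicator (fun w => ∑ i ∈ I, h i w) = fun w => ∑ i ∈ I, K.indicator (h i) w := by
    ext w
    by_cases hw : w ∈ K <;> simp [hw]
  rw [e1, areaCauchy_sum _ fun i _ => hhint i z]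
  nth_rewrite 1 [hgsum]
  rw [areaCauchy_sum _ fun i _ => integrable_kernel' (hlm i) (hlG i) (hlρ i) z,
    ← Finset.sum_sub_distrib]
  set C := 20000 * Real.pi * (1 + 64 * Real.pi * momentConst a) * G * σ with hC
  have hC0 : 0 ≤ C := by positivity
  -- The lattice sum bounds the total error independently of the number of squares, hence of the
  -- scale.
  calc _ ≤ ∑ i ∈ I, ‖areaCauchy (l i) z - areaCauchy (K.indicator (h i)) z‖ := norm_sum_le _ _
    _ ≤ ∑ i ∈ I, C * (27 * (1 / (1 + ‖gridIndex σ z - i‖) ^ 3)) := by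
        refine Finset.sum_le_sum fun i hi => (hhI i hi z).trans ?_
        rw [div_eq_mul_one_div]
        exact mul_le_mul_of_nonneg_left ((hpI i hi).2.2 z) hC0
    _ = C * (27 * ∑ i ∈ I, 1 / (1 + ‖gridIndex σ z - i‖) ^ 3) := by
        rw [Finset.mul_sum, Finset.mul_sum]
    _ ≤ _ := by
        gcongr
        exact sum_le_gridConst I _

/-- A continuous function that is holomorphic off a thick compact set `K` is, up to functions
holomorphic in a neighbourhood of the closed unit disk, a uniform limit of Cauchy transforms of
continuous densities on `K`. -/
theorem exists_cauchy_approx {K : Set ℂ} (hK : IsCompact K) {a : ℝ} (ha : 0 < a) {σ : ℕ → ℝ}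
    (hσ : ∀ n, 0 < σ n) (hσ0 : Tendsto σ atTop (𝓝 0))
    (hp : ∀ n, ∀ p ∈ K,
      ENNReal.ofReal (a * σ n ^ 2) ≤ volume (K ∩ Metric.closedBall p (2 * σ n)))
    {F : ℂ → ℂ} (hF : Continuous F) {ρ : ℝ} (hs : ∀ w, F w ≠ 0 → ‖w‖ ≤ ρ)
    (hd : DifferentiableOn ℂ F (Metric.ball 0 2 \ K)) {η : ℝ} (hη : 0 < η) :
    ∃ h G : ℂ → ℂ, Continuous h ∧ DifferentiableOn ℂ G (Metric.ball 0 (3 / 2)) ∧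
      ∀ z, ‖F z - (G z + areaCauchy (K.indicator h) z)‖ ≤ η := by
  have hpi := Real.pi_pos
  have hmc : 0 ≤ momentConst a := by unfold momentConst; positivity
  set M := 20000 * (1 + 64 * Real.pi * momentConst a) * (27 * gridConst) with hM
  have hM0 : 0 ≤ M := by have := gridConst_nonneg; positivity
  -- The density is bounded by `ω / (πσ)` and the transport error is a constant times density times
  -- `σ`, so the scale and the factor `π` cancel. The total error is `ω + M ω`.
  set ω := η / (1 + M) with hω
  have hωpos : 0 < ω := by positivity
  have hsupp : HasCompactSupport F := by
    refine HasCompactSupport.intro (isCompact_closedBall (0 : ℂ) ρ) fun w hw => ?_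
    by_contra h
    exact hw (by simpa using hs w h)
  obtain ⟨δ, hδ, hδω⟩ := Metric.uniformContinuous_iff.1
    (hsupp.uniformContinuous_of_continuous hF) ω hωpos
  obtain ⟨n, hn⟩ := (hσ0.eventually_lt_const
    (lt_min hδ (by norm_num : (0 : ℝ) < 1 / 2))).exists
  have hn1 : σ n < δ := hn.trans_le (min_le_left _ _)
  have hn2 : σ n < 1 / 2 := hn.trans_le (min_le_right _ _)
  have hσn := hσ n
  obtain ⟨g, hgc, hgB, hgs, hg0, hgF⟩ := exists_density hF hs hσn (ω := ω) fun x y hxy => by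
    rw [← dist_eq_norm]
    exact (hδω (lt_of_le_of_lt (by rwa [dist_eq_norm]) hn1)).le
  -- The part of the density outside `D` has a transform holomorphic in `D`. A point of `D` where
  -- `g` is nonzero must be within `σ n` of `K`: otherwise the closed disk of radius `σ n < 1/2`
  -- about it stays in the ball of radius `2` and misses `K`, so that `F` is holomorphic there and
  -- `g` vanishes at the point.
  set D := Metric.ball (0 : ℂ) (3 / 2) with hD
  have hDm : MeasurableSet D := measurableSet_ball
  have hgm : ∀ {S : Set ℂ}, MeasurableSet S →
      AEStronglyMeasurable (S.indicator g) volume := fun hS =>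
    hgc.aestronglyMeasurable.indicator hS
  have hgB' : ∀ (S : Set ℂ) w, ‖S.indicator g w‖ ≤ ω / (Real.pi * σ n) := fun S w =>
    (norm_indicator_le_norm_self _ _).trans (hgB w)
  have hgs' : ∀ (S : Set ℂ) w, S.indicator g w ≠ 0 → w ∈ S ∧ g w ≠ 0 := fun S w hw =>
    Set.indicator_apply_ne_zero.1 hw
  obtain ⟨h, hhc, hh⟩ := exists_global_transport hK ha hσn (hp n) (hgm hDm) (hgB' D)
    (fun w hw => hgs w (hgs' D w hw).2) (fun w hw => by
      obtain ⟨hwD, hgw⟩ := hgs' D w hw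
      by_contra! hcon
      refine hgw (hg0 w fun x hx => ?_)
      rw [Metric.mem_closedBall, Complex.dist_eq] at hx
      have hxK : x ∉ K := fun hxK => by
        have := hcon x hxK
        rw [norm_sub_rev] at this
        linarith
      have hx2 : x ∈ Metric.ball (0 : ℂ) 2 := by
        rw [mem_ball_zero_iff]
        rw [hD, mem_ball_zero_iff] at hwD
        have := norm_sub_norm_le x w
        linarith
      exact hd.differentiableAt ((Metric.isOpen_ball.sdiff hK.isClosed).mem_nhds ⟨hx2, hxK⟩))
  refine ⟨h, areaCauchy (Dᶜ.indicator g), hhc, ?_, fun z => ?_⟩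
  · exact differentiableOn_areaCauchy (hgm hDm.compl) (hgB' _)
      (fun w hw => hgs w (hgs' _ w hw).2) Metric.isOpen_ball fun w hw => by
        rw [Set.indicator_of_notMem]
        simpa using hw
  · have e : areaCauchy g z = areaCauchy (D.indicator g) z + areaCauchy (Dᶜ.indicator g) z := by
      rw [← areaCauchy_add]
      · simp only [Set.indicator_self_add_compl_apply]
      · exact integrable_kernel' (hgm hDm) (hgB' _) (fun w hw => hgs w (hgs' _ w hw).2) z
      · exact integrable_kernel' (hgm hDm.compl) (hgB' _) (fun w hw => hgs w (hgs' _ w hw).2) z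
    have e2 : F z - (areaCauchy (Dᶜ.indicator g) z + areaCauchy (K.indicator h) z) =
        (F z - areaCauchy g z) +
          (areaCauchy (D.indicator g) z - areaCauchy (K.indicator h) z) := by
      rw [e]; ring
    rw [e2]
    calc _ ≤ ω + M * ω := by
          refine (norm_add_le _ _).trans (add_le_add (hgF z) ((hh z).trans (le_of_eq ?_)))
          rw [hM]
          field_simp
      _ = η := by rw [hω]; field_simp

/-! ### Uniform approximation by polynomials on totally disconnected sets -/

lemma norm_sub_one_eq_iff {x : ℂ} : ‖x - 1‖ = ‖x + 1‖ ↔ x.re = 0 := by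
  rw [← sq_eq_sq₀ (norm_nonneg _) (norm_nonneg _), Complex.sq_norm, Complex.sq_norm,
    Complex.normSq_apply, Complex.normSq_apply]
  simp only [Complex.sub_re, Complex.one_re, Complex.sub_im, Complex.one_im, Complex.add_re,
    Complex.add_im]
  constructor <;> intro h <;> nlinarith

lemma norm_sub_one_lt_iff {x : ℂ} : ‖x - 1‖ < ‖x + 1‖ ↔ 0 < x.re := by
  rw [← sq_lt_sq₀ (norm_nonneg _) (norm_nonneg _), Complex.sq_norm, Complex.sq_norm,
    Complex.normSq_apply, Complex.normSq_apply]
  simp only [Complex.sub_re, Complex.one_re, Complex.sub_im, Complex.one_im, Complex.add_re,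
    Complex.add_im]
  constructor <;> intro h <;> nlinarith

lemma norm_pow_div_add_pow_le {x y : ℂ} {θ : ℝ} (hθ : θ < 1) (hxy : ‖y‖ ≤ θ * ‖x‖) (hx : x ≠ 0)
    {N : ℕ} (hN : N ≠ 0) : ‖y ^ N / (x ^ N + y ^ N)‖ ≤ θ ^ N / (1 - θ ^ N) := by
  have hx' : 0 < ‖x‖ := norm_pos_iff.2 hx
  have hθ0 : 0 ≤ θ := by
    by_contra! h
    nlinarith [norm_nonneg y]
  have h1 : θ ^ N < 1 := pow_lt_one₀ hθ0 hθ hN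
  have h2 : ‖y‖ ^ N ≤ θ ^ N * ‖x‖ ^ N := by rw [← mul_pow]; gcongr
  have h3 : ‖x‖ ^ N * (1 - θ ^ N) ≤ ‖x ^ N + y ^ N‖ := by
    have := norm_sub_le (x ^ N + y ^ N) (y ^ N)
    rw [add_sub_cancel_right, norm_pow, norm_pow] at this
    linarith
  have h4 : 0 < 1 - θ ^ N := by linarith
  rw [norm_div, norm_pow]
  calc ‖y‖ ^ N / ‖x ^ N + y ^ N‖ ≤ (θ ^ N * ‖x‖ ^ N) / (‖x‖ ^ N * (1 - θ ^ N)) := by gcongr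
    _ = θ ^ N / (1 - θ ^ N) := by
      rw [mul_comm (‖x‖ ^ N)]
      exact mul_div_mul_right _ _ (by positivity)

/-- A closed subalgebra of `C(X)` containing a function `u` whose range misses the imaginary axis
contains the characteristic function of `{0 < re u}`. -/
lemma exists_indicator_mem {Y : Type*} [TopologicalSpace Y] [CompactSpace Y]
    (B : Subalgebra ℂ C(Y, ℂ)) (hB : IsClosed (B : Set C(Y, ℂ))) {u : C(Y, ℂ)} (hu : u ∈ B)
    (h0 : ∀ x, (u x).re ≠ 0) :
    ∃ χ ∈ B, ∀ x, χ x = if 0 < (u x).re then 1 else 0 := by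
  rcases isEmpty_or_nonempty Y with hX | hX
  · exact ⟨0, B.zero_mem, fun x => hX.elim x⟩
  have : CompleteSpace B := hB.completeSpace_coe
  set v : B := ⟨u, hu⟩ with hv
  -- Passing from `C(Y)` to the closed subalgebra `B` can only fill bounded components of the
  -- complement of the spectrum. The imaginary axis is connected, unbounded and disjoint from the
  -- range of `u`, so it lies in an unbounded component and stays out of the spectrum in `B`.
  have hspec : ∀ s ∈ spectrum ℂ v, s.re ≠ 0 := by
    intro s hs hre
    have hb := Subalgebra.spectrum_isBounded_connectedComponentIn (hS := hB) B v hs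
    have hline : Complex.re ⁻¹' {0} ⊆ connectedComponentIn (spectrum ℂ (v : C(Y, ℂ)))ᶜ s := by
      refine IsPreconnected.subset_connectedComponentIn ?_ hre ?_
      · exact ((convex_singleton (0 : ℝ)).linear_preimage Complex.reLm).isPreconnected
      · rintro w hw hw'
        rw [ContinuousMap.spectrum_eq_range] at hw'
        obtain ⟨x, rfl⟩ := hw'
        exact h0 x hw
    obtain ⟨R, hR⟩ := (hb.subset hline).exists_norm_le
    have := hR ((|R| + 1 : ℝ) * Complex.I) (by simp)
    rw [norm_mul, Complex.norm_I, mul_one, Complex.norm_of_nonneg (by positivity)] at this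
    linarith [le_abs_self R]
  -- A zero `s` of `(X + 1)^N + (X - 1)^N` satisfies `|s + 1| = |s - 1|`, so it lies on the
  -- imaginary axis, off the spectrum. The quotients `(u + 1)^N / ((u + 1)^N + (u - 1)^N)` are
  -- therefore in `B`; they tend to `1` where `re u > 0` and to `0` where `re u < 0`.
  have hunit : ∀ N : ℕ, IsUnit ((v + 1) ^ N + (v - 1) ^ N) := by
    intro N
    set q : ℂ[X] := (X + 1) ^ N + (X - 1) ^ N with hq
    have haq : aeval v q = (v + 1) ^ N + (v - 1) ^ N := by simp [hq]
    rw [← haq]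
    by_contra hcon
    rw [← spectrum.zero_mem_iff ℂ, spectrum.map_polynomial_aeval_of_nonempty _ _
      (spectrum.nonempty v)] at hcon
    obtain ⟨s, hs, hs0⟩ := hcon
    simp only [hq, eval_add, eval_pow, eval_X, eval_one, eval_sub] at hs0
    have h1 : ‖s + 1‖ ^ N = ‖s - 1‖ ^ N := by
      rw [← norm_pow, ← norm_pow, eq_neg_of_add_eq_zero_left hs0, norm_neg]
    rcases eq_or_ne N 0 with rfl | hN
    · norm_num at hs0
    · exact hspec s hs (norm_sub_one_eq_iff.1
        ((pow_left_inj₀ (norm_nonneg _) (norm_nonneg _) hN).1 h1).symm)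
  have hinv : ∀ N : ℕ, ∃ r ∈ B, ∀ x, r x * ((u x + 1) ^ N + (u x - 1) ^ N) = (u x + 1) ^ N := by
    intro N
    obtain ⟨w, hw⟩ := (hunit N).exists_left_inv
    refine ⟨(((v + 1) ^ N * w : B) : C(Y, ℂ)), Subtype.property _, fun x => ?_⟩
    have h1 : (v + 1) ^ N * w * ((v + 1) ^ N + (v - 1) ^ N) = (v + 1) ^ N := by
      rw [mul_assoc, hw, mul_one]
    have h2 := congrArg (fun b : B => (b : C(Y, ℂ)) x) h1
    simpa using h2
  choose r hrB hr using hinv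
  have hχc : Continuous fun x => if 0 < (u x).re then (1 : ℂ) else 0 := by
    refine continuous_const.if (fun x hx => ?_) continuous_const
    have h1 : IsClopen {x | 0 < (u x).re} := by
      constructor
      · have : {x | 0 < (u x).re} = {x | 0 ≤ (u x).re} := by
          ext x; exact ⟨fun h => le_of_lt (show 0 < (u x).re from h),
            fun h => lt_of_le_of_ne (show 0 ≤ (u x).re from h) (h0 x).symm⟩
        rw [this]
        exact isClosed_le continuous_const (Complex.continuous_re.comp u.continuous)
      · exact isOpen_lt continuous_const (Complex.continuous_re.comp u.continuous)
    rw [h1.frontier_eq] at hx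
    exact hx.elim
  set χ : C(Y, ℂ) := ⟨_, hχc⟩ with hχ
  refine ⟨χ, ?_, fun x => rfl⟩
  -- By compactness the ratio of the smaller to the larger of `|u ∓ 1|` is bounded by some `θ < 1`,
  -- which makes the convergence uniform.
  obtain ⟨θ, hθ1, hθ⟩ : ∃ θ < 1, ∀ x, min ‖u x - 1‖ ‖u x + 1‖ ≤ θ * max ‖u x - 1‖ ‖u x + 1‖ := by
    have hpos : ∀ x, 0 < max ‖u x - 1‖ ‖u x + 1‖ := fun x => by
      rcases lt_or_gt_of_ne fun h => h0 x (norm_sub_one_eq_iff.1 h) with h | h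
      · exact lt_max_of_lt_right ((norm_nonneg _).trans_lt h)
      · exact lt_max_of_lt_left ((norm_nonneg _).trans_lt h)
    have hcont : Continuous fun x => min ‖u x - 1‖ ‖u x + 1‖ / max ‖u x - 1‖ ‖u x + 1‖ :=
      Continuous.div (by fun_prop) (by fun_prop) fun x => (hpos x).ne'
    obtain ⟨x₀, -, hx₀⟩ := isCompact_univ.exists_isMaxOn Set.univ_nonempty hcont.continuousOn
    refine ⟨_, (div_lt_one (hpos x₀)).2 ?_, fun x => (div_le_iff₀ (hpos x)).1
      (hx₀ (Set.mem_univ x))⟩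
    exact min_lt_max.2 fun h => h0 x₀ (norm_sub_one_eq_iff.1 h)
  have hθ0 : 0 ≤ θ := by
    obtain ⟨x⟩ := hX
    have h1 := hθ x
    by_contra! h
    have h2 : 0 ≤ min ‖u x - 1‖ ‖u x + 1‖ := by positivity
    have h3 : 0 < max ‖u x - 1‖ ‖u x + 1‖ := by
      rcases lt_or_gt_of_ne fun h => h0 x (norm_sub_one_eq_iff.1 h) with h | h
      · exact lt_max_of_lt_right ((norm_nonneg _).trans_lt h)
      · exact lt_max_of_lt_left ((norm_nonneg _).trans_lt h)
    nlinarith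
  have hbound : ∀ N ≠ 0, ‖r N - χ‖ ≤ θ ^ N / (1 - θ ^ N) := by
    intro N hN
    have h1 : θ ^ N < 1 := pow_lt_one₀ hθ0 hθ1 hN
    refine (ContinuousMap.norm_le _ (div_nonneg (by positivity) (by linarith))).2 fun x => ?_
    have hne : (u x + 1) ^ N + (u x - 1) ^ N ≠ 0 := by
      intro h
      have h1 : ‖u x + 1‖ ^ N = ‖u x - 1‖ ^ N := by
        rw [← norm_pow, ← norm_pow, eq_neg_of_add_eq_zero_left h, norm_neg]
      exact h0 x (norm_sub_one_eq_iff.1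
        ((pow_left_inj₀ (norm_nonneg _) (norm_nonneg _) hN).1 h1).symm)
    have hrx : r N x = (u x + 1) ^ N / ((u x + 1) ^ N + (u x - 1) ^ N) :=
      (eq_div_iff hne).2 (hr N x)
    rw [ContinuousMap.sub_apply, hrx]
    have hθx := hθ x
    by_cases h : 0 < (u x).re
    · have hlt := norm_sub_one_lt_iff.2 h
      have e : χ x = 1 := if_pos h
      rw [min_eq_left hlt.le, max_eq_right hlt.le] at hθx
      rw [e, div_sub_one hne, sub_add_cancel_left, neg_div, norm_neg]
      exact norm_pow_div_add_pow_le hθ1 hθx (norm_pos_iff.1 ((norm_nonneg _).trans_lt hlt)) hN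
    · have hlt : ‖u x + 1‖ < ‖u x - 1‖ :=
        lt_of_le_of_ne (not_lt.1 fun h' => h (norm_sub_one_lt_iff.1 h'))
          fun h' => h0 x (norm_sub_one_eq_iff.1 h'.symm)
      have e : χ x = 0 := if_neg h
      rw [min_eq_right hlt.le, max_eq_left hlt.le] at hθx
      rw [e, sub_zero, add_comm ((u x + 1) ^ N)]
      exact norm_pow_div_add_pow_le hθ1 hθx (norm_pos_iff.1 ((norm_nonneg _).trans_lt hlt)) hN
  refine hB.mem_of_tendsto (b := atTop) (f := r) ?_ (Eventually.of_forall hrB)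
  rw [tendsto_iff_norm_sub_tendsto_zero]
  have hpow := tendsto_pow_atTop_nhds_zero_of_lt_one hθ0 hθ1
  have hlim : Tendsto (fun N : ℕ => θ ^ N / (1 - θ ^ N)) atTop (𝓝 0) := by
    have := hpow.div (tendsto_const_nhds (x := (1 : ℝ)).sub hpow) (by norm_num)
    rw [zero_div] at this
    exact this
  exact squeeze_zero' (Eventually.of_forall fun _ => norm_nonneg _)
    ((eventually_ne_atTop 0).mono fun N hN => hbound N hN) hlim

lemma mem_polynomialFunctions_of_eval {K : Set ℂ} {f : C(K, ℂ)} (p : ℂ[X])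
    (h : ∀ z : K, f z = p.eval (z : ℂ)) : f ∈ polynomialFunctions K := by
  refine ⟨p, trivial, ?_⟩
  ext z
  simp [h]

/-- If the points of the compact set `K` are separated by lines parallel to the axes that miss `K`,
then the polynomials are dense in `C(K)`. -/
theorem polynomialFunctions_dense {K : Set ℂ} [CompactSpace K]
    (hsep : ∀ z ∈ K, ∀ w ∈ K, z ≠ w → ∃ t : ℝ,
      ((∀ x ∈ K, x.re ≠ t) ∧ (z.re < t ∧ t < w.re ∨ w.re < t ∧ t < z.re)) ∨
      ((∀ x ∈ K, x.im ≠ t) ∧ (z.im < t ∧ t < w.im ∨ w.im < t ∧ t < z.im))) :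
    (polynomialFunctions K).topologicalClosure = ⊤ := by
  set B := (polynomialFunctions K).topologicalClosure with hBdef
  have hB : IsClosed (B : Set C(K, ℂ)) := Subalgebra.isClosed_topologicalClosure _
  -- The polynomials are not stable under conjugation, but the idempotents in their closure are
  -- real-valued. The star algebra generated by these idempotents thus stays in `B`, and
  -- Stone–Weierstrass applies to it.
  set s : Set C(K, ℂ) := {χ | χ ∈ B ∧ ∀ x, χ x = 0 ∨ χ x = 1} with hs
  have hstar : star s = s := by
    have h : ∀ χ ∈ s, star χ = χ := by
      rintro χ ⟨-, h⟩
      ext x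
      rcases h x with h | h <;> simp [h]
    ext χ
    rw [Set.mem_star]
    constructor
    · intro hχ
      have := h _ hχ
      rw [star_star] at this
      rwa [this]
    · intro hχ
      rwa [h _ hχ]
  set A : StarSubalgebra ℂ C(K, ℂ) := StarAlgebra.adjoin ℂ s with hA
  have hAB : A.toSubalgebra ≤ B := by
    rw [hA, StarAlgebra.adjoin_toSubalgebra, hstar, Set.union_self, Algebra.adjoin_le_iff]
    exact fun χ h => h.1
  have key : ∀ (p : ℂ[X]), (∀ x ∈ K, (p.eval x).re ≠ 0) → ∃ χ ∈ s, ∀ x : K,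
      χ x = if 0 < (p.eval (x : ℂ)).re then 1 else 0 := by
    intro p hp
    obtain ⟨χ, hχB, hχ⟩ := exists_indicator_mem B hB
      (u := ⟨fun x : K => p.eval (x : ℂ), by fun_prop⟩)
      (Subalgebra.le_topologicalClosure _ (mem_polynomialFunctions_of_eval p fun z => rfl))
      (fun x => hp x x.2)
    refine ⟨χ, ⟨hχB, fun x => ?_⟩, hχ⟩
    rw [hχ]
    split_ifs
    · exact Or.inr rfl
    · exact Or.inl rfl
  have hAsep : A.SeparatesPoints := by
    intro z w hzw
    obtain ⟨p, hp, hpz⟩ : ∃ p : ℂ[X], (∀ x ∈ K, (p.eval x).re ≠ 0) ∧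
        ((p.eval (z : ℂ)).re < 0 ∧ 0 < (p.eval (w : ℂ)).re ∨
          (p.eval (w : ℂ)).re < 0 ∧ 0 < (p.eval (z : ℂ)).re) := by
      obtain ⟨t, ⟨h1, h2⟩ | ⟨h1, h2⟩⟩ := hsep z z.2 w w.2 fun h => hzw (Subtype.ext h)
      · refine ⟨X - C (t : ℂ), fun x hx => ?_, ?_⟩
        · simpa [sub_eq_zero] using h1 x hx
        · simpa using h2
      -- A horizontal line is turned into a vertical one by `re (-i z) = im z`.
      · refine ⟨C (-Complex.I) * X - C (t : ℂ), fun x hx => ?_, ?_⟩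
        · simpa [sub_eq_zero] using h1 x hx
        · simpa using h2
    obtain ⟨χ, hχs, hχ⟩ := key p hp
    refine ⟨χ, ⟨χ, StarAlgebra.subset_adjoin ℂ s hχs, rfl⟩, ?_⟩
    rw [hχ, hχ]
    rcases hpz with ⟨h1, h2⟩ | ⟨h1, h2⟩
    · rw [if_neg (not_lt.2 h1.le), if_pos h2]; exact zero_ne_one
    · rw [if_pos h2, if_neg (not_lt.2 h1.le)]; exact one_ne_zero
  have htop := ContinuousMap.starSubalgebra_topologicalClosure_eq_top_of_separatesPoints A hAsep
  rw [eq_top_iff]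
  rintro f -
  have hf : f ∈ A.topologicalClosure := by rw [htop]; trivial
  have hf' : f ∈ closure (A : Set C(K, ℂ)) := hf
  exact closure_minimal (s := (A : Set C(K, ℂ))) (t := (B : Set C(K, ℂ))) hAB hB hf'

/-! ### Polynomial approximation on disks -/

lemma exists_polynomial_near_of_differentiableOn {f : ℂ → ℂ} {R R' : ℝ} (hR : 0 ≤ R) (hRR : R < R')
    (hf : DifferentiableOn ℂ f (Metric.ball 0 R')) {ε : ℝ} (hε : 0 < ε) :
    ∃ p : ℂ[X], ∀ z ∈ Metric.closedBall (0 : ℂ) R, ‖f z - p.eval z‖ ≤ ε := by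
  obtain ⟨s, hs1, hs2⟩ := exists_between hRR
  obtain ⟨t, ht1, ht2⟩ := exists_between hs1
  lift s to NNReal using (by linarith)
  lift t to NNReal using (by linarith)
  have hps := (hf.mono (Metric.closedBall_subset_ball hs2)).hasFPowerSeriesOnBall
    (NNReal.coe_pos.1 (by linarith))
  have htu := hps.tendstoUniformlyOn (ENNReal.coe_lt_coe.2 (NNReal.coe_lt_coe.1 ht2))
  obtain ⟨n, hn⟩ := (Metric.tendstoUniformlyOn_iff.1 htu ε hε).exists
  refine ⟨∑ k ∈ Finset.range n, C ((cauchyPowerSeries f 0 s).coeff k) * X ^ k, fun z hz => ?_⟩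
  have h1 := hn z (Metric.closedBall_subset_ball ht1 hz)
  rw [zero_add, Complex.dist_eq] at h1
  refine le_of_eq_of_le ?_ h1.le
  congr 2
  simp only [eval_finsetSum, eval_mul, eval_C, eval_pow, eval_X,
    FormalMultilinearSeries.partialSum, FormalMultilinearSeries.apply_eq_pow_smul_coeff,
    smul_eq_mul, mul_comm]

/-- The dilate `z ↦ f (t z)` with `t < 1` is holomorphic on a larger disk, where Taylor polynomials
converge, and is uniformly close to `f` when `t` is close to `1`. -/
lemma exists_polynomial_near {f : ℂ → ℂ} {R : ℝ} (hR : 0 < R)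
    (hc : ContinuousOn f (Metric.closedBall 0 R)) (hf : DifferentiableOn ℂ f (Metric.ball 0 R))
    {ε : ℝ} (hε : 0 < ε) :
    ∃ p : ℂ[X], ∀ z ∈ Metric.closedBall (0 : ℂ) R, ‖f z - p.eval z‖ ≤ ε := by
  have huc := (isCompact_closedBall (0 : ℂ) R).uniformContinuousOn_of_continuous hc
  obtain ⟨δ, hδ, hδε⟩ := Metric.uniformContinuousOn_iff.1 huc (ε / 2) (half_pos hε)
  obtain ⟨t, ht, ht1⟩ := exists_between (max_lt (show (1 : ℝ) - δ / (R + 1) < 1 by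
    have : 0 < δ / (R + 1) := by positivity
    linarith) zero_lt_one)
  have ht0 : 0 < t := (le_max_right _ _).trans_lt ht
  have htδ : 1 - δ / (R + 1) < t := (le_max_left _ _).trans_lt ht
  have hnt : ∀ z : ℂ, ‖(t : ℂ) * z‖ = t * ‖z‖ := fun z => by
    rw [norm_mul, Complex.norm_of_nonneg ht0.le]
  obtain ⟨p, hp⟩ := exists_polynomial_near_of_differentiableOn (f := fun z => f (t * z))
    (R := R) (R' := R / t) hR.le ((lt_div_iff₀ ht0).2 (by nlinarith))
    (hf.comp (by fun_prop) fun z hz => by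
      rw [mem_ball_zero_iff] at hz ⊢
      rw [hnt]
      rwa [lt_div_iff₀' ht0] at hz) (half_pos hε)
  refine ⟨p, fun z hz => ?_⟩
  have hz' : ‖z‖ ≤ R := by simpa using hz
  have h1 : ‖f z - f (t * z)‖ < ε / 2 := by
    rw [← Complex.dist_eq]
    refine hδε z hz _ ?_ ?_
    · rw [mem_closedBall_zero_iff, hnt]
      nlinarith [norm_nonneg z]
    · rw [Complex.dist_eq, show z - t * z = ((1 - t : ℝ) : ℂ) * z by push_cast; ring, norm_mul,
        Complex.norm_of_nonneg (by linarith)]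
      have h2 : (1 - t) * (R + 1) < δ := by
        rw [← lt_div_iff₀ (by positivity)]; linarith
      nlinarith [norm_nonneg z]
  calc ‖f z - p.eval z‖ ≤ ‖f z - f (t * z)‖ + ‖f (t * z) - p.eval z‖ := by
        simpa using norm_add_le (f z - f (t * z)) (f (t * z) - p.eval z)
    _ ≤ ε := by linarith [hp z hz]

/-- A function holomorphic outside a disk and vanishing at infinity is a uniform limit of
polynomials in `1 / (z - c)`. -/
lemma exists_polynomial_inv_near {h : ℂ → ℂ} {c : ℂ} {r M : ℝ} (hr : 0 < r)
    (hc : ContinuousOn h {z | r ≤ ‖z - c‖}) (hd : DifferentiableOn ℂ h {z | r < ‖z - c‖})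
    (hM : ∀ z, r < ‖z - c‖ → ‖h z‖ ≤ M * r / (‖z - c‖ - r)) {ε : ℝ} (hε : 0 < ε) :
    ∃ p : ℂ[X], ∀ z, r ≤ ‖z - c‖ → ‖h z - p.eval (1 / (z - c))‖ ≤ ε := by
  have hM0 : 0 ≤ M := by
    have h1 : ‖(c + (2 * r : ℝ)) - c‖ = 2 * r := by
      rw [add_sub_cancel_left, Complex.norm_of_nonneg (by positivity)]
    have h2 := (norm_nonneg _).trans (hM (c + (2 * r : ℝ)) (by rw [h1]; linarith))
    rw [h1, show M * r / (2 * r - r) = M by field_simp; ring] at h2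
    exact h2
  -- The inversion `ζ = 1 / (z - c)` turns the exterior of the disk into a punctured disk. The decay
  -- of `h` makes the singularity at `ζ = 0` removable with value `0`, so approximation on a disk
  -- applies.
  set u : ℂ → ℂ := fun ζ => if ζ = 0 then 0 else h (c + 1 / ζ) with hu
  have hu' : ∀ ζ ≠ 0, u =ᶠ[𝓝 ζ] fun ζ => h (c + 1 / ζ) := fun ζ hζ => by
    filter_upwards [isOpen_ne.mem_nhds hζ] with x hx
    exact if_neg hx
  have hn : ∀ ζ : ℂ, ‖c + 1 / ζ - c‖ = 1 / ‖ζ‖ := fun ζ => by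
    rw [add_sub_cancel_left, norm_div, norm_one]
  have h0 : ContinuousAt u 0 := by
    have hu0 : u 0 = 0 := if_pos rfl
    rw [ContinuousAt, hu0, tendsto_zero_iff_norm_tendsto_zero]
    have hlim : Tendsto (fun ζ : ℂ => 2 * M * r * ‖ζ‖) (𝓝 0) (𝓝 0) := by
      have : Continuous fun ζ : ℂ => 2 * M * r * ‖ζ‖ := by fun_prop
      simpa using this.tendsto 0
    refine squeeze_zero' (Eventually.of_forall fun _ => norm_nonneg _) ?_ hlim
    filter_upwards [Metric.ball_mem_nhds (0 : ℂ) (show 0 < 1 / (2 * r) by positivity)] with ζ hζ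
    rw [mem_ball_zero_iff] at hζ
    by_cases hz : ζ = 0
    · simp only [hu, hz, if_true, norm_zero]
      positivity
    · have hz' : 0 < ‖ζ‖ := norm_pos_iff.2 hz
      have h2r : 2 * r < 1 / ‖ζ‖ := by
        rw [lt_div_iff₀ hz']
        rwa [lt_div_iff₀' (by positivity)] at hζ
      simp only [hu, if_neg hz]
      refine (hM _ (by rw [hn]; linarith)).trans ?_
      rw [hn]
      calc M * r / (1 / ‖ζ‖ - r) ≤ M * r / (1 / ‖ζ‖ / 2) := by
            apply div_le_div_of_nonneg_left <;> first | positivity | linarith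
        _ = 2 * M * r * ‖ζ‖ := by field_simp
  have hmaps : ∀ ζ : ℂ, ζ ≠ 0 → ζ ∈ Metric.ball (0 : ℂ) (1 / r) → r < ‖c + 1 / ζ - c‖ := by
    intro ζ hζ hb
    rw [mem_ball_zero_iff] at hb
    rwa [hn, lt_one_div hr (norm_pos_iff.2 hζ)]
  have hud : DifferentiableOn ℂ u (Metric.ball 0 (1 / r)) := by
    refine (Complex.differentiableOn_compl_singleton_and_continuousAt_iff
      (Metric.ball_mem_nhds _ (by positivity))).1 ⟨fun ζ hζ => ?_, h0⟩
    have hζ0 : ζ ≠ 0 := hζ.2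
    have hopen : IsOpen {z : ℂ | r < ‖z - c‖} := isOpen_lt continuous_const (by fun_prop)
    have h1 : DifferentiableAt ℂ h (c + 1 / ζ) :=
      hd.differentiableAt (hopen.mem_nhds (hmaps ζ hζ0 hζ.1))
    refine DifferentiableAt.differentiableWithinAt ?_
    refine DifferentiableAt.congr_of_eventuallyEq ?_ (hu' ζ hζ0)
    refine h1.comp ζ (f := fun ζ => c + 1 / ζ) ?_
    exact (differentiableAt_const c).add ((differentiableAt_const 1).div differentiableAt_id hζ0)
  have huc : ContinuousOn u (Metric.closedBall 0 (1 / r)) := by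
    intro ζ hζ
    by_cases hζ0 : ζ = 0
    · rw [hζ0]; exact h0.continuousWithinAt
    · have hsub : Metric.closedBall (0 : ℂ) (1 / r) ∩ {ζ | ζ ≠ 0} ∈
          𝓝[Metric.closedBall (0 : ℂ) (1 / r)] ζ :=
        inter_mem_nhdsWithin _ (isOpen_ne.mem_nhds hζ0)
      have hm : Set.MapsTo (fun ζ : ℂ => c + 1 / ζ) (Metric.closedBall (0 : ℂ) (1 / r) ∩
          {ζ | ζ ≠ 0}) {z | r ≤ ‖z - c‖} := by
        rintro x ⟨hx, hx0⟩
        have hx1 : ‖x‖ ≤ 1 / r := by simpa using hx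
        change r ≤ ‖c + 1 / x - c‖
        rwa [hn, le_one_div hr (norm_pos_iff.2 hx0)]
      have h1 : ContinuousOn (fun ζ : ℂ => h (c + 1 / ζ)) (Metric.closedBall (0 : ℂ) (1 / r) ∩
          {ζ | ζ ≠ 0}) := by
        refine hc.comp ?_ hm
        exact continuousOn_const.add (continuousOn_const.div continuousOn_id fun x hx => hx.2)
      have h2 := h1 ζ ⟨hζ, hζ0⟩
      refine ContinuousWithinAt.mono_of_mem_nhdsWithin (h2.congr (fun x hx => if_neg hx.2)
        (if_neg hζ0)) hsub
  obtain ⟨p, hp⟩ := exists_polynomial_near (R := 1 / r) (by positivity) huc hud hε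
  refine ⟨p, fun z hz => ?_⟩
  have hzc : z - c ≠ 0 := norm_pos_iff.1 (hr.trans_le hz)
  have h1 := hp (1 / (z - c)) (by
    rw [mem_closedBall_zero_iff, norm_div, norm_one]
    exact one_div_le_one_div_of_le hr hz)
  have h2 : u (1 / (z - c)) = h z := by
    simp only [hu]
    rw [if_neg (one_div_ne_zero hzc), one_div_one_div, add_sub_cancel]
  rwa [h2] at h1

/-! ### Laurent splitting -/

lemma differentiableAt_cauchyIntegral_outside {f : ℂ → ℂ} {c : ℂ} {r : ℝ} (hr : 0 < r)
    (hf : ContinuousOn f (Metric.sphere c r)) {z₀ : ℂ} (hz₀ : r < ‖z₀ - c‖) :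
    DifferentiableAt ℂ (fun z => ∮ w in C(c, r), (w - z)⁻¹ * f w) z₀ := by
  set δ := ‖z₀ - c‖ - r with hδ
  have hδ0 : 0 < δ := by linarith
  obtain ⟨B, hB⟩ := (isCompact_sphere c r).exists_bound_of_continuousOn hf
  have hB0 : 0 ≤ B := (norm_nonneg _).trans (hB (circleMap c r 0) (circleMap_mem_sphere c hr.le 0))
  have hfc : Continuous fun θ => f (circleMap c r θ) :=
    hf.comp_continuous (continuous_circleMap c r) fun θ => circleMap_mem_sphere c hr.le θ
  have hfar : ∀ z ∈ Metric.ball z₀ (δ / 2), ∀ θ, δ / 2 ≤ ‖circleMap c r θ - z‖ := by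
    intro z hz θ
    rw [Metric.mem_ball, Complex.dist_eq] at hz
    have h1 : ‖circleMap c r θ - c‖ = r := by
      simpa [Complex.dist_eq] using circleMap_mem_sphere c hr.le θ
    have h2 : ‖z₀ - c‖ ≤ ‖z - z₀‖ + ‖circleMap c r θ - z‖ + ‖circleMap c r θ - c‖ := by
      have e : z₀ - c = -(z - z₀) - (circleMap c r θ - z) + (circleMap c r θ - c) := by ring
      rw [e]
      refine (norm_add_le _ _).trans (add_le_add_left ((norm_sub_le _ _).trans ?_) _)
      rw [norm_neg]
    linarith
  have hne : ∀ z ∈ Metric.ball z₀ (δ / 2), ∀ θ, circleMap c r θ - z ≠ 0 := fun z hz θ =>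
    norm_pos_iff.1 (lt_of_lt_of_le (half_pos hδ0) (hfar z hz θ))
  have hcm := continuous_circleMap c r
  have hcm0 := continuous_circleMap 0 r
  have hcont : ∀ z ∈ Metric.ball z₀ (δ / 2), Continuous fun θ =>
      (circleMap 0 r θ * Complex.I) * ((circleMap c r θ - z)⁻¹ * f (circleMap c r θ)) := by
    intro z hz
    exact (hcm0.mul continuous_const).mul
      (((hcm.sub continuous_const).inv₀ (hne z hz)).mul hfc)
  simp only [circleIntegral, deriv_circleMap, smul_eq_mul]
  refine (intervalIntegral.hasDerivAt_integral_of_dominated_loc_of_deriv_le (μ := volume)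
    (F := fun z θ => (circleMap 0 r θ * Complex.I) *
      ((circleMap c r θ - z)⁻¹ * f (circleMap c r θ)))
    (F' := fun z θ => (circleMap 0 r θ * Complex.I) *
      (1 / (circleMap c r θ - z) ^ 2 * f (circleMap c r θ)))
    (bound := fun _ => r * (1 / (δ / 2) ^ 2 * B))
    (Metric.ball_mem_nhds z₀ (half_pos hδ0)) ?_ ?_ ?_ ?_ ?_ ?_).2.differentiableAt
  · filter_upwards [Metric.ball_mem_nhds z₀ (half_pos hδ0)] with z hz
    exact (hcont z hz).aestronglyMeasurable
  · exact (hcont z₀ (Metric.mem_ball_self (half_pos hδ0))).intervalIntegrable _ _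
  · refine Continuous.aestronglyMeasurable ((hcm0.mul continuous_const).mul (Continuous.mul ?_ hfc))
    exact continuous_const.div ((hcm.sub continuous_const).pow 2) fun θ =>
      pow_ne_zero 2 (hne z₀ (Metric.mem_ball_self (half_pos hδ0)) θ)
  · refine ae_of_all _ fun θ _ z hz => ?_
    rw [norm_mul, norm_mul, norm_mul, Complex.norm_I, mul_one, norm_circleMap_zero, abs_of_pos hr,
      norm_div, norm_one, norm_pow]
    have h1 := hfar z hz θ
    gcongr
    exact hB _ (circleMap_mem_sphere c hr.le θ)
  · exact intervalIntegrable_const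
  · refine ae_of_all _ fun θ _ z hz => ?_
    have h3 : HasDerivAt (fun x => (circleMap c r θ - x)⁻¹) (1 / (circleMap c r θ - z) ^ 2) z := by
      simpa using ((hasDerivAt_id' z).const_sub (circleMap c r θ)).fun_inv (hne z hz θ)
    exact (h3.mul_const _).const_mul _

/-- **Laurent splitting** on a closed annulus, with bounds. -/
theorem exists_laurent_splitting {f : ℂ → ℂ} {c : ℂ} {r R : ℝ} (hr : 0 < r) (hrR : r < R)
    (hc : ContinuousOn f {z | r ≤ ‖z - c‖ ∧ ‖z - c‖ ≤ R})
    (hd : DifferentiableOn ℂ f {z | r < ‖z - c‖ ∧ ‖z - c‖ < R}) :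
    ∃ g h : ℂ → ℂ, ContinuousOn g (Metric.closedBall c R) ∧
      DifferentiableOn ℂ g (Metric.ball c R) ∧ ContinuousOn h {z | r ≤ ‖z - c‖} ∧
      DifferentiableOn ℂ h {z | r < ‖z - c‖} ∧
      (∀ z, r ≤ ‖z - c‖ → ‖z - c‖ ≤ R → f z = g z + h z) ∧
      ∀ κ M, (∀ z, r ≤ ‖z - c‖ → ‖z - c‖ ≤ R → ‖f z - κ‖ ≤ M) →
        (∀ z, r < ‖z - c‖ → ‖h z‖ ≤ M * r / (‖z - c‖ - r)) ∧
        (∀ z, ‖z - c‖ < R → ‖g z - κ‖ ≤ M * R / (R - ‖z - c‖)) := by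
  have hR : 0 < R := hr.trans hrR
  have hpi := Real.pi_pos
  have h2pi : (2 * Real.pi * Complex.I : ℂ) ≠ 0 := by simp [Real.pi_ne_zero, Complex.I_ne_zero]
  have hsr : Metric.sphere c r ⊆ {z | r ≤ ‖z - c‖ ∧ ‖z - c‖ ≤ R} := fun z hz => by
    rw [mem_sphere_iff_norm] at hz
    exact ⟨hz.ge, hz.le.trans hrR.le⟩
  have hsR : Metric.sphere c R ⊆ {z | r ≤ ‖z - c‖ ∧ ‖z - c‖ ≤ R} := fun z hz => by
    rw [mem_sphere_iff_norm] at hz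
    exact ⟨hrR.le.trans hz.ge, hz.le⟩
  have hci : ∀ ρ > 0, ∀ φ : ℂ → ℂ, ContinuousOn φ (Metric.sphere c ρ) → ∀ z, ‖z - c‖ ≠ ρ →
      CircleIntegrable (fun w => (w - z)⁻¹ * φ w) c ρ := by
    intro ρ hρ φ hφ z hz
    refine ContinuousOn.circleIntegrable hρ.le (ContinuousOn.mul ?_ hφ)
    refine (continuousOn_id.sub continuousOn_const).inv₀ fun w hw h => hz ?_
    rw [← show w = z from sub_eq_zero.1 h]
    exact mem_sphere_iff_norm.1 hw
  have hcir := hci r hr f (hc.mono hsr)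
  have hciR := hci R hR f (hc.mono hsR)
  have hkr := fun z κ => hci r hr (fun _ => κ) continuousOn_const z
  have hkR := fun z κ => hci R hR (fun _ => κ) continuousOn_const z
  have hκr : ∀ z κ, r < ‖z - c‖ → (∮ w in C(c, r), (w - z)⁻¹ * κ) = 0 := by
    intro z κ hz
    have h1 := circleIntegral_inv_sub_of_notMem (w := z) (c := c) hr.le (by
      rw [mem_closedBall_iff_norm]; exact not_le.2 hz)
    have e : ∀ w, (w - z)⁻¹ * κ = (-κ) * (z - w)⁻¹ := fun w => by
      rw [← neg_sub z w, inv_neg]; ring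
    simp only [e]
    rw [circleIntegral.integral_const_mul, h1, mul_zero]
  have hκR : ∀ z κ, ‖z - c‖ < R →
      (∮ w in C(c, R), (w - z)⁻¹ * κ) = 2 * Real.pi * Complex.I * κ := by
    intro z κ hz
    have h1 := circleIntegral.integral_sub_inv_of_mem_ball (w := z) (c := c) (R := R) (by
      rwa [mem_ball_iff_norm])
    simp only [mul_comm _ κ]
    rw [circleIntegral.integral_const_mul, h1]
  -- `G` and `H` are the Cauchy integrals over the outer and the (negatively oriented) inner circle.
  -- A constant `κ` contributes `κ` to `G` inside and nothing to `H` outside, which is why the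
  -- bounds involve only `f - κ`.
  set G : ℂ → ℂ := fun z => (2 * Real.pi * Complex.I)⁻¹ * ∮ w in C(c, R), (w - z)⁻¹ * f w with hG
  set H : ℂ → ℂ := fun z => -((2 * Real.pi * Complex.I)⁻¹ * ∮ w in C(c, r), (w - z)⁻¹ * f w)
    with hH
  have hGd : DifferentiableOn ℂ G (Metric.ball c R) := by
    set ρ : NNReal := ⟨R, hR.le⟩ with hρ
    have := (hasFPowerSeriesOn_cauchy_integral (R := ρ)
      ((hc.mono hsR).circleIntegrable hR.le) hR).differentiableOn
    have e : Metric.eball c (ρ : ENNReal) = Metric.ball c R := Metric.eball_coe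
    rw [e] at this
    exact this
  have hHd : DifferentiableOn ℂ H {z | r < ‖z - c‖} := fun z hz =>
    ((differentiableAt_cauchyIntegral_outside hr (hc.mono hsr) hz).const_mul
      _).neg.differentiableWithinAt
  have hrO : IsOpen {z : ℂ | r < ‖z - c‖} := isOpen_lt continuous_const (by fun_prop)
  have hRO : IsOpen {z : ℂ | ‖z - c‖ < R} := isOpen_lt (by fun_prop) continuous_const
  have hopen : IsOpen {z : ℂ | r < ‖z - c‖ ∧ ‖z - c‖ < R} := hrO.inter hRO
  have hsplit : ∀ z, r < ‖z - c‖ → ‖z - c‖ < R → f z = G z + H z := by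
    intro z h1 h2
    have hz : DifferentiableAt ℂ f z := hd.differentiableAt (hopen.mem_nhds ⟨h1, h2⟩)
    -- The slope of `f` at `z` is continuous across `z`, so Cauchy's theorem on the annulus applies
    -- to it with `z` as an exceptional point, and no small circle around `z` is needed.
    have hA := Complex.circleIntegral_eq_of_differentiable_on_annulus_off_countable (c := c) hr
      hrR.le (f := dslope f z) (Set.countable_singleton z) (fun w hw => by
        by_cases hwz : w = z
        · rw [hwz]; exact (continuousAt_dslope_same.2 hz).continuousWithinAt
        · refine (continuousWithinAt_dslope_of_ne hwz).2 ?_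
          refine (hc w ?_).mono ?_
          · have a1 := hw.1
            have a2 := hw.2
            rw [mem_closedBall_iff_norm] at a1
            rw [mem_ball_iff_norm, not_lt] at a2
            exact ⟨a2, a1⟩
          · intro x hx
            have a1 := hx.1
            have a2 := hx.2
            rw [mem_closedBall_iff_norm] at a1
            rw [mem_ball_iff_norm, not_lt] at a2
            exact ⟨a2, a1⟩)
      (fun w hw => by
        refine (differentiableAt_dslope_of_ne hw.2).2 ?_
        refine hd.differentiableAt (hopen.mem_nhds ?_)
        have a1 := hw.1.1
        have a2 := hw.1.2
        rw [mem_ball_iff_norm] at a1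
        rw [mem_closedBall_iff_norm, not_le] at a2
        exact ⟨a2, a1⟩)
    have e : ∀ ρ > 0, ‖z - c‖ ≠ ρ → (∮ w in C(c, ρ), dslope f z w) =
        ∮ w in C(c, ρ), ((w - z)⁻¹ * f w - (w - z)⁻¹ * f z) := by
      intro ρ hρ hne
      refine circleIntegral.integral_congr hρ.le fun w hw => ?_
      have hwz : w ≠ z := by
        rintro rfl
        exact hne (mem_sphere_iff_norm.1 hw)
      simp only [dslope_of_ne _ hwz, slope_def_module, smul_eq_mul, mul_sub]
    rw [e R hR h2.ne, e r hr h1.ne', circleIntegral.integral_sub (hciR z h2.ne) (hkR z _ h2.ne),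
      circleIntegral.integral_sub (hcir z h1.ne') (hkr z _ h1.ne'), hκr z _ h1, hκR z _ h2,
      sub_zero] at hA
    simp only [hG, hH]
    rw [← hA]
    field_simp
    ring
  have hGκ : ∀ κ M, (∀ z, r ≤ ‖z - c‖ → ‖z - c‖ ≤ R → ‖f z - κ‖ ≤ M) → ∀ z, ‖z - c‖ < R →
      ‖G z - κ‖ ≤ M * R / (R - ‖z - c‖) := by
    intro κ M hM z hz
    have e : G z - κ = (2 * Real.pi * Complex.I)⁻¹ • ∮ w in C(c, R), (w - z)⁻¹ * (f w - κ) := by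
      simp only [mul_sub]
      rw [circleIntegral.integral_sub (hciR z hz.ne) (hkR z _ hz.ne), hκR z _ hz, smul_eq_mul,
        mul_sub, inv_mul_cancel_left₀ h2pi]
    rw [e]
    refine (circleIntegral.norm_two_pi_i_inv_smul_integral_le_of_norm_le_const hR.le
      (C := (R - ‖z - c‖)⁻¹ * M) fun w hw => ?_).trans (le_of_eq (by ring))
    have hwR := mem_sphere_iff_norm.1 hw
    have h3 : R - ‖z - c‖ ≤ ‖w - z‖ := by
      have := norm_sub_norm_le (w - c) (z - c)
      rwa [sub_sub_sub_cancel_right, hwR] at this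
    rw [norm_mul, norm_inv]
    have h4 : 0 < R - ‖z - c‖ := by linarith
    have h5 := hM w (hrR.le.trans hwR.ge) hwR.le
    gcongr
  have hHκ : ∀ κ M, (∀ z, r ≤ ‖z - c‖ → ‖z - c‖ ≤ R → ‖f z - κ‖ ≤ M) → ∀ z, r < ‖z - c‖ →
      ‖H z‖ ≤ M * r / (‖z - c‖ - r) := by
    intro κ M hM z hz
    have e : H z = -((2 * Real.pi * Complex.I)⁻¹ •
        ∮ w in C(c, r), (w - z)⁻¹ * (f w - κ)) := by
      simp only [mul_sub]
      rw [circleIntegral.integral_sub (hcir z hz.ne') (hkr z _ hz.ne'), hκr z _ hz, smul_eq_mul,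
        sub_zero]
    rw [e, norm_neg]
    refine (circleIntegral.norm_two_pi_i_inv_smul_integral_le_of_norm_le_const hr.le
      (C := (‖z - c‖ - r)⁻¹ * M) fun w hw => ?_).trans (le_of_eq (by ring))
    have hwr := mem_sphere_iff_norm.1 hw
    have h3 : ‖z - c‖ - r ≤ ‖w - z‖ := by
      have := norm_sub_norm_le (z - c) (w - c)
      rwa [sub_sub_sub_cancel_right, hwr, norm_sub_rev z w] at this
    rw [norm_mul, norm_inv]
    have h4 : 0 < ‖z - c‖ - r := by linarith
    have h5 := hM w hwr.ge (hwr.le.trans hrR.le)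
    gcongr
  -- The Cauchy integrals are controlled only off their circles. As `f = G + H` on the open annulus,
  -- the formula `f - H` continues `G` continuously up to the outer circle, and `f - G` continues
  -- `H` up to the inner one.
  set g : ℂ → ℂ := fun z => if ‖z - c‖ < R then G z else f z - H z with hg
  set h : ℂ → ℂ := fun z => if r < ‖z - c‖ then H z else f z - G z with hh
  have hgG : ∀ z, ‖z - c‖ < R → g z = G z := fun z hz => if_pos hz
  have hhH : ∀ z, r < ‖z - c‖ → h z = H z := fun z hz => if_pos hz
  have hgf : ∀ z, r < ‖z - c‖ → g z = f z - H z := fun z hz => by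
    by_cases h2 : ‖z - c‖ < R
    · rw [hgG z h2, hsplit z hz h2]; ring
    · exact if_neg h2
  have hhf : ∀ z, ‖z - c‖ < R → h z = f z - G z := fun z hz => by
    by_cases h2 : r < ‖z - c‖
    · rw [hhH z h2, hsplit z h2 hz]; ring
    · exact if_neg h2
  refine ⟨g, h, ?_, ?_, ?_, ?_, ?_, fun κ M hM => ⟨fun z hz => ?_, fun z hz => ?_⟩⟩
  · intro z hz
    rw [mem_closedBall_iff_norm] at hz
    rcases lt_or_ge r ‖z - c‖ with h1 | h1
    · have h2 : ContinuousOn (fun z => f z - H z) ({z | r < ‖z - c‖} ∩ Metric.closedBall c R) := by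
        refine ContinuousOn.sub (hc.mono ?_) (hHd.continuousOn.mono Set.inter_subset_left)
        exact fun x hx => ⟨le_of_lt hx.1, mem_closedBall_iff_norm.1 hx.2⟩
      refine ((h2 z ⟨h1, mem_closedBall_iff_norm.2 hz⟩).congr (fun x hx => hgf x hx.1)
        (hgf z h1)).mono_of_mem_nhdsWithin ?_
      rw [Set.inter_comm]
      exact inter_mem_nhdsWithin _ (hrO.mem_nhds h1)
    · have h2 : ‖z - c‖ < R := h1.trans_lt hrR
      refine ContinuousAt.continuousWithinAt ?_
      refine (hGd.differentiableAt (Metric.isOpen_ball.mem_nhds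
        (mem_ball_iff_norm.2 h2))).continuousAt.congr ?_
      filter_upwards [hRO.mem_nhds h2] with x hx
      exact (hgG x hx).symm
  · exact hGd.congr fun z hz => hgG z (mem_ball_iff_norm.1 hz)
  · intro z hz
    have hz : r ≤ ‖z - c‖ := hz
    rcases lt_or_ge ‖z - c‖ R with h1 | h1
    · have h2 : ContinuousOn (fun z => f z - G z) ({z | ‖z - c‖ < R} ∩ {z | r ≤ ‖z - c‖}) := by
        refine ContinuousOn.sub (hc.mono fun x hx => ⟨hx.2, le_of_lt hx.1⟩)
          (hGd.continuousOn.mono fun x hx => mem_ball_iff_norm.2 hx.1)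
      refine ((h2 z ⟨h1, hz⟩).congr (fun x hx => hhf x hx.1)
        (hhf z h1)).mono_of_mem_nhdsWithin ?_
      rw [Set.inter_comm]
      exact inter_mem_nhdsWithin _ (hRO.mem_nhds h1)
    · have h2 : r < ‖z - c‖ := hrR.trans_le h1
      refine ContinuousAt.continuousWithinAt ?_
      refine (hHd.differentiableAt (hrO.mem_nhds h2)).continuousAt.congr ?_
      filter_upwards [hrO.mem_nhds h2] with x hx
      exact (hhH x hx).symm
  · exact hHd.congr fun z hz => hhH z hz
  · intro z h1 h2
    rcases lt_or_ge r ‖z - c‖ with h3 | h3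
    · rw [hgf z h3, hhH z h3]; ring
    · have h4 : ‖z - c‖ < R := h3.trans_lt hrR
      rw [hgG z h4, hhf z h4]; ring
  · rw [hhH z hz]; exact hHκ κ M hM z hz
  · rw [hgG z hz]; exact hGκ κ M hM z hz

/-! ### The removed disks -/

/-- Pairwise far apart points `c k`, clustering exactly at `K₀`: `d k` is a lower bound for the
distance from `c k` to `K₀`, to the other points and to the unit circle. -/
structure IsSeparatedSequence (K₀ : Set ℂ) (c : ℕ → ℂ) (d : ℕ → ℝ) : Prop where
  pos : ∀ k, 0 < d k
  le_norm_sub : ∀ k, ∀ z ∈ K₀, d k ≤ ‖z - c k‖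
  le_norm_sub_center : ∀ j k, j ≠ k → d k ≤ ‖c j - c k‖
  norm_add_le : ∀ k, ‖c k‖ + d k ≤ 1
  near : ∀ k : ℕ, ∃ x ∈ K₀, ‖c k - x‖ ≤ 1 / (k + 1)
  cluster : ∀ x, MapClusterPt x atTop c ↔ x ∈ K₀

/-- As `K₀` has empty interior, each point of a sequence running infinitely often through a dense
subset of `K₀` can be approximated from outside `K₀`, with errors tending to `0` and avoiding the
earlier choices. The resulting points cluster only on `K₀`, so each of them has positive distance
from all the others. -/
lemma exists_separatedSequence {K₀ : Set ℂ} (hK : IsCompact K₀) (hne : K₀.Nonempty)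
    (hint : interior K₀ = ∅) (hball : ∀ z ∈ K₀, ‖z‖ ≤ 3 / 4) :
    ∃ c d, IsSeparatedSequence K₀ c d := by
  have : Nonempty K₀ := hne.to_subtype
  -- The first component of `Nat.unpair` takes every value infinitely often, so every term of the
  -- dense sequence is visited infinitely often.
  set x : ℕ → K₀ := fun k => TopologicalSpace.denseSeq K₀ k.unpair.1 with hx
  have hpos : ∀ k : ℕ, (0 : ℝ) < 1 / (8 * (k + 1)) := fun k => by positivity
  have hex : ∀ (s : Finset ℂ) (k : ℕ), ∃ z, z ∉ s ∧ z ∉ K₀ ∧ ‖z - x k‖ < 1 / (8 * (k + 1)) := by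
    intro s k
    have hd : Dense (K₀ᶜ ∩ (s : Set ℂ)ᶜ) := by
      refine Dense.inter_of_isOpen_left (interior_eq_empty_iff_dense_compl.1 hint)
        (s.finite_toSet.countable.dense_compl ℝ) hK.isClosed.isOpen_compl
    obtain ⟨z, hz, hzb⟩ := hd.exists_mem_open Metric.isOpen_ball
      ⟨_, Metric.mem_ball_self (x := (x k : ℂ)) (hpos k)⟩
    exact ⟨z, fun h => hz.2 h, hz.1, by rwa [Metric.mem_ball, Complex.dist_eq] at hzb⟩
  choose f hfs hfK hfx using hex
  -- `S k` is the set of the points chosen before step `k`, which the new point must avoid.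
  set S : ℕ → Finset ℂ := fun n => Nat.rec ∅ (fun k s => insert (f s k) s) n with hS
  set c : ℕ → ℂ := fun k => f (S k) k with hc
  have hSs : ∀ k, S (k + 1) = insert (c k) (S k) := fun k => rfl
  have hSm : Monotone S := monotone_nat_of_le_succ fun k => by
    rw [hSs]; exact Finset.subset_insert _ _
  have hcne : ∀ j k, j < k → c j ≠ c k := by
    intro j k hjk h
    have h1 : c j ∈ S k := hSm hjk (by rw [hSs]; exact Finset.mem_insert_self _ _)
    exact hfs (S k) k (by rw [h] at h1; exact h1)
  have hcne' : ∀ j k, j ≠ k → c j ≠ c k := fun j k hjk => by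
    rcases lt_or_gt_of_ne hjk with h | h
    · exact hcne j k h
    · exact (hcne k j h).symm
  have hcx : ∀ k, ‖c k - x k‖ < 1 / (8 * (k + 1)) := fun k => hfx _ k
  have hcx' : ∀ k : ℕ, ‖c k - x k‖ ≤ 1 / (k + 1) := fun k => (hcx k).le.trans (by
    apply one_div_le_one_div_of_le (by positivity)
    have : (0 : ℝ) ≤ k := k.cast_nonneg
    linarith)
  have hcn : ∀ k, ‖c k‖ < 1 := by
    intro k
    have h1 := hball _ (x k).2
    have h2 : (1 : ℝ) / (8 * (k + 1)) ≤ 1 / 8 := by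
      apply one_div_le_one_div_of_le (by norm_num)
      have : (0 : ℝ) ≤ k := k.cast_nonneg
      linarith
    have h3 := norm_sub_norm_le (c k) (x k)
    linarith [hcx k]
  have hlim : Tendsto (fun k : ℕ => (1 : ℝ) / (k + 1)) atTop (𝓝 0) :=
    tendsto_one_div_add_atTop_nhds_zero_nat
  have hd : ∀ k, ∃ d : ℝ, 0 < d ∧ (∀ z ∈ K₀, d ≤ ‖z - c k‖) ∧ (∀ j, j ≠ k → d ≤ ‖c j - c k‖) ∧
      ‖c k‖ + d ≤ 1 := by
    intro k
    obtain ⟨e, he, hek⟩ := Metric.isOpen_iff.1 hK.isClosed.isOpen_compl (c k) (hfK (S k) k)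
    have heK : ∀ z ∈ K₀, e ≤ ‖z - c k‖ := fun z hz => by
      by_contra! h
      exact hek (by rwa [Metric.mem_ball, Complex.dist_eq]) hz
    -- Here `e` bounds from below the distance from `c k` to `K₀`. From index `N` on, the points are
    -- within `e / 2` of `K₀`, so at least `e / 2` away from `c k`; only finitely many others
    -- constrain `d`.
    obtain ⟨N, hN⟩ := (hlim.eventually_lt_const (half_pos he)).exists_forall_of_atTop
    have h1 : ∀ᶠ d : ℝ in 𝓝[>] 0, ∀ j ∈ Finset.range N, j ≠ k → d ≤ ‖c j - c k‖ := by
      refine (Finset.range N).eventually_all.2 fun j _ => ?_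
      by_cases hjk : j = k
      · exact Eventually.of_forall fun d h => absurd hjk h
      · filter_upwards [nhdsWithin_le_nhds (gt_mem_nhds
          (norm_pos_iff.2 (sub_ne_zero.2 (hcne' j k hjk))))] with d hd _ using le_of_lt hd
    have h2 : ∀ᶠ d : ℝ in 𝓝[>] 0, d < e / 2 := nhdsWithin_le_nhds (gt_mem_nhds (half_pos he))
    have h3 : ∀ᶠ d : ℝ in 𝓝[>] 0, d < 1 - ‖c k‖ :=
      nhdsWithin_le_nhds (gt_mem_nhds (by linarith [hcn k]))
    obtain ⟨d, hd1, hd2, hd3, hd4⟩ :=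
      (h1.and (h2.and (h3.and (self_mem_nhdsWithin (a := (0 : ℝ)) (s := Set.Ioi 0))))).exists
    have hd4 : 0 < d := hd4
    refine ⟨d, hd4, fun z hz => by linarith [heK z hz], fun j hj => ?_, by linarith⟩
    by_cases hjN : j < N
    · exact hd1 j (Finset.mem_range.2 hjN) hj
    · have h4 := hN j (not_lt.1 hjN)
      have h5 := heK _ (x j).2
      have h6 := norm_sub_le (c j - c k) (c j - x j)
      rw [sub_sub_sub_cancel_left] at h6
      linarith [hcx' j]
  choose d hd0 hdK hdc hd1 using hd
  refine ⟨c, d, hd0, hdK, fun j k h => hdc k j h, hd1, fun k => ⟨x k, (x k).2, hcx' k⟩, fun p => ?_⟩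
  rw [mapClusterPt_iff_frequently]
  constructor
  · intro hp
    rw [← hK.isClosed.closure_eq, Metric.mem_closure_iff]
    intro ε hε
    obtain ⟨k, hk1, hk2⟩ := ((hp _ (Metric.ball_mem_nhds p (half_pos hε))).and_eventually
      (hlim.eventually_lt_const (half_pos hε))).exists
    refine ⟨x k, (x k).2, ?_⟩
    have h1 := hcx' k
    rw [← Complex.dist_eq] at h1
    rw [Metric.mem_ball] at hk1
    calc dist p (x k) ≤ dist (c k) p + dist (c k) (x k) := dist_triangle_left _ _ _
      _ < ε := by linarith
  · intro hp s hs
    obtain ⟨ε, hε, hεs⟩ := Metric.mem_nhds_iff.1 hs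
    obtain ⟨_, hm, m, rfl⟩ := Metric.dense_iff.1 (TopologicalSpace.denseRange_denseSeq K₀)
      (⟨p, hp⟩ : K₀) (ε / 2) (half_pos hε)
    obtain ⟨N, hN⟩ := (hlim.eventually_lt_const (half_pos hε)).exists_forall_of_atTop
    rw [frequently_atTop]
    intro M
    have h1 : max M N ≤ Nat.pair m (max M N) := Nat.right_le_pair _ _
    refine ⟨Nat.pair m (max M N), (le_max_left _ _).trans h1, hεs ?_⟩
    have h2 := hN _ ((le_max_right _ _).trans h1)
    have h3 := hcx' (Nat.pair m (max M N))
    have h4 : (x (Nat.pair m (max M N)) : K₀) = TopologicalSpace.denseSeq K₀ m := by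
      simp [hx]
    rw [h4, ← Complex.dist_eq] at h3
    have h5 : dist ((TopologicalSpace.denseSeq K₀ m : K₀) : ℂ) p < ε / 2 := hm
    rw [Metric.mem_ball]
    exact (dist_triangle _ _ _).trans_lt (by linarith)

/-- The radii attached to a separated sequence. -/
def sepRadius (d : ℕ → ℝ) (k : ℕ) : ℝ := d k * (1 / 2) ^ (k + 4)

namespace IsSeparatedSequence

variable {K₀ : Set ℂ} {c : ℕ → ℂ} {d : ℕ → ℝ}

lemma le_one (h : IsSeparatedSequence K₀ c d) (k : ℕ) : d k ≤ 1 := by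
  linarith [h.norm_add_le k, norm_nonneg (c k)]

lemma radius_pos (h : IsSeparatedSequence K₀ c d) (k : ℕ) : 0 < sepRadius d k :=
  mul_pos (h.pos k) (by positivity)

/-- In the radius, the factor `2⁻⁴` keeps the disk well inside the disk of radius `d k / 4`, and
`2⁻ᵏ` provides summability and geometric decay of the singular parts away from their disks. -/
lemma radius_le (h : IsSeparatedSequence K₀ c d) (k : ℕ) : sepRadius d k ≤ d k / 16 := by
  have h1 : (1 / 2 : ℝ) ^ (k + 4) ≤ 1 / 16 := by
    rw [pow_add]
    have : (1 / 2 : ℝ) ^ k ≤ 1 := pow_le_one₀ (by norm_num) (by norm_num)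
    linarith
  have := mul_le_mul_of_nonneg_left h1 (h.pos k).le
  rw [sepRadius]
  linarith

lemma d_le (h : IsSeparatedSequence K₀ c d) (k : ℕ) : d k ≤ 1 / (k + 1) := by
  obtain ⟨x, hx, hxk⟩ := h.near k
  rw [norm_sub_rev] at hxk
  exact (h.le_norm_sub k x hx).trans hxk

lemma tendsto_d (h : IsSeparatedSequence K₀ c d) : Tendsto d atTop (𝓝 0) :=
  squeeze_zero (fun k => (h.pos k).le) h.d_le tendsto_one_div_add_atTop_nhds_zero_nat

lemma summable_radius (h : IsSeparatedSequence K₀ c d) : Summable (sepRadius d) := by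
  refine Summable.of_nonneg_of_le (fun k => (h.radius_pos k).le) (fun k => ?_)
    (summable_geometric_of_lt_one (by norm_num : (0 : ℝ) ≤ 1 / 2) (by norm_num))
  have h1 : (1 / 2 : ℝ) ^ (k + 4) ≤ (1 / 2) ^ k :=
    pow_le_pow_of_le_one (by norm_num) (by norm_num) (by omega)
  calc sepRadius d k ≤ 1 * (1 / 2) ^ (k + 4) :=
        mul_le_mul_of_nonneg_right (h.le_one k) (by positivity)
    _ ≤ _ := by rwa [one_mul]

/-- The distance of two centres is at least both `d j` and `d k`, hence at least their mean; so the
open disks of radii `d k / 2` are pairwise disjoint. -/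
lemma outside_other (h : IsSeparatedSequence K₀ c d) {j k : ℕ} (hjk : j ≠ k) {z : ℂ}
    (hz : ‖z - c k‖ ≤ d k / 2) : d j / 2 ≤ ‖z - c j‖ := by
  have h1 := h.le_norm_sub_center k j hjk.symm
  have h2 := h.le_norm_sub_center j k hjk
  rw [norm_sub_rev] at h2
  have h3 := norm_sub_le (z - c j) (z - c k)
  rw [sub_sub_sub_cancel_left] at h3
  linarith

lemma norm_lt_one (h : IsSeparatedSequence K₀ c d) {k : ℕ} {z : ℂ} (hz : ‖z - c k‖ < d k) :
    ‖z‖ < 1 := by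
  have := norm_sub_norm_le z (c k)
  linarith [h.norm_add_le k]

lemma notMem_of_norm_sub_lt (h : IsSeparatedSequence K₀ c d) {k : ℕ} {z : ℂ}
    (hz : ‖z - c k‖ < d k) : z ∉ K₀ := fun hK => by
  linarith [h.le_norm_sub k z hK]

lemma isDiskSequence (h : IsSeparatedSequence K₀ c d) :
    IsDiskSequence K₀ c (sepRadius d) where
  radius_pos := h.radius_pos
  subset k z hz := by
    rw [mem_ball_iff_norm] at hz
    have h1 : ‖z - c k‖ < d k := by linarith [h.radius_le k, h.pos k]
    exact ⟨mem_ball_zero_iff.2 (h.norm_lt_one h1), h.notMem_of_norm_sub_lt h1⟩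
  disjoint j k hjk := by
    refine Set.disjoint_left.2 fun z hj hk => ?_
    rw [mem_ball_iff_norm] at hj hk
    have h1 := h.outside_other hjk (z := z) (by linarith [h.radius_le k, h.pos k])
    linarith [h.radius_le j, h.pos j]
  accumulate := h.cluster
  summable := h.summable_radius

lemma mem_diskMinusDisks {r : ℕ → ℝ} {z : ℂ} :
    z ∈ diskMinusDisks c r ↔ ‖z‖ ≤ 1 ∧ ∀ k, r k ≤ ‖z - c k‖ := by
  simp [diskMinusDisks, Complex.dist_eq]

lemma isCompact_diskMinusDisks (c : ℕ → ℂ) (r : ℕ → ℝ) : IsCompact (diskMinusDisks c r) :=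
  (isCompact_closedBall 0 1).diff (isOpen_iUnion fun _ => Metric.isOpen_ball)

lemma mem_of_annulus (h : IsSeparatedSequence K₀ c d) {k : ℕ} {z : ℂ}
    (h1 : sepRadius d k ≤ ‖z - c k‖) (h2 : ‖z - c k‖ ≤ d k / 2) :
    z ∈ diskMinusDisks c (sepRadius d) := by
  have hk := h.pos k
  refine mem_diskMinusDisks.2 ⟨(h.norm_lt_one (k := k) (by linarith)).le, fun j => ?_⟩
  by_cases hjk : j = k
  · rw [hjk]; exact h1
  · have := h.outside_other hjk h2
    linarith [h.radius_le j, h.pos j]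

lemma mem_interior_of_annulus (h : IsSeparatedSequence K₀ c d) {k : ℕ} {z : ℂ}
    (h1 : sepRadius d k < ‖z - c k‖) (h2 : ‖z - c k‖ < d k / 2) :
    z ∈ interior (diskMinusDisks c (sepRadius d)) := by
  refine mem_interior.2 ⟨{z | sepRadius d k < ‖z - c k‖} ∩ {z | ‖z - c k‖ < d k / 2},
    fun w hw => h.mem_of_annulus (le_of_lt hw.1) (le_of_lt hw.2), ?_, h1, h2⟩
  exact (isOpen_lt continuous_const (by fun_prop)).inter (isOpen_lt (by fun_prop) continuous_const)

/-- The removed disks are locally finite off `K₀`: those of large index are close to `K₀`, so only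
finitely many conditions matter near `z`. -/
lemma eventually_outside (h : IsSeparatedSequence K₀ c d) (hK : IsCompact K₀) {z : ℂ}
    (hz : z ∉ K₀) (hzk : ∀ k, sepRadius d k < ‖z - c k‖) :
    ∀ᶠ y in 𝓝 z, ∀ k, sepRadius d k < ‖y - c k‖ := by
  obtain ⟨e, he, hek⟩ := Metric.isOpen_iff.1 hK.isClosed.isOpen_compl z hz
  have heK : ∀ x ∈ K₀, e ≤ ‖x - z‖ := fun x hx => by
    by_contra! h
    exact hek (by rwa [Metric.mem_ball, Complex.dist_eq]) hx
  obtain ⟨N, hN⟩ := (tendsto_one_div_add_atTop_nhds_zero_nat.eventually_lt_const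
    (show 0 < e / 4 by positivity)).exists_forall_of_atTop
  have h1 : ∀ᶠ y in 𝓝 z, ∀ k ∈ Finset.range N, sepRadius d k < ‖y - c k‖ :=
    (Finset.range N).eventually_all.2 fun k _ =>
      (isOpen_lt continuous_const (by fun_prop : Continuous fun y => ‖y - c k‖)).mem_nhds (hzk k)
  filter_upwards [h1, Metric.ball_mem_nhds z (show 0 < e / 4 by positivity)] with y hy1 hy2 k
  by_cases hk : k < N
  · exact hy1 k (Finset.mem_range.2 hk)
  · have h2 := hN k (not_lt.1 hk)
    obtain ⟨x, hx, hxk⟩ := h.near k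
    rw [mem_ball_iff_norm] at hy2
    have h3 := heK x hx
    have h4 : ‖x - z‖ ≤ ‖y - z‖ + ‖y - c k‖ + ‖c k - x‖ := by
      have e : x - z = (y - z) - (y - c k) - (c k - x) := by ring
      rw [e]
      exact (norm_sub_le _ _).trans (add_le_add_left (norm_sub_le _ _) _)
    have h5 := h.d_le k
    have h6 := h.radius_le k
    have h7 := h.pos k
    linarith

lemma mem_interior (h : IsSeparatedSequence K₀ c d) (hK : IsCompact K₀) {z : ℂ} (hz1 : ‖z‖ < 1)
    (hz : z ∉ K₀) (hzk : ∀ k, sepRadius d k < ‖z - c k‖) :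
    z ∈ interior (diskMinusDisks c (sepRadius d)) := by
  rw [mem_interior_iff_mem_nhds]
  filter_upwards [h.eventually_outside hK hz hzk, Metric.isOpen_ball.mem_nhds
    (mem_ball_zero_iff.2 hz1)] with y hy hy1
  exact mem_diskMinusDisks.2 ⟨(mem_ball_zero_iff.1 hy1).le, fun k => (hy k).le⟩

lemma center_notMem (h : IsSeparatedSequence K₀ c d) (k : ℕ) :
    c k ∉ diskMinusDisks c (sepRadius d) := fun hk => by
  have := (mem_diskMinusDisks.1 hk).2 k
  rw [sub_self, norm_zero] at this
  linarith [h.radius_pos k]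

/-- Each neighbourhood of a point of `K₀` contains a centre of a removed disk. This is why
holomorphy off `K₀` suffices for membership in `A(K)`. -/
lemma disjoint_interior (h : IsSeparatedSequence K₀ c d) {z : ℂ}
    (hz : z ∈ interior (diskMinusDisks c (sepRadius d))) : z ∉ K₀ := fun hK => by
  have h1 := mapClusterPt_iff_frequently.1 ((h.cluster z).2 hK) _
    (mem_interior_iff_mem_nhds.1 hz)
  obtain ⟨k, hk⟩ := h1.exists
  exact h.center_notMem k hk

end IsSeparatedSequence

/-! ### Closed subspaces of `C(K)` -/

open Classical in
/-- The extension by zero of a function on `K`. -/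
def extendZero {K : Set ℂ} (f : C(K, ℂ)) (z : ℂ) : ℂ := if h : z ∈ K then f ⟨z, h⟩ else 0

lemma extendZero_apply {K : Set ℂ} (f : C(K, ℂ)) {z : ℂ} (h : z ∈ K) :
    extendZero f z = f ⟨z, h⟩ := dif_pos h

lemma mem_analyticAlgebra {K : Set ℂ} {f : C(K, ℂ)} :
    f ∈ analyticAlgebra K ↔ DifferentiableOn ℂ (extendZero f) (interior K) := by
  constructor
  · rintro ⟨F, hF, hFa⟩
    refine hFa.differentiableOn.congr fun z hz => ?_
    rw [extendZero_apply f (interior_subset hz), ← hF]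
  · intro h
    exact ⟨extendZero f, fun z => extendZero_apply f z.2, h.analyticOnNhd isOpen_interior⟩

lemma mem_closure_of_forall_norm_le {K : Set ℂ} [CompactSpace K] {S : Set C(K, ℂ)} {f : C(K, ℂ)}
    (h : ∀ ε > 0, ∃ g ∈ S, ∀ z, ‖f z - g z‖ ≤ ε) : f ∈ closure S := by
  rw [Metric.mem_closure_iff]
  intro ε hε
  obtain ⟨g, hg, hfg⟩ := h (ε / 2) (half_pos hε)
  refine ⟨g, hg, ?_⟩
  rw [dist_eq_norm]
  exact ((ContinuousMap.norm_le _ (half_pos hε).le).2 hfg).trans_lt (half_lt_self hε)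

lemma isClosed_analyticAlgebra (K : Set ℂ) [CompactSpace K] :
    IsClosed (analyticAlgebra K : Set C(K, ℂ)) := by
  refine IsSeqClosed.isClosed fun f g hf hfg => ?_
  refine mem_analyticAlgebra.2 ?_
  have h1 : TendstoUniformlyOn (fun n => extendZero (f n)) (extendZero g) atTop (interior K) := by
    rw [Metric.tendstoUniformlyOn_iff]
    intro ε hε
    filter_upwards [Metric.tendsto_nhds.1 hfg ε hε] with n hn z hz
    rw [extendZero_apply _ (interior_subset hz), extendZero_apply _ (interior_subset hz), dist_comm]
    exact (ContinuousMap.dist_apply_le_dist _).trans_lt hn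
  exact h1.tendstoLocallyUniformlyOn.differentiableOn
    (Eventually.of_forall fun n => mem_analyticAlgebra.1 (hf n)) isOpen_interior

lemma polyClosure_le_ratClosure (K : Set ℂ) : polyClosure K ≤ ratClosure K := by
  refine Submodule.topologicalClosure_mono ?_
  rintro f ⟨p, -, rfl⟩
  exact ⟨p, 1, fun z _ => by simp, fun z => by simp⟩

lemma ratClosure_le_HP {K : Set ℂ} (φ : C(K, ℂ)) : ratClosure K ≤ HP φ :=
  le_sup_right.trans (Submodule.le_topologicalClosure _)

lemma mul_mem_HP {K : Set ℂ} (φ : C(K, ℂ)) {f : C(K, ℂ)} (hf : f ∈ polynomialFunctions K) :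
    f * φ ∈ HP φ := by
  refine Submodule.le_topologicalClosure _ (Submodule.mem_sup_left ?_)
  exact ⟨f, Submodule.le_topologicalClosure _ hf, rfl⟩

lemma isClosed_HP {K : Set ℂ} (φ : C(K, ℂ)) : IsClosed (HP φ : Set C(K, ℂ)) :=
  Submodule.isClosed_topologicalClosure _

lemma isClosed_ratClosure (K : Set ℂ) : IsClosed (ratClosure K : Set C(K, ℂ)) :=
  Submodule.isClosed_topologicalClosure _

lemma polyClosure_le_analyticAlgebra (K : Set ℂ) [CompactSpace K] :
    polyClosure K ≤ Subalgebra.toSubmodule (analyticAlgebra K) := by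
  refine Submodule.topologicalClosure_minimal _ ?_ (isClosed_analyticAlgebra K)
  rintro f ⟨p, -, rfl⟩
  exact ⟨fun z => p.eval z, fun z => by simp, fun z _ => p.differentiable.analyticAt z⟩

lemma ratClosure_le_analyticAlgebra (K : Set ℂ) [CompactSpace K] :
    ratClosure K ≤ Subalgebra.toSubmodule (analyticAlgebra K) := by
  refine Submodule.topologicalClosure_minimal _ ?_ (isClosed_analyticAlgebra K)
  rintro f ⟨p, q, hq, hf⟩
  refine ⟨fun z => p.eval z / q.eval z, fun z => (hf z).symm, fun z hz => ?_⟩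
  exact (p.differentiable.analyticAt z).div (q.differentiable.analyticAt z)
    (hq z (interior_subset hz))

lemma HP_le_analyticAlgebra {K : Set ℂ} [CompactSpace K] {φ : C(K, ℂ)}
    (hφ : φ ∈ analyticAlgebra K) : HP φ ≤ Subalgebra.toSubmodule (analyticAlgebra K) := by
  refine Submodule.topologicalClosure_minimal _ (sup_le ?_ (ratClosure_le_analyticAlgebra K))
    (isClosed_analyticAlgebra K)
  rintro _ ⟨f, hf, rfl⟩
  exact (analyticAlgebra K).mul_mem (polyClosure_le_analyticAlgebra K hf) hφ

/-- A function continuous on the closed unit disk and holomorphic inside restricts to an element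
of `P(K)`. -/
lemma mem_polyClosure {K : Set ℂ} [CompactSpace K] (hK : K ⊆ Metric.closedBall 0 1) {f : C(K, ℂ)}
    {g : ℂ → ℂ} (hc : ContinuousOn g (Metric.closedBall 0 1))
    (hd : DifferentiableOn ℂ g (Metric.ball 0 1)) (hfg : ∀ z : K, f z = g z) :
    f ∈ polyClosure K := by
  refine mem_closure_of_forall_norm_le fun ε hε => ?_
  obtain ⟨p, hp⟩ := exists_polynomial_near one_pos hc hd hε
  exact ⟨p.toContinuousMapOn K, mem_polynomialFunctions_of_eval p fun z => rfl, fun z => by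
    rw [hfg]; exact hp z (hK z.2)⟩

/-- The function `1 / (z - s)` on `K`, for `s ∉ K`. -/
def invSub {K : Set ℂ} {s : ℂ} (hs : s ∉ K) : C(K, ℂ) where
  toFun z := ((z : ℂ) - s)⁻¹
  continuous_toFun := (continuous_subtype_val.sub continuous_const).inv₀ fun z h =>
    hs (by rw [← show (z : ℂ) = s from sub_eq_zero.1 h]; exact z.2)

lemma invSub_apply {K : Set ℂ} {s : ℂ} (hs : s ∉ K) (z : K) : invSub hs z = ((z : ℂ) - s)⁻¹ := rfl

lemma sub_ne_zero_of_notMem {K : Set ℂ} {s : ℂ} (hs : s ∉ K) (z : K) : (z : ℂ) - s ≠ 0 := fun h =>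
  hs (by rw [← show (z : ℂ) = s from sub_eq_zero.1 h]; exact z.2)

lemma invSub_mem_ratFunctions {K : Set ℂ} {s : ℂ} (hs : s ∉ K) : invSub hs ∈ ratFunctions K :=
  ⟨1, X - C s, fun z hz => by simpa using sub_ne_zero_of_notMem hs ⟨z, hz⟩, fun z => by
    simp [invSub_apply]⟩

/-- A function holomorphic outside a disk that misses `K`, and vanishing at infinity, restricts to
an element of `R(K)`. -/
lemma mem_ratClosure {K : Set ℂ} [CompactSpace K] {f : C(K, ℂ)} {h : ℂ → ℂ} {c : ℂ} {r M : ℝ}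
    (hr : 0 < r) (hK : ∀ z ∈ K, r ≤ ‖z - c‖)
    (hc : ContinuousOn h {z | r ≤ ‖z - c‖}) (hd : DifferentiableOn ℂ h {z | r < ‖z - c‖})
    (hM : ∀ z, r < ‖z - c‖ → ‖h z‖ ≤ M * r / (‖z - c‖ - r)) (hfh : ∀ z : K, f z = h z) :
    f ∈ ratClosure K := by
  have hcK : c ∉ K := fun hcK => by
    have := hK c hcK
    rw [sub_self, norm_zero] at this
    linarith
  refine mem_closure_of_forall_norm_le fun ε hε => ?_
  obtain ⟨p, hp⟩ := exists_polynomial_inv_near hr hc hd hM hε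
  refine ⟨aeval (invSub hcK) p, ?_, fun z => ?_⟩
  · have h1 : aeval (invSub hcK) p ∈ Algebra.adjoin ℂ {invSub hcK} :=
      aeval_mem_adjoin_singleton ℂ (invSub hcK)
    refine (Algebra.adjoin_le ?_ : Algebra.adjoin ℂ {invSub hcK} ≤ ratFunctions K) h1
    rintro _ rfl
    exact invSub_mem_ratFunctions hcK
  · rw [aeval_continuousMap_apply, invSub_apply, hfh, ← one_div]
    exact hp z (hK z z.2)

/-! ### Cauchy transforms in `HP` -/

lemma cauchyTransform_restrict {K₀ : Set ℂ} (hK : MeasurableSet K₀) (z : ℂ) :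
    cauchyTransform (volume.restrict K₀) z = areaCauchy (K₀.indicator fun _ => 1) z := by
  rw [cauchyTransform, areaCauchy, ← integral_indicator hK]
  congr 1
  ext w
  by_cases hw : w ∈ K₀ <;> simp [hw]

lemma exists_bounds_indicator {K₀ : Set ℂ} (hK₀ : IsCompact K₀) {h : ℂ → ℂ} (hh : Continuous h) :
    AEStronglyMeasurable (K₀.indicator h) volume ∧
      ∃ B ρ, (∀ w, ‖K₀.indicator h w‖ ≤ B) ∧ ∀ w, K₀.indicator h w ≠ 0 → ‖w‖ ≤ ρ := by
  obtain ⟨R, hR⟩ := hK₀.isBounded.exists_norm_le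
  obtain ⟨B, hB⟩ := hK₀.exists_bound_of_continuousOn hh.continuousOn
  refine ⟨hh.aestronglyMeasurable.indicator hK₀.measurableSet, max B 0, R, fun w => ?_,
    fun w hw => hR w (Set.indicator_apply_ne_zero.1 hw).1⟩
  by_cases hw : w ∈ K₀
  · rw [Set.indicator_of_mem hw]; exact (hB w hw).trans (le_max_left _ _)
  · rw [Set.indicator_of_notMem hw, norm_zero]; exact le_max_right _ _

lemma integrable_indicator_kernel {K₀ : Set ℂ} (hK₀ : IsCompact K₀) {h : ℂ → ℂ} (hh : Continuous h) (z : ℂ) :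
    Integrable fun w => K₀.indicator h w / (w - z) := by
  obtain ⟨hm, B, ρ, hB, hρ⟩ := exists_bounds_indicator hK₀ hh
  exact integrable_kernel' hm hB hρ z

lemma integrable_indicator_continuous {K₀ : Set ℂ} (hK₀ : IsCompact K₀) {h : ℂ → ℂ} (hh : Continuous h) :
    Integrable (K₀.indicator h) := by
  obtain ⟨hm, B, ρ, hB, hρ⟩ := exists_bounds_indicator hK₀ hh
  exact integrable_of_bounded_support hm hB hρ

lemma continuous_areaCauchy_indicator {K₀ : Set ℂ} (hK₀ : IsCompact K₀) {h : ℂ → ℂ} (hh : Continuous h) :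
    Continuous (areaCauchy (K₀.indicator h)) := by
  obtain ⟨hm, B, ρ, hB, hρ⟩ := exists_bounds_indicator hK₀ hh
  exact continuous_areaCauchy hm hB hρ

lemma differentiableOn_areaCauchy_indicator {K₀ : Set ℂ} (hK₀ : IsCompact K₀) {h : ℂ → ℂ} (hh : Continuous h) :
    DifferentiableOn ℂ (areaCauchy (K₀.indicator h)) K₀ᶜ := by
  obtain ⟨hm, B, ρ, hB, hρ⟩ := exists_bounds_indicator hK₀ hh
  exact differentiableOn_areaCauchy hm hB hρ hK₀.isClosed.isOpen_compl fun w hw =>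
    Set.indicator_of_notMem hw _

/-- The identity `w / (w - z) = 1 + z / (w - z)`, valid for `w ≠ z`, is integrated. -/
lemma areaCauchy_mul_id {K₀ : Set ℂ} (hK₀ : IsCompact K₀) {h : ℂ → ℂ} (hh : Continuous h) (z : ℂ) :
    areaCauchy (K₀.indicator fun w => w * h w) z =
      z * areaCauchy (K₀.indicator h) z + ∫ w, K₀.indicator h w := by
  rw [areaCauchy, areaCauchy, ← integral_const_mul, ← integral_add
    ((integrable_indicator_kernel hK₀ hh z).const_mul z) (integrable_indicator_continuous hK₀ hh)]
  have h0 : ∀ᵐ w : ℂ, w ≠ z := by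
    simp [ae_iff, Set.ofPred_eq_eq_singleton]
  refine integral_congr_ae (h0.mono fun w hw => ?_)
  have hw' : w - z ≠ 0 := sub_ne_zero.2 hw
  by_cases hwK : w ∈ K₀
  · simp only [Set.indicator_of_mem hwK]
    field_simp
    ring
  · simp only [Set.indicator_of_notMem hwK]
    simp

/-- Iterating `areaCauchy_mul_id` extracts one power of `z` at a time, each at the cost of a
constant. This places the transforms of polynomial densities in `P(K) φ + R(K)`. -/
lemma areaCauchy_polynomial {K₀ : Set ℂ} (hK₀ : IsCompact K₀) (p : ℂ[X]) : ∃ q : ℂ[X], ∀ z,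
    areaCauchy (K₀.indicator fun w => p.eval w) z =
      p.eval z * areaCauchy (K₀.indicator fun _ => 1) z + q.eval z := by
  induction p using Polynomial.induction_on' with
  | add p p' hp hp' =>
    obtain ⟨q, hq⟩ := hp
    obtain ⟨q', hq'⟩ := hp'
    refine ⟨q + q', fun z => ?_⟩
    have e : (K₀.indicator fun w => (p + p').eval w) = fun w =>
        K₀.indicator (fun w => p.eval w) w + K₀.indicator (fun w => p'.eval w) w := by
      ext w
      by_cases hw : w ∈ K₀ <;> simp [hw]
    rw [e, areaCauchy_add (integrable_indicator_kernel hK₀ p.continuous z)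
      (integrable_indicator_kernel hK₀ p'.continuous z), hq, hq', eval_add, eval_add]
    ring
  | monomial n s =>
    induction n with
    | zero =>
      refine ⟨0, fun z => ?_⟩
      simp only [monomial_zero_left, eval_C, eval_zero, add_zero]
      rw [areaCauchy, areaCauchy, ← integral_const_mul]
      congr 1
      ext w
      by_cases hw : w ∈ K₀ <;> simp [hw, div_eq_mul_inv]
    | succ n ih =>
      obtain ⟨q, hq⟩ := ih
      refine ⟨X * q + C (∫ w, K₀.indicator (fun w => (monomial n s).eval w) w), fun z => ?_⟩
      have e : (fun w => (monomial (n + 1) s).eval w) =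
          fun w => w * (monomial n s).eval w := by
        ext w
        simp only [eval_monomial]
        ring
      rw [e, areaCauchy_mul_id hK₀ (Polynomial.continuous _), hq]
      simp only [eval_monomial, eval_add, eval_mul, eval_X, eval_C]
      ring

/-- Cauchy transforms of continuous densities on `K₀` belong to `HP(φ, K)`. -/
lemma areaCauchy_mem_HP {K₀ : Set ℂ} (hK₀ : IsCompact K₀) {K : Set ℂ} [CompactSpace K] (hK : K ⊆ Metric.closedBall 0 1)
    (hK₀1 : ∀ w ∈ K₀, ‖w‖ < 1)
    (hdense : (closure (polynomialFunctions K₀ : Set C(K₀, ℂ))) = Set.univ) {φ : C(K, ℂ)}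
    (hφ : ∀ z : K, φ z = areaCauchy (K₀.indicator fun _ => 1) z) {h : ℂ → ℂ} (hh : Continuous h)
    {f : C(K, ℂ)} (hf : ∀ z : K, f z = areaCauchy (K₀.indicator h) z) : f ∈ HP φ := by
  have hcs : CompactSpace K₀ := isCompact_iff_compactSpace.1 hK₀
  have hpi := Real.pi_pos
  rw [← SetLike.mem_coe, ← (isClosed_HP φ).closure_eq]
  refine mem_closure_of_forall_norm_le fun ε hε => ?_
  set h₀ : C(K₀, ℂ) := ⟨fun w => h w, hh.comp continuous_subtype_val⟩ with hh₀
  have hmem : h₀ ∈ closure (polynomialFunctions K₀ : Set C(K₀, ℂ)) := by rw [hdense]; trivial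
  -- For `z ∈ K` the set `K₀` lies in the disk of radius `2` about `z`, so a density of size `B` has
  -- a transform of size at most `B · 2π · 2`.
  obtain ⟨_, ⟨p, -, rfl⟩, hp⟩ := Metric.mem_closure_iff.1 hmem (ε / (2 * Real.pi * 2))
    (by positivity)
  have hpw : ∀ w ∈ K₀, ‖h w - p.eval w‖ ≤ ε / (2 * Real.pi * 2) := fun w hw => by
    have := (ContinuousMap.dist_apply_le_dist (⟨w, hw⟩ : K₀)).trans hp.le
    rw [dist_eq_norm] at this
    simpa [hh₀] using this
  obtain ⟨q, hq⟩ := areaCauchy_polynomial hK₀ p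
  refine ⟨p.toContinuousMapOn K * φ + q.toContinuousMapOn K, (HP φ).add_mem
    (mul_mem_HP φ (mem_polynomialFunctions_of_eval p fun z => rfl))
    (ratClosure_le_HP φ (polyClosure_le_ratClosure K (Submodule.le_topologicalClosure _
      (mem_polynomialFunctions_of_eval q fun z => rfl)))), fun z => ?_⟩
  have e1 : (p.toContinuousMapOn K * φ + q.toContinuousMapOn K) z =
      areaCauchy (K₀.indicator fun w => p.eval w) z := by
    rw [hq, ← hφ]; rfl
  rw [hf, e1, ← areaCauchy_sub (integrable_indicator_kernel hK₀ hh z)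
    (integrable_indicator_kernel hK₀ p.continuous z)]
  refine (norm_areaCauchy_le (R := 2) (by norm_num) (B := ε / (2 * Real.pi * 2)) (fun w => ?_) z
    fun w hw => ?_).trans (le_of_eq (by field_simp))
  · by_cases hw : w ∈ K₀
    · simpa only [Set.indicator_of_mem hw] using hpw w hw
    · simp only [Set.indicator_of_notMem hw, sub_zero, norm_zero]
      positivity
  · have hwK : w ∈ K₀ := by
      by_contra hwK
      exact hw (by simp only [Set.indicator_of_notMem hwK, sub_zero])
    rw [mem_ball_iff_norm]
    have h1 := hK₀1 w hwK
    have h2 : ‖(z : ℂ)‖ ≤ 1 := by simpa using hK z.2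
    linarith [norm_sub_le w (z : ℂ)]

/-! ### Integrals of rational functions over circles -/

lemma exists_partial_fractions (p : ℂ[X]) {q : ℂ[X]} (hq : q ≠ 0) :
    ∃ (u : ℂ[X]) (A : ℂ → ℕ → ℂ), ∀ z, q.eval z ≠ 0 → p.eval z / q.eval z =
      u.eval z + ∑ s ∈ q.roots.toFinset, ∑ j ∈ Finset.range (q.rootMultiplicity s),
        A s j * (z - s) ^ (-((j : ℤ) + 1)) := by
  classical
  obtain ⟨u, r, hr, hp⟩ := eq_quo_mul_prod_pow_add_sum_rem_mul_prod_pow (s := q.roots.toFinset)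
    p (g := fun s => X - C s) (fun s _ => monic_X_sub_C s)
    (fun s _ t _ hst => pairwise_coprime_X_sub_C Function.injective_id hst)
    (fun s => q.rootMultiplicity s)
  have hr0 : ∀ s ∈ q.roots.toFinset, ∀ j, r s j = C ((r s j).coeff 0) := fun s hs j =>
    eq_C_of_degree_le_zero (Nat.WithBot.lt_one_iff_le_zero.1 (by simpa using hr s hs j))
  have hqe : ∀ z, q.eval z = q.leadingCoeff *
      ∏ s ∈ q.roots.toFinset, (z - s) ^ q.rootMultiplicity s := fun z => by
    conv_lhs => rw [(IsAlgClosed.splits q).eq_prod_roots, prod_multiset_root_eq_finset_root]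
    simp [eval_prod]
  -- The decomposition used expands in `(z - s)^j` over the full power `(z - s)^m`; reversing `j`
  -- indexes the terms by the order of the pole, `j + 1`.
  refine ⟨C q.leadingCoeff⁻¹ * u, fun s j => q.leadingCoeff⁻¹ * if h : j < q.rootMultiplicity s then
    (r s (Fin.rev ⟨j, h⟩)).coeff 0 else 0, fun z hz => ?_⟩
  have hl : q.leadingCoeff ≠ 0 := leadingCoeff_ne_zero.2 hq
  have hs : ∀ s ∈ q.roots.toFinset, z - s ≠ 0 := fun s hs h0 => hz (by
    rw [show z = s from sub_eq_zero.1 h0]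
    simpa [hq] using hs)
  rw [div_eq_iff hz, hqe, congrArg (eval z) hp]
  simp only [eval_add, eval_mul, eval_finsetSum, eval_prod, eval_pow, eval_sub, eval_X, eval_C]
  rw [add_mul]
  congr 1
  · field_simp
  rw [Finset.sum_mul]
  refine Finset.sum_congr rfl fun s hs' => ?_
  rw [← Equiv.sum_comp Fin.revPerm, Finset.sum_range, Finset.sum_mul]
  refine Finset.sum_congr rfl fun j _ => ?_
  rw [← Finset.mul_prod_erase _ _ hs', dif_pos j.2, Fin.revPerm_apply, Fin.eta, hr0 s hs', eval_C,
    coeff_C_zero]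
  have e : (z - s) ^ (Fin.rev j : ℕ) =
      (z - s) ^ (-((j : ℤ) + 1)) * (z - s) ^ q.rootMultiplicity s := by
    rw [← zpow_natCast, ← zpow_natCast, ← zpow_add₀ (hs s hs'), Fin.val_rev]
    congr 1
    have := j.2
    omega
  rw [e]
  field_simp

/-- In a partial fraction expansion only the simple poles contribute to a contour integral. The
point is that the same coefficients serve all circles, so integrals over different circles can be
compared root by root. -/
lemma exists_circleIntegral_residues (p : ℂ[X]) {q : ℂ[X]} (hq : q ≠ 0) :
    ∃ A : ℂ → ℂ, ∀ c R, 0 < R → (∀ z ∈ Metric.sphere c R, q.eval z ≠ 0) →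
      (∮ z in C(c, R), p.eval z / q.eval z) =
        ∑ s ∈ q.roots.toFinset, A s * ∮ z in C(c, R), (s - z)⁻¹ := by
  obtain ⟨u, A, hA⟩ := exists_partial_fractions p hq
  -- The sign appears because the coefficient multiplies `(s - z)⁻¹` and not `(z - s)⁻¹`.
  refine ⟨fun s => -A s 0, fun c R hR hz => ?_⟩
  have hs : ∀ s ∈ q.roots.toFinset, s ∉ Metric.sphere c R := fun s hs hsc =>
    hz s hsc (by simpa [hq] using hs)
  have hi : ∀ s ∈ q.roots.toFinset, ∀ j : ℕ,
      CircleIntegrable (fun z => A s j * (z - s) ^ (-((j : ℤ) + 1))) c R := fun s hs' j =>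
    ((circleIntegrable_sub_zpow_iff).2 (.inr (.inr (by
      rw [abs_of_pos hR]; exact hs s hs')))).const_smul
  rw [circleIntegral.integral_congr hR.le fun z hz' => hA z (hz z hz'),
    circleIntegral.integral_add (u.continuous.continuousOn.circleIntegrable hR.le)
      (CircleIntegrable.fun_sum _ fun s hs' => CircleIntegrable.fun_sum _ fun j _ => hi s hs' j),
    Complex.circleIntegral_eq_zero_of_differentiable_on_off_countable hR.le Set.countable_empty
      u.continuous.continuousOn fun z _ => u.differentiable.differentiableAt, zero_add,
    circleIntegral.integral_fun_sum fun s hs' => CircleIntegrable.fun_sum _ fun j _ => hi s hs' j]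
  refine Finset.sum_congr rfl fun s hs' => ?_
  rw [circleIntegral.integral_fun_sum fun j _ => hi s hs' j]
  have hm : 0 < q.rootMultiplicity s := (rootMultiplicity_pos hq).2 (by simpa [hq] using hs')
  rw [Finset.sum_eq_single 0, circleIntegral.integral_const_mul, neg_mul, ← mul_neg]
  · congr 1
    rw [← neg_one_mul (∮ z in C(c, R), (s - z)⁻¹), ← circleIntegral.integral_const_mul]
    congr 1
    ext z
    rw [← neg_sub s z, Nat.cast_zero, zero_add, zpow_neg_one, inv_neg, neg_one_mul]
  · intro j _ hj
    rw [circleIntegral.integral_const_mul, circleIntegral.integral_sub_zpow_of_ne (by omega),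
      mul_zero]
  · exact fun h0 => absurd (Finset.mem_range.2 hm) h0

/-- The Cauchy transform of the area of a compact set integrates to a multiple of that area. -/
lemma circleIntegral_areaCauchy_indicator {K₀ : Set ℂ} (hK₀ : IsCompact K₀) {ρ R : ℝ} (hρ : ρ < R)
    (hb : ∀ w ∈ K₀, ‖w‖ ≤ ρ) :
    (∮ z in C(0, R), areaCauchy (K₀.indicator fun _ => 1) z) =
      -(2 * Real.pi * Complex.I) * volume.real K₀ := by
  rcases K₀.eq_empty_or_nonempty with rfl | ⟨w₀, hw₀⟩
  · simp [areaCauchy, circleIntegral]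
  have hR0 : 0 < R := ((norm_nonneg _).trans (hb w₀ hw₀)).trans_lt hρ
  have hcm : Continuous (circleMap 0 R) := continuous_circleMap 0 R
  have hfin : IsFiniteMeasure (volume.restrict K₀) := ⟨by simpa using hK₀.measure_lt_top⟩
  have e : ∀ z, areaCauchy (K₀.indicator fun _ => 1) z = ∫ w in K₀, (w - z)⁻¹ := fun z => by
    rw [← cauchyTransform_restrict hK₀.measurableSet, cauchyTransform]
    simp only [one_div]
  simp only [e, circleIntegral_eq_integral_restrict]
  simp only [← integral_const_mul]
  -- By Fubini the contour integral is taken first; it equals `-2πi` for every `w ∈ K₀`, since all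
  -- of `K₀` is inside the circle.
  rw [integral_integral_swap]
  · have e2 : ∀ w ∈ K₀, (∫ θ in Set.Ioc 0 (2 * Real.pi),
        circleMap 0 R θ * Complex.I * (w - circleMap 0 R θ)⁻¹) = -(2 * Real.pi * Complex.I) := by
      intro w hw
      rw [← circleIntegral_eq_integral_restrict (fun z => (w - z)⁻¹),
        circleIntegral_inv_sub_of_mem (mem_ball_zero_iff.2 ((hb w hw).trans_lt hρ))]
    rw [setIntegral_congr_fun hK₀.measurableSet e2, setIntegral_const, Complex.real_smul, mul_comm]
  · refine Integrable.of_bound (C := R * (R - ρ)⁻¹) ?_ ?_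
    · refine Measurable.aestronglyMeasurable ?_
      have h2 : Measurable fun p : ℝ × ℂ => circleMap 0 R p.1 * Complex.I :=
        (by fun_prop : Continuous fun p : ℝ × ℂ => circleMap 0 R p.1 * Complex.I).measurable
      exact h2.mul (by fun_prop : Continuous fun p : ℝ × ℂ => p.2 - circleMap 0 R p.1).measurable.inv
    · have h3 : ∀ᵐ p : ℝ × ℂ ∂((volume.restrict (Set.Ioc 0 (2 * Real.pi))).prod
          (volume.restrict K₀)), p.2 ∈ K₀ :=
        Measure.quasiMeasurePreserving_snd.ae (ae_restrict_mem hK₀.measurableSet)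
      refine h3.mono fun p hp => ?_
      have h4 : R - ρ ≤ ‖p.2 - circleMap 0 R p.1‖ := by
        have h5 := norm_sub_norm_le (circleMap 0 R p.1) p.2
        rw [norm_circleMap_zero, abs_of_pos hR0, norm_sub_rev] at h5
        linarith [hb _ hp]
      simp only [Function.uncurry, norm_mul, norm_inv, norm_circleMap_zero, abs_of_pos hR0,
        Complex.norm_I, mul_one]
      gcongr

/-! ### Cauchy's theorem on the disk minus disks, and a function of `A(K)` outside `R(K)` -/

namespace IsSeparatedSequence

variable {K₀ : Set ℂ} {c : ℕ → ℂ} {d : ℕ → ℝ}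

lemma sphere_subset (h : IsSeparatedSequence K₀ c d) (k : ℕ) :
    Metric.sphere (c k) (sepRadius d k) ⊆ diskMinusDisks c (sepRadius d) := fun z hz => by
  rw [mem_sphere_iff_norm] at hz
  exact h.mem_of_annulus hz.ge (by linarith [h.radius_le k, h.pos k])

lemma unit_sphere_subset (h : IsSeparatedSequence K₀ c d) :
    Metric.sphere 0 1 ⊆ diskMinusDisks c (sepRadius d) := fun z hz => by
  rw [mem_sphere_zero_iff_norm] at hz
  refine mem_diskMinusDisks.2 ⟨hz.le, fun k => ?_⟩
  have h1 := norm_sub_norm_le z (c k)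
  linarith [h.norm_add_le k, h.radius_le k, h.pos k]

lemma exists_mem_ball {s : ℂ} (hs : s ∉ diskMinusDisks c (sepRadius d)) (hs1 : ‖s‖ ≤ 1) :
    ∃ k, s ∈ Metric.ball (c k) (sepRadius d k) := by
  by_contra! hk
  exact hs (mem_diskMinusDisks.2 ⟨hs1, fun k => by simpa [Complex.dist_eq] using hk k⟩)

/-- The Cauchy theorem on the disk minus disks for rational functions with poles off it. -/
lemma circleIntegral_rational (h : IsSeparatedSequence K₀ c d) (p q : ℂ[X])
    (hq : ∀ z ∈ diskMinusDisks c (sepRadius d), q.eval z ≠ 0) :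
    ∃ N, (∮ z in C(0, 1), p.eval z / q.eval z) =
      ∑ k ∈ Finset.range N, ∮ z in C(c k, sepRadius d k), p.eval z / q.eval z := by
  classical
  have hq0 : q ≠ 0 := by
    rintro rfl
    exact hq 1 (h.unit_sphere_subset (by simp)) (by simp)
  obtain ⟨A, hA⟩ := exists_circleIntegral_residues p hq0
  have hroot : ∀ s ∈ q.roots.toFinset, s ∉ diskMinusDisks c (sepRadius d) := fun s hs hsK =>
    hq s hsK (by simpa [hq0] using hs)
  have hex : ∀ s, ∃ m, s ∈ q.roots.toFinset → ‖s‖ ≤ 1 →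
      s ∈ Metric.ball (c m) (sepRadius d m) := fun s => by
    by_cases hs : s ∈ q.roots.toFinset ∧ ‖s‖ ≤ 1
    · obtain ⟨m, hm⟩ := exists_mem_ball (hroot s hs.1) hs.2
      exact ⟨m, fun _ _ => hm⟩
    · exact ⟨0, fun h1 h2 => absurd ⟨h1, h2⟩ hs⟩
  choose m hm using hex
  -- A root in the closed unit disk lies in exactly one removed disk, of index `m s`, so it
  -- contributes equally to both sides; a root outside contributes to neither. The range must reach
  -- the largest of these indices.
  refine ⟨q.roots.toFinset.sup m + 1, ?_⟩
  rw [hA 0 1 one_pos fun z hz => hq z (h.unit_sphere_subset hz), Finset.sum_congr rfl fun k _ =>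
    hA (c k) _ (h.radius_pos k) fun z hz => hq z (h.sphere_subset k hz), Finset.sum_comm]
  refine Finset.sum_congr rfl fun s hs => ?_
  rw [← Finset.mul_sum]
  congr 1
  have hnot : ∀ k, s ∉ Metric.ball (c k) (sepRadius d k) →
      (∮ z in C(c k, sepRadius d k), (s - z)⁻¹) = 0 := fun k hk =>
    circleIntegral_inv_sub_of_notMem (h.radius_pos k).le fun hk' => hroot s hs (h.sphere_subset k
      (Metric.mem_sphere.2 (le_antisymm hk' (not_lt.1 hk))))
  by_cases hs1 : ‖s‖ ≤ 1
  · have hsm := hm s hs hs1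
    have hsm' : ‖s - c (m s)‖ < sepRadius d (m s) := by rwa [mem_ball_iff_norm] at hsm
    have hlt : ‖s‖ < 1 := h.norm_lt_one (k := m s) (by linarith [h.radius_le (m s), h.pos (m s)])
    rw [circleIntegral_inv_sub_of_mem (mem_ball_zero_iff.2 hlt), Finset.sum_eq_single (m s),
      circleIntegral_inv_sub_of_mem hsm]
    · intro k _ hk
      refine hnot k fun hk' => ?_
      rw [mem_ball_iff_norm] at hk'
      have := h.outside_other hk (z := s) (by linarith [h.radius_le (m s), h.pos (m s)])
      linarith [h.radius_le k, h.pos k]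
    · exact fun hk => absurd (Finset.mem_range.2 (Nat.lt_succ_of_le (Finset.le_sup hs))) hk
  · rw [circleIntegral_inv_sub_of_notMem zero_le_one (by simpa using hs1)]
    refine (Finset.sum_eq_zero fun k _ => hnot k fun hk => hs1 ?_).symm
    rw [mem_ball_iff_norm] at hk
    exact (h.norm_lt_one (k := k) (by linarith [h.radius_le k, h.pos k])).le

/-- The difference between the integral over the unit circle and the sum over the removed circles
vanishes on rational functions and has norm at most `2π (1 + ∑ r_k)`, but it is `-2πi · area(K₀)` at
`φ`. A rational function within `ε` of `φ` gives a contradiction once `ε (1 + ∑ r_k) < area(K₀)`. -/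
lemma cauchyTransform_notMem_ratClosure (h : IsSeparatedSequence K₀ c d) (hK₀ : IsCompact K₀)
    (hball : ∀ z ∈ K₀, ‖z‖ ≤ 3 / 4) (hvol : 0 < volume.real K₀)
    {φ : C(diskMinusDisks c (sepRadius d), ℂ)}
    (hφ : ∀ z : diskMinusDisks c (sepRadius d), φ z = areaCauchy (K₀.indicator fun _ => 1) z) :
    φ ∉ ratClosure (diskMinusDisks c (sepRadius d)) := by
  intro hmem
  have hcs : CompactSpace (diskMinusDisks c (sepRadius d)) :=
    isCompact_iff_compactSpace.1 (isCompact_diskMinusDisks _ _)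
  have hpi := Real.pi_pos
  set Φ := areaCauchy (K₀.indicator fun _ => 1) with hΦ
  have hΦc : Continuous Φ := continuous_areaCauchy_indicator hK₀ continuous_const
  set S := ∑' k, sepRadius d k with hS
  have hS0 : 0 ≤ S := tsum_nonneg fun k => (h.radius_pos k).le
  obtain ⟨ε, hε, hεS⟩ : ∃ ε > 0, ε * (1 + S) < volume.real K₀ :=
    ⟨volume.real K₀ / (2 * (1 + S)), by positivity, by
      rw [div_mul_eq_mul_div, div_lt_iff₀ (by positivity)]
      nlinarith⟩
  obtain ⟨f, ⟨p, q, hq, hf⟩, hφf⟩ := Metric.mem_closure_iff.1 hmem ε hε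
  have hclose : ∀ z ∈ diskMinusDisks c (sepRadius d),
      ‖Φ z - p.eval z / q.eval z‖ ≤ ε := fun z hz => by
    have := (ContinuousMap.dist_apply_le_dist (⟨z, hz⟩ : diskMinusDisks c (sepRadius d))).trans
      hφf.le
    rwa [dist_eq_norm, hφ, hf] at this
  obtain ⟨N, hN⟩ := h.circleIntegral_rational p q hq
  have hint : ∀ (x : ℂ) R, 0 < R → Metric.sphere x R ⊆ diskMinusDisks c (sepRadius d) →
      ‖(∮ z in C(x, R), Φ z) - ∮ z in C(x, R), p.eval z / q.eval z‖ ≤ 2 * Real.pi * R * ε := by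
    intro x R hR hsub
    have hpq : CircleIntegrable (fun z => p.eval z / q.eval z) x R :=
      (p.continuous.continuousOn.div q.continuous.continuousOn fun z hz =>
        hq z (hsub hz)).circleIntegrable hR.le
    rw [← circleIntegral.integral_sub (hΦc.continuousOn.circleIntegrable hR.le) hpq]
    exact circleIntegral.norm_integral_le_of_norm_le_const hR.le fun z hz => hclose z (hsub hz)
  -- `φ` is holomorphic in the removed disks themselves, because these miss `K₀`.
  have hzero : ∀ k, (∮ z in C(c k, sepRadius d k), Φ z) = 0 := fun k => by
    refine Complex.circleIntegral_eq_zero_of_differentiable_on_off_countable (h.radius_pos k).le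
      Set.countable_empty hΦc.continuousOn fun z hz => ?_
    refine (differentiableOn_areaCauchy_indicator hK₀ continuous_const).differentiableAt
      (hK₀.isClosed.isOpen_compl.mem_nhds (h.notMem_of_norm_sub_lt (k := k) ?_))
    have h1 : ‖z - c k‖ < sepRadius d k := by simpa [Complex.dist_eq] using hz.1
    linarith [h.radius_le k, h.pos k]
  have h0 := hint 0 1 one_pos h.unit_sphere_subset
  rw [circleIntegral_areaCauchy_indicator hK₀ (by norm_num : (3 / 4 : ℝ) < 1) hball, hN] at h0
  have h1 : ‖∑ k ∈ Finset.range N, ∮ z in C(c k, sepRadius d k), p.eval z / q.eval z‖ ≤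
      2 * Real.pi * ε * S := by
    refine (norm_sum_le _ _).trans ((Finset.sum_le_sum fun k _ => ?_).trans
      (b := ∑ k ∈ Finset.range N, 2 * Real.pi * ε * sepRadius d k) ?_)
    · have := hint (c k) _ (h.radius_pos k) (h.sphere_subset k)
      rw [hzero, zero_sub, norm_neg] at this
      linarith
    · rw [← Finset.mul_sum]
      exact mul_le_mul_of_nonneg_left (h.summable_radius.sum_le_tsum _ fun k _ =>
        (h.radius_pos k).le) (by positivity)
  have h2 : ‖-(2 * Real.pi * Complex.I) * (volume.real K₀ : ℂ)‖ = 2 * Real.pi * volume.real K₀ := by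
    simp [abs_of_pos hpi, abs_of_pos hvol]
  have h3 := norm_sub_norm_le (-(2 * Real.pi * Complex.I) * (volume.real K₀ : ℂ))
    (∑ k ∈ Finset.range N, ∮ z in C(c k, sepRadius d k), p.eval z / q.eval z)
  nlinarith

end IsSeparatedSequence

/-! ### Splitting off the singularities in the removed disks -/

/-- A function holomorphic in an annulus differs from a function holomorphic in the outer disk by
a function holomorphic outside the inner disk. -/
lemma exists_singular_part {F : ℂ → ℂ} (hF : Continuous F) {c : ℂ} {r R : ℝ} (hr : 0 < r)
    (hrR : r < R) (hd : DifferentiableOn ℂ F {z | r < ‖z - c‖ ∧ ‖z - c‖ < R}) :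
    ∃ e : ℂ → ℂ, Continuous e ∧ DifferentiableOn ℂ e {z | r < ‖z - c‖} ∧
      DifferentiableOn ℂ (fun z => F z - e z) (Metric.ball c R) ∧
      ∀ M, (∀ z, ‖z - c‖ ≤ R → ‖F z - F c‖ ≤ M) →
        (∀ z, r < ‖z - c‖ → ‖e z‖ ≤ M * r / (‖z - c‖ - r)) ∧
        ∀ z, ‖z - c‖ < R → ‖e z‖ ≤ M + M * R / (R - ‖z - c‖) := by
  obtain ⟨g, h, hgc, hgd, hhc, hhd, hgh, hM⟩ := exists_laurent_splitting hr hrR hF.continuousOn hd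
  classical
  -- On the closed annulus both formulas agree by the splitting; together they extend the principal
  -- part `h` continuously to the plane, and `F - e = g` on the whole outer disk whatever `F` is
  -- inside the inner one.
  set e : ℂ → ℂ := fun z => if r ≤ ‖z - c‖ then h z else F z - g z with he
  have e1 : ∀ z, r ≤ ‖z - c‖ → e z = h z := fun z hz => if_pos hz
  have e2 : ∀ z, ‖z - c‖ ≤ R → e z = F z - g z := fun z hz => by
    by_cases h1 : r ≤ ‖z - c‖
    · rw [e1 z h1, hgh z h1 hz, add_sub_cancel_left]
    · exact if_neg h1
  refine ⟨e, ?_, hhd.congr fun z hz => e1 z (le_of_lt hz), hgd.congr fun z hz => ?_,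
    fun M hFM => ?_⟩
  · rw [← continuousOn_univ]
    have hu : Set.univ = {z | r ≤ ‖z - c‖} ∪ Metric.closedBall c R := by
      ext z
      rw [Set.mem_union, mem_closedBall_iff_norm]
      refine iff_of_true trivial ?_
      rcases le_total r ‖z - c‖ with h1 | h1
      · exact .inl h1
      · exact .inr (h1.trans hrR.le)
    rw [hu]
    refine (hhc.congr fun z hz => e1 z hz).union_of_isClosed
      ((hF.continuousOn.sub hgc).congr fun z hz => e2 z (mem_closedBall_iff_norm.1 hz))
      (isClosed_le continuous_const (by fun_prop)) Metric.isClosed_closedBall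
  · rw [e2 z (mem_ball_iff_norm.1 hz).le, sub_sub_cancel]
  · obtain ⟨h1, h2⟩ := hM (F c) M fun z _ hz => hFM z hz
    refine ⟨fun z hz => by rw [e1 z hz.le]; exact h1 z hz, fun z hz => ?_⟩
    rw [e2 z hz.le, ← sub_sub_sub_cancel_right (F z) (g z) (F c)]
    exact (norm_sub_le _ _).trans (add_le_add (hFM z hz.le) (h2 z hz))

open scoped BoundedContinuousFunction in
-- Once the terms in `s` are removed, the partial sums are holomorphic in `U` and converge
-- uniformly.
lemma differentiableOn_sub_of_hasSum {e : ℕ → ℂ →ᵇ ℂ} {E : ℂ →ᵇ ℂ} (hE : HasSum e E) {U : Set ℂ}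
    (hU : IsOpen U) (s : Finset ℕ) (hd : ∀ j, j ∉ s → DifferentiableOn ℂ (e j) U) :
    DifferentiableOn ℂ (fun z => E z - ∑ j ∈ s, e j z) U := by
  have h1 : Tendsto (fun n => ∑ j ∈ Finset.range n, e j - ∑ j ∈ s, e j) atTop
      (𝓝 (E - ∑ j ∈ s, e j)) := hE.tendsto_sum_nat.sub_const _
  have h2 := (BoundedContinuousFunction.tendsto_iff_tendstoUniformly.1 h1).tendstoUniformlyOn
    (s := U)
  have h3 := h2.tendstoLocallyUniformlyOn.differentiableOn ?_ hU
  · refine h3.congr fun z _ => by simp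
  · filter_upwards [eventually_ge_atTop (s.sup id + 1)] with n hn
    have hs : s ⊆ Finset.range n := fun j hj => Finset.mem_range.2
      ((Nat.lt_succ_of_le (Finset.le_sup (f := id) hj)).trans_le hn)
    refine (DifferentiableOn.fun_sum (u := Finset.range n \ s) (A := fun j => ⇑(e j))
      fun j hj => hd j (Finset.mem_sdiff.1 hj).2).congr fun z _ => ?_
    rw [← Finset.sum_sdiff hs]
    simp

/-! ### Decomposition of the functions in `A(K)` and the inclusion in `HP(φ, K)` -/

namespace IsSeparatedSequence

variable {K₀ : Set ℂ} {c : ℕ → ℂ} {d : ℕ → ℝ}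

/-- Small functions singular in distinct removed disks have a uniformly convergent sum. -/
lemma sum_norm_le (h : IsSeparatedSequence K₀ c d) {e : ℕ → ℂ → ℂ} {ε : ℝ} {t : Finset ℕ}
    (he : ∀ k ∈ t, (∀ z, ‖z - c k‖ < d k / 4 → ‖e k z‖ ≤ 3 * ε) ∧
      ∀ z, d k / 4 ≤ ‖z - c k‖ → ‖e k z‖ ≤ ε * (1 / 2) ^ k) (hε : 0 ≤ ε) (z : ℂ) :
    ∑ k ∈ t, ‖e k z‖ ≤ 5 * ε := by
  classical
  have hgeo : ∀ s : Finset ℕ, ∑ k ∈ s, ε * (1 / 2 : ℝ) ^ k ≤ 2 * ε := fun s => by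
    rw [← Finset.mul_sum, mul_comm 2]
    refine mul_le_mul_of_nonneg_left ?_ hε
    refine le_of_le_of_eq ?_ tsum_geometric_two
    exact summable_geometric_two.sum_le_tsum _ fun k _ => by positivity
  -- At most one disk of radius `d k / 4` contains `z`; its term is at most `3ε`, and the remaining
  -- ones add up to at most `2ε`.
  by_cases hz : ∃ k ∈ t, ‖z - c k‖ < d k / 4
  · obtain ⟨k, hk, hkz⟩ := hz
    rw [← Finset.add_sum_erase _ _ hk]
    have h1 := (he k hk).1 z hkz
    have h2 := (Finset.sum_le_sum fun j hj => (he j (Finset.mem_erase.1 hj).2).2 z (by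
      have := h.outside_other (Finset.mem_erase.1 hj).1 (z := z) (by linarith [h.pos k])
      linarith [h.pos j])).trans (hgeo (t.erase k))
    linarith
  · push Not at hz
    have := (Finset.sum_le_sum fun k hk => (he k hk).2 z (hz k hk)).trans (hgeo t)
    linarith

/-- Every function of `A(K)` is, up to an element of `R(K)`, continuous on the plane and
holomorphic in the unit disk off `K₀`. -/
lemma exists_sub_mem_ratClosure (h : IsSeparatedSequence K₀ c d) (hK₀ : IsCompact K₀)
    {f : C(diskMinusDisks c (sepRadius d), ℂ)}
    (hf : f ∈ analyticAlgebra (diskMinusDisks c (sepRadius d))) :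
    ∃ (F : ℂ → ℂ) (g : C(diskMinusDisks c (sepRadius d), ℂ)), Continuous F ∧
      DifferentiableOn ℂ F (Metric.ball 0 1 \ K₀) ∧
      g ∈ ratClosure (diskMinusDisks c (sepRadius d)) ∧ ∀ z, f z = F z + g z := by
  have hcs : CompactSpace (diskMinusDisks c (sepRadius d)) :=
    isCompact_iff_compactSpace.1 (isCompact_diskMinusDisks _ _)
  -- Tietze extension. The values of `f₁` in the removed disks are arbitrary; subtracting the
  -- singular parts corrects them.
  obtain ⟨f₁, hf₁⟩ := f.exists_restrict_eq (isCompact_diskMinusDisks _ _).isClosed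
  have hff : ∀ z : diskMinusDisks c (sepRadius d), f₁ z = f z := fun z => by rw [← hf₁]; rfl
  have hfd : DifferentiableOn ℂ f₁ (interior (diskMinusDisks c (sepRadius d))) :=
    (mem_analyticAlgebra.1 hf).congr fun z hz => by
      rw [extendZero_apply f (interior_subset hz), ← hff]
  have hrlt : ∀ k, sepRadius d k < d k / 2 := fun k => by linarith [h.radius_le k, h.pos k]
  have hex := fun k => exists_singular_part f₁.continuous (h.radius_pos k) (hrlt k)
    (hfd.mono fun z hz => h.mem_interior_of_annulus hz.1 hz.2)
  choose e hec hed hefd heM using hex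
  -- With outer radius `d k / 2`, the bound near the centre is `M + 2M`. At distance at least `d k /
  -- 4`, the quotient of the radius by the distance to the removed disk is at most `2⁻ᵏ / 3`, since
  -- `1/4 - 1/16 = 3/16`.
  have hbound : ∀ k M, (∀ z, ‖z - c k‖ ≤ d k / 2 → ‖f₁ z - f₁ (c k)‖ ≤ M) →
      (∀ z, ‖z - c k‖ < d k / 4 → ‖e k z‖ ≤ 3 * M) ∧
      ∀ z, d k / 4 ≤ ‖z - c k‖ → ‖e k z‖ ≤ M * (1 / 2) ^ k := by
    intro k M hM
    have hk := h.pos k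
    have hM0 : 0 ≤ M := (norm_nonneg _).trans (hM (c k) (by simpa using by linarith))
    refine ⟨fun z hz => ((heM k M hM).2 z (by linarith)).trans ?_, fun z hz =>
      ((heM k M hM).1 z (by linarith [h.radius_le k])).trans ?_⟩
    · have : M * (d k / 2) / (d k / 2 - ‖z - c k‖) ≤ 2 * M := by
        rw [div_le_iff₀ (by linarith)]
        nlinarith
      linarith
    · rw [mul_div_assoc]
      refine mul_le_mul_of_nonneg_left ?_ hM0
      have h1 := h.radius_le k
      rw [div_le_iff₀ (by linarith), sepRadius, pow_add]
      have h2 : 0 < (1 / 2 : ℝ) ^ k := by positivity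
      have h3 : 3 / 16 * d k ≤ ‖z - c k‖ - sepRadius d k := by linarith
      have h4 := mul_le_mul_of_nonneg_left h3 h2.le
      rw [sepRadius, pow_add] at h4
      nlinarith
  have hosc : ∀ ε > 0, ∃ n : ℕ, ∀ k, n ≤ k → ∀ z, ‖z - c k‖ ≤ d k / 2 →
      ‖f₁ z - f₁ (c k)‖ ≤ ε := by
    intro ε hε
    obtain ⟨δ, hδ, hu⟩ := Metric.uniformContinuousOn_iff.1
      ((isCompact_closedBall (0 : ℂ) 1).uniformContinuousOn_of_continuous
        f₁.continuous.continuousOn) ε hε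
    obtain ⟨n, hn⟩ := (h.tendsto_d.eventually_lt_const hδ).exists_forall_of_atTop
    refine ⟨n, fun k hk z hz => ?_⟩
    have hdk := h.pos k
    rw [← dist_eq_norm]
    refine (hu z ?_ (c k) ?_ ?_).le
    · exact mem_closedBall_zero_iff.2 (h.norm_lt_one (k := k) (by linarith)).le
    · exact mem_closedBall_zero_iff.2 (h.norm_lt_one (k := k) (by simpa using hdk)).le
    · rw [dist_eq_norm]; linarith [hn k hk]
  have hbdd : ∀ k, ∃ B, ∀ z, ‖e k z‖ ≤ B := by
    intro k
    obtain ⟨B, hB⟩ := (isCompact_closedBall (c k) (d k / 2)).exists_bound_of_continuousOn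
      (f := fun z => f₁ z - f₁ (c k)) (f₁.continuous.sub continuous_const).continuousOn
    have hB' : ∀ z, ‖z - c k‖ ≤ d k / 2 → ‖f₁ z - f₁ (c k)‖ ≤ B := fun z hz =>
      hB z (mem_closedBall_iff_norm.2 hz)
    have hB0 : 0 ≤ B := (norm_nonneg _).trans (hB' (c k) (by
      rw [sub_self, norm_zero]; exact (half_pos (h.pos k)).le))
    obtain ⟨h1, h2⟩ := hbound k B hB'
    refine ⟨3 * B, fun z => ?_⟩
    rcases lt_or_ge ‖z - c k‖ (d k / 4) with hz | hz
    · exact h1 z hz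
    · have : (1 / 2 : ℝ) ^ k ≤ 1 := pow_le_one₀ (by norm_num) (by norm_num)
      nlinarith [h2 z hz]
  choose B hB using hbdd
  set eb : ℕ → BoundedContinuousFunction ℂ ℂ := fun k =>
    BoundedContinuousFunction.ofNormedAddCommGroup (e k) (hec k) (B k) (hB k) with heb
  -- The norms of the singular parts tend to `0` but need not be summable. The Cauchy criterion
  -- holds since at each point all but one of the terms are geometrically small, while the
  -- oscillation of `f₁` on the disks tends to `0`.
  have hsum : Summable eb := by
    refine summable_iff_vanishing_norm.2 fun ε hε => ?_
    obtain ⟨n, hn⟩ := hosc (ε / 6) (by positivity)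
    refine ⟨Finset.range n, fun t ht => ?_⟩
    refine lt_of_le_of_lt ((BoundedContinuousFunction.norm_le (C := 5 * (ε / 6)) (by positivity)).2
      fun z => ?_) (by linarith)
    have h1 : (∑ k ∈ t, eb k) z = ∑ k ∈ t, e k z := by simp [heb]
    rw [h1]
    refine (norm_sum_le _ _).trans (h.sum_norm_le (fun k hk => ?_) (by positivity) z)
    refine hbound k _ (hn k (not_lt.1 fun hkn => ?_))
    exact Finset.disjoint_left.1 ht hk (Finset.mem_range.2 hkn)
  obtain ⟨E, hE⟩ := hsum
  have hKr : ∀ k, ∀ z ∈ diskMinusDisks c (sepRadius d), sepRadius d k ≤ ‖z - c k‖ :=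
    fun k z hz => (mem_diskMinusDisks.1 hz).2 k
  have hek : ∀ k, (eb k).toContinuousMap.restrict (diskMinusDisks c (sepRadius d)) ∈
      ratClosure (diskMinusDisks c (sepRadius d)) := by
    intro k
    obtain ⟨M, hM⟩ := (isCompact_closedBall (c k) (d k / 2)).exists_bound_of_continuousOn
      (f := fun z => f₁ z - f₁ (c k)) (f₁.continuous.sub continuous_const).continuousOn
    exact mem_ratClosure (h.radius_pos k) (hKr k) (hec k).continuousOn (hed k)
      (heM k M fun z hz => hM z (mem_closedBall_iff_norm.2 hz)).1 fun z => rfl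
  refine ⟨fun z => f₁ z - E z, E.toContinuousMap.restrict _, f₁.continuous.sub E.continuous, ?_, ?_,
    fun z => ?_⟩
  · intro z hz
    refine DifferentiableAt.differentiableWithinAt ?_
    -- Near the `k`-th removed disk, `f₁ - e k` is holomorphic and all the other singular parts are
    -- too. Away from all the disks, `f₁` and each `e j` are separately holomorphic.
    by_cases hk : ∃ k, ‖z - c k‖ < d k / 2
    · obtain ⟨k, hk⟩ := hk
      have h1 := differentiableOn_sub_of_hasSum hE Metric.isOpen_ball {k} (U := Metric.ball (c k)
        (d k / 2)) fun j hj => (hed j).mono fun y hy => by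
          have := h.outside_other (Finset.notMem_singleton.1 hj) (mem_ball_iff_norm.1 hy).le
          exact (hrlt j).trans_le this
      have h2 := ((hefd k).sub h1).differentiableAt
        (Metric.isOpen_ball.mem_nhds (mem_ball_iff_norm.2 hk))
      refine h2.congr_of_eventuallyEq (Eventually.of_forall fun y => ?_)
      simp [heb]
    · push Not at hk
      have hzk : ∀ k, sepRadius d k < ‖z - c k‖ := fun k => (hrlt k).trans_le (hk k)
      have h1 := differentiableOn_sub_of_hasSum hE isOpen_interior ∅
        (U := interior {y | ∀ k, sepRadius d k < ‖y - c k‖}) fun j _ =>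
          (hed j).mono fun y hy => interior_subset hy j
      have h2 := h1.differentiableAt (isOpen_interior.mem_nhds
        (mem_interior_iff_mem_nhds.2 (h.eventually_outside hK₀ hz.2 hzk)))
      have h3 := hfd.differentiableAt (isOpen_interior.mem_nhds
        (h.mem_interior hK₀ (mem_ball_zero_iff.1 hz.1) hz.2 hzk))
      refine (h3.sub h2).congr_of_eventuallyEq (Eventually.of_forall fun y => ?_)
      simp
  · rw [← SetLike.mem_coe, ← (isClosed_ratClosure _).closure_eq]
    refine mem_closure_of_forall_norm_le fun ε hε => ?_
    obtain ⟨n, hn⟩ := (Metric.tendsto_nhds.1 hE.tendsto_sum_nat ε hε).exists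
    refine ⟨∑ k ∈ Finset.range n, (eb k).toContinuousMap.restrict _,
      Submodule.sum_mem _ fun k _ => hek k, fun z => ?_⟩
    have h1 := (BoundedContinuousFunction.dist_coe_le_dist (z : ℂ)).trans hn.le
    rw [dist_comm, dist_eq_norm] at h1
    have e1 : (∑ k ∈ Finset.range n, eb k) z = ∑ k ∈ Finset.range n, eb k z := by simp
    rw [e1] at h1
    rw [ContinuousMap.sum_apply]
    exact h1
  · simp [hff]

/-- `A(K)` is contained in `HP(φ, K)`, where `φ` is the Cauchy
transform of the area of `K₀`. -/
lemma analyticAlgebra_le_HP (h : IsSeparatedSequence K₀ c d) (hK₀ : IsCompact K₀)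
    (hball : ∀ z ∈ K₀, ‖z‖ ≤ 3 / 4) {a : ℝ} (ha : 0 < a) {σ : ℕ → ℝ} (hσ : ∀ n, 0 < σ n)
    (hσ0 : Tendsto σ atTop (𝓝 0))
    (hp : ∀ n, ∀ p ∈ K₀,
      ENNReal.ofReal (a * σ n ^ 2) ≤ volume (K₀ ∩ Metric.closedBall p (2 * σ n)))
    (hdense : (closure (polynomialFunctions K₀ : Set C(K₀, ℂ))) = Set.univ)
    {φ : C(diskMinusDisks c (sepRadius d), ℂ)}
    (hφ : ∀ z : diskMinusDisks c (sepRadius d), φ z = areaCauchy (K₀.indicator fun _ => 1) z) :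
    Subalgebra.toSubmodule (analyticAlgebra (diskMinusDisks c (sepRadius d))) ≤ HP φ := by
  intro f hf
  have hcs : CompactSpace (diskMinusDisks c (sepRadius d)) :=
    isCompact_iff_compactSpace.1 (isCompact_diskMinusDisks _ _)
  have hKb : diskMinusDisks c (sepRadius d) ⊆ Metric.closedBall 0 1 := Set.sdiff_subset
  have hPHP := (polyClosure_le_ratClosure (diskMinusDisks c (sepRadius d))).trans
    (ratClosure_le_HP φ)
  obtain ⟨F, g, hFc, hFd, hg, hfg⟩ := h.exists_sub_mem_ratClosure hK₀ hf
  -- Splitting in the annulus `3/4 < |z| < 1`, free of `K₀`, leaves `F - e` in the disk algebra and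
  -- makes `e` holomorphic on the whole plane off `K₀`, so beyond the unit circle too.
  obtain ⟨e, hec, hed, hFe, -⟩ := exists_singular_part hFc (c := 0) (r := 3 / 4) (R := 1)
    (by norm_num) (by norm_num) (hFd.mono fun z hz => by
      simp only [sub_zero, Set.mem_ofPred_eq] at hz
      exact ⟨mem_ball_zero_iff.2 hz.2, fun hzK => by linarith [hball z hzK]⟩)
  simp only [sub_zero] at hed
  have hed' : ∀ z ∉ K₀, DifferentiableAt ℂ e z := fun z hz => by
    rcases lt_or_ge (3 / 4) ‖z‖ with h1 | h1
    · exact hed.differentiableAt ((isOpen_lt continuous_const continuous_norm).mem_nhds h1)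
    · have hz1 : z ∈ Metric.ball (0 : ℂ) 1 := mem_ball_zero_iff.2 (by linarith)
      have h2 := (hFd.differentiableAt ((Metric.isOpen_ball.sdiff hK₀.isClosed).mem_nhds
        ⟨hz1, hz⟩)).sub (hFe.differentiableAt (Metric.isOpen_ball.mem_nhds hz1))
      exact h2.congr_of_eventuallyEq (Eventually.of_forall fun y => by simp)
  -- `exists_cauchy_approx` asks for bounded support and for holomorphy only in the disk of radius
  -- `2`; this cut-off equals `1` there and vanishes beyond radius `3`.
  set χ : ℂ → ℝ := fun z => max 0 (min 1 (3 - ‖z‖)) with hχ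
  have hχ1 : ∀ z ∈ Metric.ball (0 : ℂ) 2, χ z = 1 := fun z hz => by
    rw [mem_ball_zero_iff] at hz
    simp only [hχ]
    rw [min_eq_left (by linarith), max_eq_right zero_le_one]
  have hχc : Continuous χ := by fun_prop
  have hsupp : ∀ w, e w * χ w ≠ 0 → ‖w‖ ≤ 3 := fun w hw => by
    by_contra! h3
    refine hw ?_
    simp only [hχ]
    rw [max_eq_left ((min_le_right _ _).trans (by linarith)), Complex.ofReal_zero, mul_zero]
  have hed2 : DifferentiableOn ℂ (fun z => e z * χ z) (Metric.ball 0 2 \ K₀) := fun z hz =>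
    ((hed' z hz.2).differentiableWithinAt).congr (fun y hy => by simp [hχ1 y hy.1])
      (by simp [hχ1 z hz.1])
  rw [← SetLike.mem_coe, ← (isClosed_HP φ).closure_eq]
  refine mem_closure_of_forall_norm_le fun ε hε => ?_
  obtain ⟨k, G, hk, hG, happ⟩ := exists_cauchy_approx hK₀ ha hσ hσ0 hp
    (hec.mul (Complex.continuous_ofReal.comp hχc)) hsupp hed2 hε
  have hsub : Metric.closedBall (0 : ℂ) 1 ⊆ Metric.ball 0 (3 / 2) :=
    Metric.closedBall_subset_ball (by norm_num)
  set f₁ : C(diskMinusDisks c (sepRadius d), ℂ) := ⟨fun z => F z - e z, by fun_prop⟩ with hf₁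
  set f₂ : C(diskMinusDisks c (sepRadius d), ℂ) := ⟨fun z => G z,
    (hG.continuousOn.mono (hKb.trans hsub)).domRestrict⟩ with hf₂
  set f₃ : C(diskMinusDisks c (sepRadius d), ℂ) := ⟨fun z => areaCauchy (K₀.indicator k) z,
    (continuous_areaCauchy_indicator hK₀ hk).comp continuous_subtype_val⟩ with hf₃
  have h1 : f₁ ∈ HP φ := hPHP (mem_polyClosure hKb (hFc.sub hec).continuousOn hFe fun z => rfl)
  have h2 : f₂ ∈ HP φ := hPHP (mem_polyClosure hKb (hG.continuousOn.mono hsub)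
    (hG.mono (Metric.ball_subset_closedBall.trans hsub)) fun z => rfl)
  have h3 : f₃ ∈ HP φ := areaCauchy_mem_HP hK₀ hKb (fun w hw => by linarith [hball w hw]) hdense hφ
    hk fun z => rfl
  -- The sum has its pieces in `R(K)`, in `P(K)` twice, and among the Cauchy transforms on `K₀`. Its
  -- difference from `f` is exactly the error in approximating `e`.
  refine ⟨g + f₁ + (f₂ + f₃), (HP φ).add_mem ((HP φ).add_mem (ratClosure_le_HP φ hg) h1)
    ((HP φ).add_mem h2 h3), fun z => ?_⟩
  have h4 : ‖e z * χ z - (G z + areaCauchy (K₀.indicator k) z)‖ ≤ ε := happ z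
  have h5 : χ z = 1 := hχ1 z (mem_ball_zero_iff.2 (by
    have := mem_closedBall_zero_iff.1 (hKb z.2)
    linarith))
  rw [h5, Complex.ofReal_one, mul_one] at h4
  convert h4 using 2
  have e1 : (g + f₁ + (f₂ + f₃)) z =
      g z + (F z - e z) + (G z + areaCauchy (K₀.indicator k) z) := rfl
  rw [e1, hfg]
  ring

end IsSeparatedSequence

lemma closure_polynomialFunctions_planarCantor {a : ℝ} (ha0 : 0 < a) (ha1 : a < 1) :
    closure (polynomialFunctions (planarCantor a) : Set C(planarCantor a, ℂ)) = Set.univ := by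
  have hcs : CompactSpace (planarCantor a) :=
    isCompact_iff_compactSpace.1 (isCompact_planarCantor a)
  have h1 := polynomialFunctions_dense (K := planarCantor a) fun z hz w hw hzw => by
    obtain ⟨t, ht, h1⟩ := exists_separating_line ha0 ha1 hz hw hzw
    refine ⟨t, ?_⟩
    have hre : ∀ x ∈ planarCantor a, x.re ≠ t := fun x hx hxt =>
      ht (hxt ▸ (mem_planarCantor.1 hx).1)
    have him : ∀ x ∈ planarCantor a, x.im ≠ t := fun x hx hxt =>
      ht (hxt ▸ (mem_planarCantor.1 hx).2)
    tauto
  rw [← Subalgebra.topologicalClosure_coe, h1, Algebra.coe_top]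


end

/-! ### The example -/

theorem proposition1 (a : ℝ) (ha0 : 0 < a) (ha1 : a < 1) :
    IsCompact (planarCantor a) ∧
    planarCantor a ⊆ Metric.ball 0 1 ∧
    volume (planarCantor a) = ENNReal.ofReal a ∧
    (∀ z : ℂ, Integrable (fun w : ℂ => 1 / (w - z)) (volume.restrict (planarCantor a))) ∧
    ∃ (c : ℕ → ℂ) (r : ℕ → ℝ),
      IsDiskSequence (planarCantor a) c r ∧
      IsCompact (diskMinusDisks c r) ∧
      ∃ φ : C(diskMinusDisks c r, ℂ),
        (∀ z : diskMinusDisks c r,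
          φ z = cauchyTransform (volume.restrict (planarCantor a)) (z : ℂ)) ∧
        φ ∈ analyticAlgebra (diskMinusDisks c r) ∧
        ratClosure (diskMinusDisks c r) ≠
          Subalgebra.toSubmodule (analyticAlgebra (diskMinusDisks c r)) ∧
        Subalgebra.toSubmodule (analyticAlgebra (diskMinusDisks c r)) = HP φ := by
  have hK₀ := isCompact_planarCantor a
  have hball : ∀ z ∈ planarCantor a, ‖z‖ ≤ 3 / 4 := fun z hz => norm_le_of_mem_planarCantor hz
  have hvol := volume_planarCantor ha0 ha1
  have hvr : volume.real (planarCantor a) = a := by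
    rw [measureReal_def, hvol, ENNReal.toReal_ofReal ha0.le]
  have hne : (planarCantor a).Nonempty := by
    rw [Set.nonempty_iff_ne_empty]
    intro h0
    rw [h0, measureReal_empty] at hvr
    exact ha0.ne hvr
  refine ⟨hK₀, fun z hz => mem_ball_zero_iff.2 (by linarith [hball z hz]), hvol, fun z => ?_, ?_⟩
  · rw [← IntegrableOn, ← integrable_indicator_iff hK₀.measurableSet]
    refine (integrable_indicator_kernel hK₀ (continuous_const (y := (1 : ℂ))) z).congr
      (ae_of_all _ fun w => ?_)
    by_cases hw : w ∈ planarCantor a <;> simp [hw]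
  obtain ⟨c, d, h⟩ := exists_separatedSequence hK₀ hne (interior_planarCantor ha0 ha1) hball
  have hcs : CompactSpace (diskMinusDisks c (sepRadius d)) :=
    isCompact_iff_compactSpace.1 (IsSeparatedSequence.isCompact_diskMinusDisks _ _)
  set φ : C(diskMinusDisks c (sepRadius d), ℂ) :=
    ⟨fun z => areaCauchy ((planarCantor a).indicator fun _ => 1) z,
      (continuous_areaCauchy_indicator hK₀ continuous_const).comp continuous_subtype_val⟩ with hφ
  have hφA : φ ∈ analyticAlgebra (diskMinusDisks c (sepRadius d)) :=
    mem_analyticAlgebra.2 (((differentiableOn_areaCauchy_indicator hK₀ continuous_const).mono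
      fun z hz => h.disjoint_interior hz).congr fun z hz =>
        extendZero_apply φ (interior_subset hz))
  refine ⟨c, sepRadius d, h.isDiskSequence, IsSeparatedSequence.isCompact_diskMinusDisks _ _, φ,
    fun z => (cauchyTransform_restrict hK₀.measurableSet _).symm, hφA, fun hRA => ?_, ?_⟩
  -- `φ` itself is the function of `A(K)` that is not in `R(K)`.
  · refine h.cauchyTransform_notMem_ratClosure hK₀ hball (hvr.symm ▸ ha0) (φ := φ)
      (fun z => rfl) ?_
    rw [hRA]
    exact hφA
  · exact le_antisymm (h.analyticAlgebra_le_HP hK₀ hball ha0 (cantorSide_pos ha0)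
      (tendsto_cantorSide ha0 ha1) (fun n p hp => le_volume_planarCantor_inter ha0 ha1 n hp)
      (closure_polynomialFunctions_planarCantor ha0 ha1) fun z => rfl)
      (HP_le_analyticAlgebra hφA)
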